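/- Let $m\ge 5$ and $n\ge 2$ be integers with $m-2n\notin\{0,1,2\}$, and put $d=\lfloor m/2\rfloor$. Let $\mathfrak g=\mathfrak{osp}(m|2n;\mathbb C)$ be the orthosymplectic Lie superalgebra of a split orthosymplectic metric on $\mathbb C^{m|2n}$, with the Cartan subalgebra of diagonal matrices and the usual weights $\epsilon_1,\dots,\epsilon_d$ (of $\mathfrak{so}(m)$) and $\delta_1,\dots,\delta_n$ (of $\mathfrak{sp}(2n)$). Consider two systems of simple roots. The standard one is $$\delta_1-\delta_2,\ \dots,\ \delta_{n-1}-\delta_n,\ \delta_n-\epsilon_1,\ \epsilon_1-\epsilon_2,\ \dots,\ \epsilon_{d-1}-\epsilon_d,\ \text{and } \epsilon_d \text{ if } m \text{ is odd},\ \epsilon_{d-1}+\epsilon_d \text{ if } m \text{ is even};$$ the non-standard one is $$\epsilon_1-\epsilon_2,\ \dots,\ \epsilon_{d-1}-\epsilon_d,\ \epsilon_d-\delta_1,\ \delta_1-\delta_2,\ \dots,\ \delta_{n-1}-\delta_n,\ \text{and } \delta_n \text{ if } m \text{ is odd},\ 2\delta_n \text{ if } m \text{ is even}.$$ Write $L_\lambda$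 (respectively $K_\mu$) for an irreducible $\mathfrak g$-representation of highest weight $\lambda$ for the standard (respectively $\mu$ for the non-standard) system. Let $\mathfrak g\otimes\mathfrak g$ be the second tensor power of the adjoint representation, with action $X\cdot(U\otimes V)=[X,U]\otimes V+(-1)^{|X||U|}U\otimes[X,V]$ for homogeneous $X,U$. Then $\mathfrak g\otimes\mathfrak g$ is the direct sum of six irreducible subrepresentations, $\mathfrak g\otimes\mathfrak g=W_1\oplus W_2\oplus W_3\oplus W_4\oplus W_5\oplus W_6$, where $$W_1\cong L_{2\delta_1+2\delta_2},\quad W_2\cong L_{3\delta_1+\delta_2},\quad W_3\cong L_{\delta_1+\delta_2},\quad W_4\cong L_{4\delta_1},\quad W_5\cong L_{2\delta_1},\quad W_6\cong L_0,$$ and, if $m\ge 8$, $$W_1\cong K_{2\epsilon_1+2\epsilon_2},\quad W_2\cong K_{2\epsilon_1+\epsilon_2+\epsilon_3},\quad W_3\cong K_{2\epsilon_1},\quad W_4\cong K_{\epsilon_1+\epsilon_2+\epsilon_3+\epsilon_4},\quad W_5\cong K_{\epsilon_1+\epsilon_2},\quad W_6\cong K_0.$$ For $m\in\{6,7\}$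 the same holds except that $W_4\cong K_{\epsilon_1+\epsilon_2+\epsilon_3+\delta_1}$; for $m=5$ the same holds except that $W_2\cong K_{2\epsilon_1+\epsilon_2+\delta_1}$ and $W_4\cong K_{\epsilon_1+\epsilon_2+2\delta_1}$. Moreover, the supersymmetric square $\mathfrak g\odot\mathfrak g=\operatorname{span}\{X\otimes Y+(-1)^{|X||Y|}Y\otimes X : X,Y \text{ homogeneous}\}$ equals $W_1\oplus W_3\oplus W_4\oplus W_6$. -/

import Mathlib

open scoped TensorProduct

noncomputable section

/-! ## Signs and the superspace `ℂ^{m|2n}` -/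

/-- The sign `(-1)^{ij}` for parities `i, j ∈ ℤ/2`. -/
def superSign (i j : ZMod 2) : ℂ := if i = 1 ∧ j = 1 then -1 else 1

lemma zmod_two_cases (i : ZMod 2) : i = 0 ∨ i = 1 := by
  revert i
  decide

/-- Labels of the standard basis `e_a` of `ℂ^{m|2n}`: `m` even ones, then `2n` odd ones. -/
abbrev OspIdx (m n : ℕ) : Type := Fin m ⊕ Fin (2 * n)

/-- The parity `[a]` of the basis vector `e_a`. -/
def idxParity {m n : ℕ} : OspIdx m n → ZMod 2 :=
  Sum.elim (fun _ => 0) (fun _ => 1)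

/-- The orthosymplectic metric `g_{ab}` in split form: the even basis vectors `e_i` and
`e_{m+1-i}` are paired with value `1`, the odd basis vectors number `j` and `2n+1-j` with value
`1` if `j ≤ n` and `-1` if `j > n` (labels counted from one). All other entries vanish. -/
def ospMetric (m n : ℕ) : Matrix (OspIdx m n) (OspIdx m n) ℂ
  | Sum.inl i, Sum.inl j => if j = Fin.rev i then 1 else 0
  | Sum.inr i, Sum.inr j => if j = Fin.rev i then (if i.val < n then 1 else -1) else 0
  | _, _ => 0

/-! ## The Lie superalgebra `osp(m|2n)` -/

/-- The superbracket of `gl(m|2n)`: the bilinear extension of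
`[A,B] = AB - (-1)^{|A||B|} BA` for homogeneous `A, B`; the matrix unit at position `(a,b)` is
homogeneous of parity `[a]+[b]`. -/
def superBracket {m n : ℕ} (A B : Matrix (OspIdx m n) (OspIdx m n) ℂ) :
    Matrix (OspIdx m n) (OspIdx m n) ℂ :=
  Matrix.of fun a b => ∑ c, (A a c * B c b -
    superSign (idxParity c + idxParity b) (idxParity a + idxParity c) * (B a c * A c b))

/-- The component of parity `k` of a matrix in `gl(m|2n)`. -/
def matrixPart {m n : ℕ} (k : ZMod 2) (A : Matrix (OspIdx m n) (OspIdx m n) ℂ) :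
    Matrix (OspIdx m n) (OspIdx m n) ℂ :=
  Matrix.of fun a b => if idxParity a + idxParity b = k then A a b else 0

/-- `osp(m|2n)`: the matrices `A` (with entries `A^a_b = A a b`) such that
`∑_c (g_{ac} A^c_b + (-1)^{[b]([a]+[c])} A^c_a g_{cb}) = 0` for all `a, b`. -/
def osp (m n : ℕ) : Submodule ℂ (Matrix (OspIdx m n) (OspIdx m n) ℂ) where
  carrier := {A | ∀ a b, ∑ c, (ospMetric m n a c * A c b +
    superSign (idxParity b) (idxParity a + idxParity c) * (A c a * ospMetric m n c b)) = 0}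
  zero_mem' := by intro a b; simp
  add_mem' := by
    intro A B hA hB a b
    rw [← add_zero (0 : ℂ)]
    nth_rewrite 1 [← hA a b]
    rw [← hB a b, ← Finset.sum_add_distrib]
    refine Finset.sum_congr rfl fun c _ => ?_
    simp only [Matrix.add_apply]
    ring
  smul_mem' := by
    intro t A hA a b
    rw [← mul_zero t, ← hA a b, Finset.mul_sum]
    refine Finset.sum_congr rfl fun c _ => ?_
    simp only [Matrix.smul_apply, smul_eq_mul]
    ring

/-- The duality `a ↦ a'` of labels with `g_{aa'} ≠ 0`. -/
def idxRev {m n : ℕ} : OspIdx m n → OspIdx m n := Sum.map Fin.rev Fin.rev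

/-- The nonzero entries of the metric. -/
def metricSign {m n : ℕ} : OspIdx m n → ℂ :=
  Sum.elim (fun _ => 1) (fun i => if i.val < n then 1 else -1)

lemma idxRev_idxRev {m n : ℕ} (a : OspIdx m n) : idxRev (idxRev a) = a := by
  cases a <;> simp [idxRev]

lemma idxParity_idxRev {m n : ℕ} (a : OspIdx m n) : idxParity (idxRev a) = idxParity a := by
  cases a <;> simp [idxRev, idxParity]

lemma ospMetric_eq {m n : ℕ} (a b : OspIdx m n) :
    ospMetric m n a b = if b = idxRev a then metricSign a else 0 := by
  cases a <;> cases b <;> simp [ospMetric, idxRev, metricSign]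

lemma metricSign_mul_self {m n : ℕ} (a : OspIdx m n) : metricSign a * metricSign a = 1 := by
  cases a with
  | inl i => simp [metricSign]
  | inr i => by_cases h : i.val < n <;> simp [metricSign, h]

lemma metricSign_idxRev {m n : ℕ} (a : OspIdx m n) :
    metricSign (idxRev a) = superSign (idxParity a) (idxParity a) * metricSign a := by
  cases a with
  | inl i => simp [metricSign, idxRev, idxParity, superSign]
  | inr i =>
    by_cases h : i.val < n
    · have h2 : ¬ (2 * n - (i.val + 1) < n) := by omega
      simp [metricSign, idxRev, idxParity, superSign, h, h2]
    · have h2 : 2 * n - (i.val + 1) < n := by omega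
      simp [metricSign, idxRev, idxParity, superSign, h, h2]

/-- The defining equations of `osp(m|2n)`, with the sums carried out. -/
lemma mem_osp_iff {m n : ℕ} (A : Matrix (OspIdx m n) (OspIdx m n) ℂ) :
    A ∈ osp m n ↔ ∀ a b, A (idxRev a) b =
      -(superSign (idxParity a) (idxParity b) * metricSign a * metricSign b *
        A (idxRev b) a) := by
  have key : ∀ a b, ∑ c, (ospMetric m n a c * A c b +
      superSign (idxParity b) (idxParity a + idxParity c) * (A c a * ospMetric m n c b)) =
      metricSign a * A (idxRev a) b + superSign (idxParity a) (idxParity b) * metricSign b *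
        A (idxRev b) a := by
    intro a b
    have h : ∀ c : OspIdx m n, (b = idxRev c) = (c = idxRev b) := by
      intro c
      apply propext
      constructor <;> (rintro rfl; exact (idxRev_idxRev _).symm)
    have hs : ∀ i j : ZMod 2, superSign j (i + j) * superSign j j = superSign i j := by
      intro i j
      rcases zmod_two_cases i with rfl | rfl <;> rcases zmod_two_cases j with rfl | rfl <;>
        simp [superSign, CharTwo.add_self_eq_zero]
    simp only [ospMetric_eq, h, Finset.sum_add_distrib, ite_mul, mul_ite, zero_mul, mul_zero,
      Finset.sum_ite_eq', Finset.mem_univ, if_true]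
    rw [idxParity_idxRev, metricSign_idxRev, ← hs (idxParity a) (idxParity b)]
    ring
  have hA : A ∈ osp m n ↔ ∀ a b, ∑ c, (ospMetric m n a c * A c b +
      superSign (idxParity b) (idxParity a + idxParity c) * (A c a * ospMetric m n c b)) = 0 :=
    Iff.rfl
  rw [hA]
  refine forall_congr' fun a => forall_congr' fun b => ?_
  rw [key]
  have hm := metricSign_mul_self a
  constructor
  · intro h
    linear_combination metricSign a * h - A (idxRev a) b * hm
  · intro h
    linear_combination metricSign a * h -
      superSign (idxParity a) (idxParity b) * metricSign b * A (idxRev b) a * hm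

lemma matrixPart_mem {m n : ℕ} (k : ZMod 2) {A : Matrix (OspIdx m n) (OspIdx m n) ℂ}
    (hA : A ∈ osp m n) : matrixPart k A ∈ osp m n := by
  rw [mem_osp_iff] at hA ⊢
  intro a b
  simp only [matrixPart, Matrix.of_apply, idxParity_idxRev]
  rw [add_comm (idxParity b) (idxParity a), hA a b]
  split_ifs <;> simp

lemma superBracket_mem {m n : ℕ} {A B : Matrix (OspIdx m n) (OspIdx m n) ℂ}
    (hA : A ∈ osp m n) (hB : B ∈ osp m n) : superBracket A B ∈ osp m n := by
  rw [mem_osp_iff] at hA hB ⊢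
  intro a b
  have hsum : ∀ f : OspIdx m n → ℂ, ∑ c, f (idxRev c) = ∑ c, f c := fun f =>
    Equiv.sum_comp (Function.Involutive.toPerm idxRev idxRev_idxRev) f
  simp only [superBracket, Matrix.of_apply, idxParity_idxRev]
  rw [← hsum (fun c => A (idxRev b) c * B c a -
    superSign (idxParity c + idxParity a) (idxParity b + idxParity c) *
      (B (idxRev b) c * A c a)), Finset.mul_sum, ← Finset.sum_neg_distrib]
  refine Finset.sum_congr rfl fun c _ => ?_
  have e1 : ∀ D : Matrix (OspIdx m n) (OspIdx m n) ℂ, (∀ a b, D (idxRev a) b =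
      -(superSign (idxParity a) (idxParity b) * metricSign a * metricSign b *
        D (idxRev b) a)) → D c b = -(superSign (idxParity c) (idxParity b) *
      (superSign (idxParity c) (idxParity c) * metricSign c) * metricSign b *
        D (idxRev b) (idxRev c)) := by
    intro D hD
    have := hD (idxRev c) b
    rwa [idxRev_idxRev, idxParity_idxRev, metricSign_idxRev] at this
  rw [hA a c, hB a c, e1 A hA, e1 B hB, idxParity_idxRev]
  have hm := metricSign_mul_self c
  have hs : ∀ i j k : ZMod 2, superSign i k * superSign k j * superSign k k =
      superSign i j * superSign (k + i) (j + k) := by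
    intro i j k
    rcases zmod_two_cases i with rfl | rfl <;> rcases zmod_two_cases j with rfl | rfl <;>
      rcases zmod_two_cases k with rfl | rfl <;> simp [superSign, CharTwo.add_self_eq_zero]
  have hs' : ∀ i j k : ZMod 2, superSign (k + j) (i + k) *
      (superSign i k * superSign k j * superSign k k) = superSign i j := by
    intro i j k
    rcases zmod_two_cases i with rfl | rfl <;> rcases zmod_two_cases j with rfl | rfl <;>
      rcases zmod_two_cases k with rfl | rfl <;> simp [superSign, CharTwo.add_self_eq_zero]
  have h1 := hs (idxParity a) (idxParity b) (idxParity c)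
  have h2 := hs' (idxParity a) (idxParity b) (idxParity c)
  generalize superSign (idxParity c + idxParity b) (idxParity a + idxParity c) = s1 at *
  generalize superSign (idxParity c + idxParity a) (idxParity b + idxParity c) = s2 at *
  generalize superSign (idxParity a) (idxParity c) = s3 at *
  generalize superSign (idxParity c) (idxParity b) = s4 at *
  generalize superSign (idxParity c) (idxParity c) = s5 at *
  generalize superSign (idxParity a) (idxParity b) = s6 at *
  generalize metricSign c = mc at *
  generalize metricSign a = ma at *
  generalize metricSign b = mb at *
  generalize A (idxRev c) a = x1 at *
  generalize B (idxRev c) a = x2 at *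
  generalize A (idxRev b) (idxRev c) = x3 at *
  generalize B (idxRev b) (idxRev c) = x4 at *
  linear_combination (x1 * x4 * ma * mb * mc * mc) * h1 - (x2 * x3 * ma * mb * mc * mc) * h2 +
    (x1 * x4 * ma * mb * s6 * s2 - x2 * x3 * ma * mb * s6) * hm

/-- The projection of `osp(m|2n)` onto its component of parity `k`. -/
def ospPart (m n : ℕ) (k : ZMod 2) : Module.End ℂ (osp m n) where
  toFun X := ⟨matrixPart k X.1, matrixPart_mem k X.2⟩
  map_add' X Y := by
    ext a b
    by_cases h : idxParity a + idxParity b = k <;> simp [matrixPart, h]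
  map_smul' t X := by
    ext a b
    by_cases h : idxParity a + idxParity b = k <;> simp [matrixPart, h]

/-- The adjoint representation `X ↦ [X, ·]` of `osp(m|2n)`. -/
def ospAd (m n : ℕ) : osp m n →ₗ[ℂ] Module.End ℂ (osp m n) :=
  LinearMap.mk₂ ℂ (fun X Y => ⟨superBracket X.1 Y.1, superBracket_mem X.2 Y.2⟩)
    (by
      intro X X' Y; ext a b
      simp only [superBracket, Matrix.of_apply, Submodule.coe_add, Matrix.add_apply,
        ← Finset.sum_add_distrib]
      exact Finset.sum_congr rfl fun c _ => by ring)
    (by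
      intro t X Y; ext a b
      simp only [superBracket, Matrix.of_apply, Submodule.coe_smul, Matrix.smul_apply,
        smul_eq_mul, Finset.mul_sum]
      exact Finset.sum_congr rfl fun c _ => by ring)
    (by
      intro X Y Y'; ext a b
      simp only [superBracket, Matrix.of_apply, Submodule.coe_add, Matrix.add_apply,
        ← Finset.sum_add_distrib]
      exact Finset.sum_congr rfl fun c _ => by ring)
    (by
      intro t X Y; ext a b
      simp only [superBracket, Matrix.of_apply, Submodule.coe_smul, Matrix.smul_apply,
        smul_eq_mul, Finset.mul_sum]
      exact Finset.sum_congr rfl fun c _ => by ring)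

/-! ## The second tensor power of the adjoint representation -/

/-- The underlying space of `𝔤 ⊗ 𝔤` for `𝔤 = osp(m|2n)`. -/
abbrev OspSq (m n : ℕ) : Type := (osp m n) ⊗[ℂ] (osp m n)

/-- The component of parity `k` in `𝔤 ⊗ 𝔤`, where `|X ⊗ Y| = |X| + |Y|`. -/
def ospSqPart (m n : ℕ) (k : ZMod 2) : Module.End ℂ (OspSq m n) :=
  ∑ i : ZMod 2, TensorProduct.map (ospPart m n i) (ospPart m n (k - i))

/-- The action of `𝔤` on `𝔤 ⊗ 𝔤`, the linear extension of
`X • (U ⊗ V) = [X,U] ⊗ V + (-1)^{|X||U|} U ⊗ [X,V]` for homogeneous `X, U`. -/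
def ospSqAct (m n : ℕ) : osp m n →ₗ[ℂ] Module.End ℂ (OspSq m n) where
  toFun X := TensorProduct.map (ospAd m n X) LinearMap.id +
    ∑ i : ZMod 2, ∑ j : ZMod 2, superSign i j •
      TensorProduct.map (ospPart m n j) (ospAd m n (ospPart m n i X))
  map_add' X Y := by
    simp only [map_add, TensorProduct.map_add_left, TensorProduct.map_add_right, smul_add,
      Finset.sum_add_distrib]
    abel
  map_smul' t X := by
    simp only [map_smul, TensorProduct.map_smul_left, TensorProduct.map_smul_right,
      RingHom.id_apply, smul_add, Finset.smul_sum, smul_comm t]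

/-- The supersymmetric square `𝔤 ⊙ 𝔤`, spanned by the elements
`X ⊗ Y + (-1)^{|X||Y|} Y ⊗ X` with `X, Y` homogeneous. -/
def ospSymSq (m n : ℕ) : Submodule ℂ (OspSq m n) :=
  Submodule.span ℂ {T | ∃ (i j : ZMod 2) (X Y : osp m n),
    ospPart m n i X = X ∧ ospPart m n j Y = Y ∧
      T = X ⊗ₜ[ℂ] Y + superSign i j • (Y ⊗ₜ[ℂ] X)}

/-! ## Weights and root systems -/

/-- Integral weights `∑ μ_i ε_i + ∑ ν_j δ_j` with `1 ≤ i ≤ ⌊m/2⌋` and `1 ≤ j ≤ n`. -/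
abbrev OspWeight (m n : ℕ) : Type := (Fin (m / 2) ⊕ Fin n) → ℤ

/-- `ε_i`, with `i` counted from one (only used for `1 ≤ i ≤ ⌊m/2⌋`). -/
def wtEps (m n i : ℕ) : OspWeight m n :=
  Sum.elim (fun k => if k.val + 1 = i then 1 else 0) (fun _ => 0)

/-- `δ_j`, with `j` counted from one (only used for `1 ≤ j ≤ n`). -/
def wtDelta (m n j : ℕ) : OspWeight m n :=
  Sum.elim (fun _ => 0) (fun k => if k.val + 1 = j then 1 else 0)

/-- The value of a weight on a diagonal matrix `H` in `osp(m|2n)`: `ε_i` reads off the eigenvalue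
of `H` on the `i`-th even, `δ_j` that on the `j`-th odd basis vector. (The other diagonal entries
of `H` are the negatives of these, and the middle even one is zero for odd `m`.) -/
def wtEval {m n : ℕ} (μ : OspWeight m n) (H : osp m n) : ℂ :=
  ∑ i : Fin (m / 2), (μ (Sum.inl i) : ℂ) *
      H.1 (Sum.inl (Fin.castLE (Nat.div_le_self m 2) i))
        (Sum.inl (Fin.castLE (Nat.div_le_self m 2) i)) +
  ∑ j : Fin n, (μ (Sum.inr j) : ℂ) *
      H.1 (Sum.inr (Fin.castLE (Nat.le_mul_of_pos_left n two_pos) j))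
        (Sum.inr (Fin.castLE (Nat.le_mul_of_pos_left n two_pos) j))

/-- Simple roots of the distinguished (standard) root system:
`δ₁-δ₂, …, δₙ₋₁-δₙ, δₙ-ε₁, ε₁-ε₂, …, ε_{d-1}-ε_d`, and `ε_d` if `m = 2d+1`,
`ε_{d-1}+ε_d` if `m = 2d`. -/
def standardSimpleRoots (m n : ℕ) : Set (OspWeight m n) :=
  {α | ∃ j, 1 ≤ j ∧ j < n ∧ α = wtDelta m n j - wtDelta m n (j + 1)} ∪
  {wtDelta m n n - wtEps m n 1} ∪
  {α | ∃ i, 1 ≤ i ∧ i < m / 2 ∧ α = wtEps m n i - wtEps m n (i + 1)} ∪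
  {if Odd m then wtEps m n (m / 2) else wtEps m n (m / 2 - 1) + wtEps m n (m / 2)}

/-- Simple roots of the non-standard root system:
`ε₁-ε₂, …, ε_{d-1}-ε_d, ε_d-δ₁, δ₁-δ₂, …, δₙ₋₁-δₙ`, and `δₙ` if `m = 2d+1`,
`2δₙ` if `m = 2d`. -/
def nonstandardSimpleRoots (m n : ℕ) : Set (OspWeight m n) :=
  {α | ∃ i, 1 ≤ i ∧ i < m / 2 ∧ α = wtEps m n i - wtEps m n (i + 1)} ∪
  {wtEps m n (m / 2) - wtDelta m n 1} ∪
  {α | ∃ j, 1 ≤ j ∧ j < n ∧ α = wtDelta m n j - wtDelta m n (j + 1)} ∪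
  {if Odd m then wtDelta m n n else 2 • wtDelta m n n}

/-! ## Subrepresentations and highest weights

A representation of `osp(m|2n)` on a superspace `M` is given by its action `act` and by the
projections `pr 0`, `pr 1` onto the even and the odd part of `M`. -/

/-- `v` lies in the weight space of weight `μ`; the Cartan subalgebra consists of the diagonal
matrices in `osp(m|2n)`. -/
def HasWeight {m n : ℕ} {M : Type*} [AddCommGroup M] [Module ℂ M]
    (act : osp m n →ₗ[ℂ] Module.End ℂ M) (μ : OspWeight m n) (v : M) : Prop :=
  ∀ H : osp m n, H.1.IsDiag → act H v = wtEval μ H • v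

/-- `X` is a root vector for a positive root (or zero), where the positive roots are the roots
that are sums of simple roots. -/
def IsPositiveRootVector {m n : ℕ} (simple : Set (OspWeight m n)) (X : osp m n) : Prop :=
  ∃ α ∈ AddSubmonoid.closure simple, α ≠ 0 ∧ HasWeight (ospAd m n) α X

/-- `v` is a highest weight vector of weight `μ` for the root system with the given simple
roots. -/
def IsHighestWeightVector {m n : ℕ} {M : Type*} [AddCommGroup M] [Module ℂ M]
    (act : osp m n →ₗ[ℂ] Module.End ℂ M) (simple : Set (OspWeight m n))
    (μ : OspWeight m n) (v : M) : Prop :=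
  v ≠ 0 ∧ HasWeight act μ v ∧ ∀ X : osp m n, IsPositiveRootVector simple X → act X v = 0

/-- `W` is a (graded) subrepresentation. -/
def IsSubrep {m n : ℕ} {M : Type*} [AddCommGroup M] [Module ℂ M]
    (act : osp m n →ₗ[ℂ] Module.End ℂ M) (pr : ZMod 2 → Module.End ℂ M)
    (W : Submodule ℂ M) : Prop :=
  (∀ X : osp m n, ∀ w ∈ W, act X w ∈ W) ∧ ∀ k : ZMod 2, ∀ w ∈ W, pr k w ∈ W

/-- `W` is an irreducible subrepresentation. -/
def IsIrreducibleSubrep {m n : ℕ} {M : Type*} [AddCommGroup M] [Module ℂ M]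
    (act : osp m n →ₗ[ℂ] Module.End ℂ M) (pr : ZMod 2 → Module.End ℂ M)
    (W : Submodule ℂ M) : Prop :=
  IsSubrep act pr W ∧ W ≠ ⊥ ∧ ∀ U ≤ W, IsSubrep act pr U → U = ⊥ ∨ U = W

/-- `W` is an irreducible highest weight representation of highest weight `μ`, for the root
system with the given simple roots. -/
def IsIrreducibleWithHighestWeight {m n : ℕ} {M : Type*} [AddCommGroup M] [Module ℂ M]
    (act : osp m n →ₗ[ℂ] Module.End ℂ M) (pr : ZMod 2 → Module.End ℂ M)
    (simple : Set (OspWeight m n)) (μ : OspWeight m n) (W : Submodule ℂ M) : Prop :=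
  IsIrreducibleSubrep act pr W ∧ ∃ v ∈ W, IsHighestWeightVector act simple μ v

/-- The highest weights
`2ε₁+2ε₂, 2ε₁+ε₂+ε₃, 2ε₁, ε₁+ε₂+ε₃+ε₄, ε₁+ε₂, 0` for the non-standard root system if `m ≥ 8`;
the fourth becomes `ε₁+ε₂+ε₃+δ₁` for `m = 6, 7` and `ε₁+ε₂+2δ₁` for `m = 5`, and the second
becomes `2ε₁+ε₂+δ₁` for `m = 5`. -/
def nonstandardWeights (m n : ℕ) : Fin 6 → OspWeight m n :=
  ![2 • wtEps m n 1 + 2 • wtEps m n 2,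
    if 6 ≤ m then 2 • wtEps m n 1 + wtEps m n 2 + wtEps m n 3
      else 2 • wtEps m n 1 + wtEps m n 2 + wtDelta m n 1,
    2 • wtEps m n 1,
    if 8 ≤ m then wtEps m n 1 + wtEps m n 2 + wtEps m n 3 + wtEps m n 4
      else if 6 ≤ m then wtEps m n 1 + wtEps m n 2 + wtEps m n 3 + wtDelta m n 1
      else wtEps m n 1 + wtEps m n 2 + 2 • wtDelta m n 1,
    wtEps m n 1 + wtEps m n 2,
    0]

/-- The highest weights `2δ₁+2δ₂, 3δ₁+δ₂, δ₁+δ₂, 4δ₁, 2δ₁, 0` for the standard root system. -/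
def standardWeights (m n : ℕ) : Fin 6 → OspWeight m n :=
  ![2 • wtDelta m n 1 + 2 • wtDelta m n 2,
    3 • wtDelta m n 1 + wtDelta m n 2,
    wtDelta m n 1 + wtDelta m n 2,
    4 • wtDelta m n 1,
    2 • wtDelta m n 1,
    0]

end

/-! Write V for the vector representation and M = m - 2n for its superdimension. The map X ↦
X^a_{b'} g embeds 𝔤 as the super exterior square Λ²V, so 𝔤 ⊗ 𝔤 becomes `antiSub`, the copy of Λ²V ⊗
Λ²V inside V^{⊗4}. Permutations of the factors, insertion of the metric and contraction with it all
commute with 𝔤. The six summands are the familiar symmetry types of a curvature-like tensor: Weyl,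
the trace-free part of Λ²(Λ²V), trace-free symmetric Ricci, totally antisymmetric, antisymmetric
Ricci, scalar. The invariant operator `sep` = A∘b₂₃ + i·A∘(insert∘contract), with A the double
antisymmetrizer, acts on them by six scalars. These scalars are distinct exactly because M is none
of 0, 1, 2 (`sepValue_injective`), and the summands are defined as the eigenspaces.

Complete reducibility is not available for superalgebras in general; two facts about six explicit
vectors v_i, one in each eigenspace (`stdVec`, `sep_stdVec`), take its place.

(1) Every nonzero invariant subspace of Λ²V ⊗ Λ²V contains some v_i (`exists_stdVec_mem`). Grade by
the Cartan element of an odd basis vector e_p and pass to the top degree of the subspace. A tensor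
killed by positive degree is determined by its slice at e_p ⊗ e_p in the last two factors
(`eq_zero_of_slice`). The slices form a subspace of Λ²V stable under the subalgebra of degree zero,
and such a subspace, if nonzero, contains one of six elements (`exists_wedge2_mem`), which are
multiples of the slices of the v_i.

(2) The v_i together generate everything (`eq_antiSub_of_stable`). There is a nondegenerate
contravariant form for which no v_i is isotropic (`form4_stdVec_ne_zero`; M ∉ {0, 1, 2} is used here
too). If an invariant T contains all v_i, its orthogonal complement is invariant; were it nonzero,
it would contain some v_i by (1), which would then be orthogonal to itself.

The rest is formal (`IsCyclicSpectral`). The sum of the eigenspaces is invariant and contains all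
v_i, so it is everything. A nonzero invariant subspace U of one eigenspace contains the only v_i
that can lie there; then U and the other eigenspaces generate everything, so U is the whole
eigenspace. In the same way the flip of the two factors 𝔤 acts on each summand by the sign found on
v_i, which identifies the supersymmetric square.

With p, q the first two odd labels, the v_i are highest weight vectors for the standard system. For
the non-standard system the same six constructions are applied to the labels ε₁, ε₂, ε₃, ε₄, with δ₁
in place of a missing ε₃ or ε₄. The resulting vectors have the same `sep`-eigenvalues and so lie in
the same summands. Membership in a positive root space is used only through the matrix entries it
forces to vanish (`entry_eq_zero_of_isPositiveRootVector`). -/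

noncomputable section

/-! ## Signs -/

lemma superSign_comm (i j : ZMod 2) : superSign i j = superSign j i := by
  simp [superSign, and_comm]

lemma superSign_add_right (i j k : ZMod 2) :
    superSign i (j + k) = superSign i j * superSign i k := by
  rcases zmod_two_cases i with rfl | rfl <;> rcases zmod_two_cases j with rfl | rfl <;>
    rcases zmod_two_cases k with rfl | rfl <;> simp [superSign, CharTwo.add_self_eq_zero]

lemma superSign_add_left (i j k : ZMod 2) :
    superSign (i + j) k = superSign i k * superSign j k := by
  rw [superSign_comm, superSign_add_right, superSign_comm k i, superSign_comm k j]

lemma superSign_mul_self (i j : ZMod 2) : superSign i j * superSign i j = 1 := by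
  by_cases h : i = 1 ∧ j = 1 <;> simp [superSign, h]

@[simp] lemma superSign_zero_left (j : ZMod 2) : superSign 0 j = 1 := by simp [superSign]

@[simp] lemma superSign_zero_right (j : ZMod 2) : superSign j 0 = 1 := by simp [superSign]

@[simp] lemma superSign_one_one : superSign 1 1 = -1 := by simp [superSign]

lemma zmod_two_one_add_one : (1 : ZMod 2) + 1 = 0 := by decide

variable {m n : ℕ}

lemma idxRev_eq_iff (a b : OspIdx m n) : idxRev a = b ↔ a = idxRev b := by
  constructor <;> (rintro rfl; simp [idxRev_idxRev])

lemma sum_idxRev {N : Type*} [AddCommMonoid N] (f : OspIdx m n → N) :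
    ∑ c, f (idxRev c) = ∑ c, f c :=
  Equiv.sum_comp (Function.Involutive.toPerm idxRev idxRev_idxRev) f

lemma metricSign_rev_mul (a : OspIdx m n) :
    metricSign (idxRev a) * metricSign a = superSign (idxParity a) (idxParity a) := by
  rw [metricSign_idxRev, mul_assoc, metricSign_mul_self, mul_one]

/-- The equations of `osp(m|2n)` with the first index dualized. -/
lemma osp_entry (X : osp m n) (a b : OspIdx m n) : X.1 b (idxRev a) =
    -(superSign (idxParity a) (idxParity b) * metricSign (idxRev a) * metricSign (idxRev b) *
      X.1 a (idxRev b)) := by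
  have := (mem_osp_iff X.1).1 X.2 (idxRev b) (idxRev a)
  rw [idxRev_idxRev, idxRev_idxRev, idxParity_idxRev, idxParity_idxRev] at this
  rw [this, superSign_comm]; ring

/-! ## Twists -/

/-- The automorphism of `osp(m|2n)` multiplying the component of parity `j` by `(-1)^{kj}`. -/
def parityTwist (k : ZMod 2) : Module.End ℂ (osp m n) :=
  ospPart m n 0 + superSign k 1 • ospPart m n 1

lemma ospPart_apply (k : ZMod 2) (X : osp m n) (a b : OspIdx m n) :
    (ospPart m n k X).1 a b = if idxParity a + idxParity b = k then X.1 a b else 0 := rfl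

lemma parityTwist_apply (k : ZMod 2) (X : osp m n) (a b : OspIdx m n) :
    (parityTwist k X).1 a b = superSign k (idxParity a + idxParity b) * X.1 a b := by
  change (ospPart m n 0 X).1 a b + superSign k 1 * (ospPart m n 1 X).1 a b = _
  simp only [ospPart_apply]
  rcases zmod_two_cases (idxParity a + idxParity b) with h | h <;> simp [h]

lemma osp_ext {X Y : osp m n} (h : ∀ a b, X.1 a b = Y.1 a b) : X = Y :=
  Subtype.ext (Matrix.ext h)

lemma parityTwist_parityTwist (k l : ZMod 2) (X : osp m n) :
    parityTwist k (parityTwist l X) = parityTwist (k + l) X :=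
  osp_ext fun a b => by
    simp only [parityTwist_apply, superSign_add_left]; ring

lemma parityTwist_zero (X : osp m n) : parityTwist 0 X = X :=
  osp_ext fun a b => by simp [parityTwist_apply]

/-- Matches the sign in the twist with the sum over parities in the definition of the action on 𝔤 ⊗
𝔤. -/
lemma parityTwist_eq_sum (k : ZMod 2) (X : osp m n) :
    parityTwist k X = ∑ i : ZMod 2, superSign i k • ospPart m n i X :=
  osp_ext fun a b => by
    rw [parityTwist_apply]
    have : ((∑ i : ZMod 2, superSign i k • ospPart m n i X : osp m n)).1 a b =
        ∑ i : ZMod 2, superSign i k * (ospPart m n i X).1 a b := by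
      simp [Matrix.sum_apply]
    rw [this]
    simp only [ospPart_apply, mul_ite, mul_zero, Finset.sum_ite_eq, Finset.mem_univ, if_true]
    rw [superSign_comm]

/-! ## Tensoring with the vector representation -/

variable {N N' : Type*} [AddCommGroup N] [Module ℂ N] [AddCommGroup N'] [Module ℂ N']

/-- The action of `osp(m|2n)` on `V ⊗ N`, where `V = ℂ^{m|2n}` and elements of `V ⊗ N` are
written as families of elements of `N`. -/
def vecAct (ρ : osp m n →ₗ[ℂ] Module.End ℂ N) :
    osp m n →ₗ[ℂ] Module.End ℂ (OspIdx m n → N) :=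
  LinearMap.mk₂ ℂ
    -- The twist supplies the sign (-1)^{|a||X|} of moving X past e_a, componentwise for an
    -- inhomogeneous X.
    (fun X f a => ∑ e, X.1 a e • f e + ρ (parityTwist (idxParity a) X) (f a))
    (by
      intro X Y f; funext a
      simp only [map_add, Submodule.coe_add, Matrix.add_apply, add_smul, Finset.sum_add_distrib,
        LinearMap.add_apply, Pi.add_apply]
      abel)
    (by
      intro t X f; funext a
      simp only [map_smul, Submodule.coe_smul, Matrix.smul_apply, smul_eq_mul, mul_smul,
        LinearMap.smul_apply, Pi.smul_apply, Finset.smul_sum, smul_add])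
    (by
      intro X f f'; funext a
      simp only [map_add, Pi.add_apply, smul_add, Finset.sum_add_distrib]
      abel)
    (by
      intro t X f; funext a
      simp only [map_smul, Pi.smul_apply, Finset.smul_sum, smul_add]
      simp only [smul_comm t])

lemma vecAct_apply (ρ : osp m n →ₗ[ℂ] Module.End ℂ N) (X : osp m n) (f : OspIdx m n → N)
    (a : OspIdx m n) : vecAct ρ X f a =
      ∑ e, X.1 a e • f e + ρ (parityTwist (idxParity a) X) (f a) := rfl

/-- `φ` commutes with the actions of `osp(m|2n)`. -/
def Intertwines (ρ : osp m n →ₗ[ℂ] Module.End ℂ N) (ρ' : osp m n →ₗ[ℂ] Module.End ℂ N')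
    (φ : N →ₗ[ℂ] N') : Prop := ∀ X x, φ (ρ X x) = ρ' X (φ x)

/-- The map `id ⊗ φ` on `V ⊗ N`. -/
def vecMap (φ : N →ₗ[ℂ] N') : (OspIdx m n → N) →ₗ[ℂ] (OspIdx m n → N') where
  toFun f a := φ (f a)
  map_add' f g := by funext a; simp
  map_smul' t f := by funext a; simp

lemma Intertwines.vecMap {ρ : osp m n →ₗ[ℂ] Module.End ℂ N}
    {ρ' : osp m n →ₗ[ℂ] Module.End ℂ N'} {φ : N →ₗ[ℂ] N'} (h : Intertwines ρ ρ' φ) :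
    Intertwines (vecAct ρ) (vecAct ρ') (vecMap φ) := by
  intro X f
  funext a
  change φ (∑ e, X.1 a e • f e + ρ (parityTwist (idxParity a) X) (f a)) =
    ∑ e, X.1 a e • φ (f e) + ρ' (parityTwist (idxParity a) X) (φ (f a))
  rw [map_add, map_sum, h]
  simp only [map_smul]

/-- The braiding of the first two factors of `V ⊗ V ⊗ N`. -/
def braid (m n : ℕ) (N : Type*) [AddCommGroup N] [Module ℂ N] :
    Module.End ℂ (OspIdx m n → OspIdx m n → N) where
  toFun f a b := superSign (idxParity a) (idxParity b) • f b a
  map_add' f g := by funext a b; simp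
  map_smul' t f := by funext a b; simp [smul_comm t]

lemma braid_apply (f : OspIdx m n → OspIdx m n → N) (a b : OspIdx m n) :
    braid m n N f a b = superSign (idxParity a) (idxParity b) • f b a := rfl

lemma vecAct_vecAct_apply (ρ : osp m n →ₗ[ℂ] Module.End ℂ N) (X : osp m n)
    (f : OspIdx m n → OspIdx m n → N) (a b : OspIdx m n) : vecAct (vecAct ρ) X f a b =
      ∑ e, X.1 a e • f e b +
      ∑ e, (superSign (idxParity a) (idxParity b + idxParity e) * X.1 b e) • f a e +
      ρ (parityTwist (idxParity a + idxParity b) X) (f a b) := by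
  simp only [vecAct_apply, Pi.add_apply, Finset.sum_apply, Pi.smul_apply, parityTwist_apply,
    parityTwist_parityTwist, add_assoc]
  rw [add_comm (idxParity b)]

lemma intertwines_braid (ρ : osp m n →ₗ[ℂ] Module.End ℂ N) :
    Intertwines (vecAct (vecAct ρ)) (vecAct (vecAct ρ)) (braid m n N) := by
  intro X f
  funext a b
  rw [vecAct_vecAct_apply, braid_apply, vecAct_vecAct_apply, add_comm (idxParity b) (idxParity a)]
  simp only [braid_apply, smul_add, Finset.smul_sum, smul_smul, map_smul]
  rw [add_comm (∑ e, _) (∑ e, _)]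
  congr 2
  · refine Finset.sum_congr rfl fun e _ => ?_
    congr 1
    rw [superSign_add_right, superSign_comm (idxParity b) (idxParity a),
      superSign_comm (idxParity b) (idxParity e)]
    linear_combination (X.1 a e * superSign (idxParity e) (idxParity b)) *
      superSign_mul_self (idxParity a) (idxParity b)
  · refine Finset.sum_congr rfl fun e _ => ?_
    congr 1
    rw [superSign_add_right]
    linear_combination -(X.1 b e * superSign (idxParity a) (idxParity b)) *
      superSign_mul_self (idxParity a) (idxParity e)

lemma braid_braid (f : OspIdx m n → OspIdx m n → N) : braid m n N (braid m n N f) = f := by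
  funext a b
  simp only [braid_apply, smul_smul]
  rw [superSign_comm (idxParity b), superSign_mul_self, one_smul]

/-- The contraction `V ⊗ V ⊗ N → N` with the metric. -/
def contract (m n : ℕ) (N : Type*) [AddCommGroup N] [Module ℂ N] :
    (OspIdx m n → OspIdx m n → N) →ₗ[ℂ] N where
  toFun f := ∑ a, metricSign (idxRev a) • f a (idxRev a)
  map_add' f g := by simp [Finset.sum_add_distrib]
  map_smul' t f := by simp [Finset.smul_sum, smul_comm t]

lemma contract_apply (f : OspIdx m n → OspIdx m n → N) :
    contract m n N f = ∑ a, metricSign (idxRev a) • f a (idxRev a) := rfl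

lemma intertwines_contract (ρ : osp m n →ₗ[ℂ] Module.End ℂ N) :
    Intertwines (vecAct (vecAct ρ)) ρ (contract m n N) := by
  intro X f
  rw [contract_apply, contract_apply, map_sum]
  simp only [vecAct_vecAct_apply, idxParity_idxRev, CharTwo.add_self_eq_zero, parityTwist_zero,
    smul_add, Finset.sum_add_distrib, map_smul]
  rw [add_eq_right]
  -- After dualizing the summation label, the terms where X hits the first factor cancel termwise
  -- against those where it hits the second; this is the defining equation of osp.
  rw [← sum_idxRev (fun a => metricSign (idxRev a) • ∑ e, X.1 a e • f e (idxRev a))]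
  simp only [idxRev_idxRev, Finset.smul_sum, smul_smul]
  rw [Finset.sum_comm, ← Finset.sum_add_distrib]
  refine Finset.sum_eq_zero fun a _ => ?_
  rw [← Finset.sum_add_distrib]
  refine Finset.sum_eq_zero fun b _ => ?_
  rw [← add_smul]
  convert zero_smul ℂ _
  rw [(mem_osp_iff X.1).1 X.2 a b, superSign_add_right]
  have h1 := metricSign_rev_mul a
  have h2 := superSign_mul_self (idxParity a) (idxParity a)
  have h3 := superSign_mul_self (idxParity a) (idxParity b)
  generalize superSign (idxParity a) (idxParity a) = s at *
  generalize superSign (idxParity a) (idxParity b) = s' at *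
  generalize metricSign (idxRev a) = k at *
  generalize metricSign a = k' at *
  linear_combination -(metricSign b * X.1 (idxRev b) a * s * s' * s') * h1 -
    (metricSign b * X.1 (idxRev b) a * s' * s') * h2 - (metricSign b * X.1 (idxRev b) a) * h3

/-- The insertion `N → V ⊗ V ⊗ N` of the invariant element of `V ⊗ V`. -/
def insertMetric (m n : ℕ) (N : Type*) [AddCommGroup N] [Module ℂ N] :
    N →ₗ[ℂ] (OspIdx m n → OspIdx m n → N) where
  toFun x a b := (if b = idxRev a then metricSign a else 0) • x
  map_add' f g := by funext a b; simp
  map_smul' t f := by funext a b; simp [smul_comm t]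

lemma insertMetric_apply (x : N) (a b : OspIdx m n) :
    insertMetric m n N x a b = (if b = idxRev a then metricSign a else 0) • x := rfl

lemma intertwines_insertMetric (ρ : osp m n →ₗ[ℂ] Module.End ℂ N) :
    Intertwines ρ (vecAct (vecAct ρ)) (insertMetric m n N) := by
  intro X x
  funext a b
  rw [vecAct_vecAct_apply]
  have h : ∀ e : OspIdx m n, (b = idxRev e) = (e = idxRev b) := fun e =>
    propext ⟨fun h => by rw [h, idxRev_idxRev], fun h => by rw [h, idxRev_idxRev]⟩
  simp only [insertMetric_apply, h, ite_smul, zero_smul, smul_ite, smul_zero, smul_smul,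
    Finset.sum_ite_eq', Finset.mem_univ, if_true, idxParity_idxRev]
  rw [← add_smul, osp_entry X a b, superSign_add_right]
  have h0 : X.1 a (idxRev b) * metricSign (idxRev b) +
      superSign (idxParity a) (idxParity b) * superSign (idxParity a) (idxParity a) *
      -(superSign (idxParity a) (idxParity b) * metricSign (idxRev a) *
          metricSign (idxRev b) * X.1 a (idxRev b)) * metricSign a = 0 := by
    have h1 := metricSign_rev_mul a
    have h2 := superSign_mul_self (idxParity a) (idxParity a)
    have h3 := superSign_mul_self (idxParity a) (idxParity b)
    generalize superSign (idxParity a) (idxParity a) = s at *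
    generalize superSign (idxParity a) (idxParity b) = s' at *
    generalize metricSign (idxRev a) = k at *
    generalize metricSign (idxRev b) = l at *
    generalize metricSign a = k' at *
    linear_combination -(l * X.1 a (idxRev b) * s * s' * s') * h1 -
      (l * X.1 a (idxRev b) * s' * s') * h2 - (l * X.1 a (idxRev b)) * h3
  rw [h0, zero_smul, zero_add]
  by_cases hab : a = idxRev b
  · subst hab
    simp [idxParity_idxRev, CharTwo.add_self_eq_zero, parityTwist_zero]
  · simp [hab]

lemma Intertwines.comp {N'' : Type*} [AddCommGroup N''] [Module ℂ N'']
    {ρ : osp m n →ₗ[ℂ] Module.End ℂ N}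
    {ρ' : osp m n →ₗ[ℂ] Module.End ℂ N'} {ρ'' : osp m n →ₗ[ℂ] Module.End ℂ N''}
    {ψ : N' →ₗ[ℂ] N''} {φ : N →ₗ[ℂ] N'}
    (hψ : Intertwines ρ' ρ'' ψ) (hφ : Intertwines ρ ρ' φ) : Intertwines ρ ρ'' (ψ ∘ₗ φ) :=
  fun X x => by simp [hφ X x, hψ X (φ x)]

end

/-! ### Invariant operators on V^{⊗4} -/

noncomputable section

/-! ## Operators for the symmetric group on four letters -/

section SymmetricGroup

variable {R : Type*} [Ring R] {a b c : R}

/-- Relations of the three Coxeter generators of the symmetric group on four letters. -/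
structure CoxeterRelations (a b c : R) : Prop where
  aa : a * a = 1
  bb : b * b = 1
  cc : c * c = 1
  ca : c * a = a * c
  bab : b * a * b = a * b * a
  cbc : c * b * c = b * c * b

/-- The antisymmetrizer (up to scale) of the subgroup generated by `a` and `c`. -/
def pairAnti (a c : R) : R := (1 - a) * (1 - c)

/-- The permutation `(13)(24)`. -/
def pairSwap (a b c : R) : R := b * a * c * b

/-- The antisymmetrizer (up to scale) of the symmetric group, written through double cosets. -/
def fullAnti (a b c : R) : R :=
  pairAnti a c + pairAnti a c * pairSwap a b c - pairAnti a c * b * pairAnti a c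

namespace CoxeterRelations

variable (h : CoxeterRelations a b c)
include h

lemma mul_pairAnti_left : a * pairAnti a c = -pairAnti a c := by
  rw [pairAnti, ← mul_assoc, mul_sub a 1, mul_one, h.aa]; noncomm_ring

lemma mul_pairAnti_right : c * pairAnti a c = -pairAnti a c := by
  have : pairAnti a c = (1 - c) * (1 - a) := by
    rw [pairAnti]; noncomm_ring; rw [h.ca]
  rw [this, ← mul_assoc, mul_sub c 1, mul_one, h.cc]; noncomm_ring

lemma pairAnti_mul_left : pairAnti a c * a = -pairAnti a c := by
  have : pairAnti a c = (1 - c) * (1 - a) := by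
    rw [pairAnti]; noncomm_ring; rw [h.ca]
  rw [this, mul_assoc, sub_mul 1 a, h.aa]; noncomm_ring

lemma pairAnti_mul_right : pairAnti a c * c = -pairAnti a c := by
  rw [pairAnti, mul_assoc, sub_mul 1 c, h.cc]; noncomm_ring

lemma pairSwap_mul_self : pairSwap a b c * pairSwap a b c = 1 := by
  have : pairSwap a b c * pairSwap a b c = b * (a * c) * (b * b) * (a * c) * b := by
    rw [pairSwap]; noncomm_ring
  rw [this, h.bb, mul_one]
  have : b * (a * c) * (a * c) * b = b * (a * (c * a) * c) * b := by noncomm_ring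
  rw [this, h.ca, ← mul_assoc a a c, h.aa, one_mul, h.cc, mul_one, h.bb]

lemma left_mul_pairSwap : a * pairSwap a b c = pairSwap a b c * c := by
  have h1 : a * pairSwap a b c = (a * b * a) * c * b := by rw [pairSwap]; noncomm_ring
  have h2 : b * a * b * c * b = b * a * (b * c * b) := by noncomm_ring
  rw [h1, ← h.bab, h2, ← h.cbc, pairSwap]; noncomm_ring

lemma right_mul_pairSwap : c * pairSwap a b c = pairSwap a b c * a := by
  have h1 : c * pairSwap a b c = c * b * (a * c) * b := by rw [pairSwap]; noncomm_ring
  have h2 : c * b * (c * a) * b = (c * b * c) * a * b := by noncomm_ring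
  have h3 : b * c * b * a * b = b * c * (b * a * b) := by noncomm_ring
  have h4 : b * c * (a * b * a) = b * (c * a) * b * a := by noncomm_ring
  rw [h1, ← h.ca, h2, h.cbc, h3, h.bab, h4, h.ca, pairSwap]; noncomm_ring

lemma pairAnti_mul_pairSwap :
    pairAnti a c * pairSwap a b c = pairSwap a b c * pairAnti a c := by
  have : pairAnti a c = (1 - c) * (1 - a) := by
    rw [pairAnti]; noncomm_ring; rw [h.ca]
  nth_rewrite 2 [this]
  rw [pairAnti, mul_assoc, sub_mul 1 c, h.right_mul_pairSwap, one_mul]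
  have : pairSwap a b c - pairSwap a b c * a = pairSwap a b c * (1 - a) := by noncomm_ring
  rw [this, ← mul_assoc, sub_mul 1 a, h.left_mul_pairSwap]
  noncomm_ring

/-- Multiplication by `b` mixes the double cosets, so there is no structural shortcut as for `a` and
`c`. The Coxeter relations are turned into a rewriting system on words, and the signed words then
cancel. -/
lemma swap_fullAnti_swap : b * fullAnti a b c = -fullAnti a b c ∧
    fullAnti a b c * b = -fullAnti a b c := by
  have aa := h.aa
  have bb := h.bb
  have cc := h.cc
  have ca := h.ca
  have bab := h.bab
  have cbc := h.cbc
  rw [mul_assoc] at bab cbc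
  have aa' : ∀ x, a * (a * x) = x := fun x => by rw [← mul_assoc, aa, one_mul]
  have bb' : ∀ x, b * (b * x) = x := fun x => by rw [← mul_assoc, bb, one_mul]
  have cc' : ∀ x, c * (c * x) = x := fun x => by rw [← mul_assoc, cc, one_mul]
  have ca' : ∀ x, c * (a * x) = a * (c * x) := fun x => by
    rw [← mul_assoc, ca, mul_assoc]
  have bab' : ∀ x, b * (a * (b * x)) = a * (b * (a * x)) := fun x => by
    rw [← mul_assoc a b, ← mul_assoc b, bab]; simp only [mul_assoc]
  have cbc' : ∀ x, c * (b * (c * x)) = b * (c * (b * x)) := fun x => by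
    rw [← mul_assoc b c, ← mul_assoc c, cbc]; simp only [mul_assoc]
  have cbac : c * (b * (a * c)) = b * (c * (b * a)) := by
    rw [← ca, cbc']
  have cbac' : ∀ x, c * (b * (a * (c * x))) = b * (c * (b * (a * x))) := fun x => by
    rw [← ca', cbc']
  simp only [fullAnti, pairAnti, pairSwap, mul_add, add_mul, mul_sub, sub_mul, mul_one, one_mul,
    mul_assoc, aa, bb, bab, cbc, aa', bb', ca', bab', cbac, cbac']
  constructor <;> abel

lemma swap_mul_fullAnti : b * fullAnti a b c = -fullAnti a b c := h.swap_fullAnti_swap.1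

lemma left_mul_fullAnti : a * fullAnti a b c = -fullAnti a b c := by
  rw [fullAnti, mul_sub, mul_add]
  simp only [← mul_assoc, h.mul_pairAnti_left]
  noncomm_ring

lemma right_mul_fullAnti : c * fullAnti a b c = -fullAnti a b c := by
  rw [fullAnti, mul_sub, mul_add]
  simp only [← mul_assoc, h.mul_pairAnti_right]
  noncomm_ring

lemma pairAnti_mul_fullAnti : pairAnti a c * fullAnti a b c = 4 * fullAnti a b c := by
  rw [pairAnti, mul_assoc, sub_mul 1 c, h.right_mul_fullAnti, sub_mul, one_mul, one_mul, mul_sub,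
    mul_neg, h.left_mul_fullAnti]
  noncomm_ring

lemma pairSwap_mul_fullAnti : pairSwap a b c * fullAnti a b c = fullAnti a b c := by
  rw [pairSwap, mul_assoc, h.swap_mul_fullAnti, mul_neg, mul_assoc, h.right_mul_fullAnti, mul_neg,
    mul_assoc, h.left_mul_fullAnti, mul_neg, h.swap_mul_fullAnti]
  abel

/-- The three double cosets of the subgroup generated by `a` and `c` contribute 4 + 4 + 16 = 24. -/
lemma fullAnti_mul_fullAnti : fullAnti a b c * fullAnti a b c = 24 * fullAnti a b c := by
  nth_rewrite 1 [fullAnti]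
  rw [sub_mul, add_mul, mul_assoc _ (pairSwap a b c), h.pairSwap_mul_fullAnti, mul_assoc _ _
    (fullAnti a b c), h.pairAnti_mul_fullAnti]
  have : pairAnti a c * b * (4 * fullAnti a b c) =
    4 * (pairAnti a c * (b * fullAnti a b c)) := by noncomm_ring
  rw [this, h.swap_mul_fullAnti, mul_neg, h.pairAnti_mul_fullAnti]
  noncomm_ring

/-- The opposite relations hold in the opposite ring; the antisymmetrizer is symmetric. -/
lemma fullAnti_mul_left : fullAnti a b c * a = -fullAnti a b c := by
  rw [fullAnti, sub_mul, add_mul, mul_assoc _ (pairSwap a b c), ← h.right_mul_pairSwap,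
    ← mul_assoc, h.pairAnti_mul_right, mul_assoc _ (pairAnti a c) a, h.pairAnti_mul_left]
  noncomm_ring

lemma fullAnti_mul_right : fullAnti a b c * c = -fullAnti a b c := by
  rw [fullAnti, sub_mul, add_mul, mul_assoc _ (pairSwap a b c), ← h.left_mul_pairSwap,
    ← mul_assoc, h.pairAnti_mul_left, mul_assoc _ (pairAnti a c) c, h.pairAnti_mul_right]
  noncomm_ring

lemma fullAnti_mul_swap : fullAnti a b c * b = -fullAnti a b c :=
  h.swap_fullAnti_swap.2

end CoxeterRelations

end SymmetricGroup

/-! ## The fourth tensor power of the vector representation -/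

variable {m n : ℕ}

/-- The space `V ⊗ V`. -/
abbrev Tens2 (m n : ℕ) : Type := OspIdx m n → OspIdx m n → ℂ

/-- The space `V ⊗ V ⊗ V ⊗ V`. -/
abbrev Tens4 (m n : ℕ) : Type := OspIdx m n → OspIdx m n → Tens2 m n

/-- The action on `V ⊗ V`. -/
def act2 (m n : ℕ) : osp m n →ₗ[ℂ] Module.End ℂ (Tens2 m n) := vecAct (vecAct 0)

/-- The action on `V ⊗ V ⊗ V ⊗ V`. -/
def act4 (m n : ℕ) : osp m n →ₗ[ℂ] Module.End ℂ (Tens4 m n) := vecAct (vecAct (act2 m n))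

/-- The braiding of factors 1 and 2. -/
def braid12 (m n : ℕ) : Module.End ℂ (Tens4 m n) := braid m n (Tens2 m n)

/-- The braiding of factors 2 and 3. -/
def braid23 (m n : ℕ) : Module.End ℂ (Tens4 m n) := vecMap (braid m n (OspIdx m n → ℂ))

/-- The braiding of factors 3 and 4. -/
def braid34 (m n : ℕ) : Module.End ℂ (Tens4 m n) := vecMap (vecMap (braid m n ℂ))

lemma braid12_apply (t : Tens4 m n) (a b c d : OspIdx m n) :
    braid12 m n t a b c d = superSign (idxParity a) (idxParity b) * t b a c d := rfl

lemma braid23_apply (t : Tens4 m n) (a b c d : OspIdx m n) :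
    braid23 m n t a b c d = superSign (idxParity b) (idxParity c) * t a c b d := rfl

lemma braid34_apply (t : Tens4 m n) (a b c d : OspIdx m n) :
    braid34 m n t a b c d = superSign (idxParity c) (idxParity d) * t a b d c := rfl

lemma tens4_ext {t u : Tens4 m n} (h : ∀ a b c d, t a b c d = u a b c d) : t = u :=
  funext fun a => funext fun b => funext fun c => funext fun d => h a b c d

lemma coxeterRelations_braid :
    CoxeterRelations (braid12 m n) (braid23 m n) (braid34 m n) where
  aa := LinearMap.ext fun t => tens4_ext fun a b c d => by
    simp only [Module.End.mul_apply, Module.End.one_apply, braid12_apply, ← mul_assoc]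
    rw [superSign_comm (idxParity b), superSign_mul_self, one_mul]
  bb := LinearMap.ext fun t => tens4_ext fun a b c d => by
    simp only [Module.End.mul_apply, Module.End.one_apply, braid23_apply, ← mul_assoc]
    rw [superSign_comm (idxParity c), superSign_mul_self, one_mul]
  cc := LinearMap.ext fun t => tens4_ext fun a b c d => by
    simp only [Module.End.mul_apply, Module.End.one_apply, braid34_apply, ← mul_assoc]
    rw [superSign_comm (idxParity d), superSign_mul_self, one_mul]
  ca := LinearMap.ext fun t => tens4_ext fun a b c d => by
    simp only [Module.End.mul_apply, braid12_apply, braid34_apply]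
    ring
  bab := LinearMap.ext fun t => tens4_ext fun a b c d => by
    simp only [Module.End.mul_apply, braid12_apply, braid23_apply]
    ring
  cbc := LinearMap.ext fun t => tens4_ext fun a b c d => by
    simp only [Module.End.mul_apply, braid34_apply, braid23_apply]
    ring

/-- The map `x ↦ g^{bc} x_{ad}`. -/
def insert23 (m n : ℕ) : Tens2 m n →ₗ[ℂ] Tens4 m n :=
  vecMap (insertMetric m n (OspIdx m n → ℂ))

/-- Contraction of factors 2 and 3. -/
def contract23 (m n : ℕ) : Tens4 m n →ₗ[ℂ] Tens2 m n :=
  vecMap (contract m n (OspIdx m n → ℂ))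

lemma insert23_apply (x : Tens2 m n) (a b c d : OspIdx m n) :
    insert23 m n x a b c d = (if c = idxRev b then metricSign b else 0) * x a d := rfl

lemma contract23_apply (t : Tens4 m n) (a d : OspIdx m n) :
    contract23 m n t a d = ∑ b, metricSign (idxRev b) * t a b (idxRev b) d := by
  simp [contract23, vecMap, contract_apply, Finset.sum_apply]

/-- The invariant element of `V ⊗ V`. -/
def metric2 (m n : ℕ) : Tens2 m n := insertMetric m n ℂ 1

lemma metric2_apply (a b : OspIdx m n) :
    metric2 m n a b = if b = idxRev a then metricSign a else 0 := by
  simp [metric2, insertMetric_apply]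

/-- The double antisymmetrizer. -/
def anti (m n : ℕ) : Module.End ℂ (Tens4 m n) := pairAnti (braid12 m n) (braid34 m n)

/-- The flip of the first two and the last two factors. -/
def swap (m n : ℕ) : Module.End ℂ (Tens4 m n) :=
  pairSwap (braid12 m n) (braid23 m n) (braid34 m n)

/-- The full antisymmetrizer. -/
def full (m n : ℕ) : Module.End ℂ (Tens4 m n) :=
  fullAnti (braid12 m n) (braid23 m n) (braid34 m n)

/-- An invariant operator separating the six summands. -/
def sep (m n : ℕ) : Module.End ℂ (Tens4 m n) :=
  -- The factor i keeps the permutation part and the trace part of the eigenvalues apart, as real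
  -- and imaginary parts.
  anti m n * braid23 m n + Complex.I • (anti m n * (insert23 m n ∘ₗ contract23 m n))

lemma anti_apply (t : Tens4 m n) (a b c d : OspIdx m n) : anti m n t a b c d =
    t a b c d - superSign (idxParity a) (idxParity b) * t b a c d -
      superSign (idxParity c) (idxParity d) * t a b d c +
      superSign (idxParity a) (idxParity b) * superSign (idxParity c) (idxParity d) *
        t b a d c := by
  simp only [anti, pairAnti, Module.End.mul_apply, LinearMap.sub_apply, Module.End.one_apply,
    Pi.sub_apply, braid12_apply, braid34_apply]
  ring

lemma swap_apply (t : Tens4 m n) (a b c d : OspIdx m n) : swap m n t a b c d =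
    superSign (idxParity a + idxParity b) (idxParity c + idxParity d) * t c d a b := by
  simp only [swap, pairSwap, Module.End.mul_apply, braid12_apply, braid34_apply, braid23_apply,
    superSign_add_left, superSign_add_right]
  ring

lemma intertwines_act4_of_mul {φ ψ : Module.End ℂ (Tens4 m n)}
    (h : Intertwines (act4 m n) (act4 m n) φ) (h' : Intertwines (act4 m n) (act4 m n) ψ) :
    Intertwines (act4 m n) (act4 m n) (φ * ψ) := h.comp h'

lemma Intertwines.add {ρ ρ' : osp m n →ₗ[ℂ] Module.End ℂ (Tens4 m n)} {φ ψ : Module.End ℂ (Tens4 m n)}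
    (h : Intertwines ρ ρ' φ) (h' : Intertwines ρ ρ' ψ) :
    Intertwines ρ ρ' (φ + ψ) := fun X x => by
  simp [h X x, h' X x]

lemma Intertwines.sub {ρ ρ' : osp m n →ₗ[ℂ] Module.End ℂ (Tens4 m n)} {φ ψ : Module.End ℂ (Tens4 m n)}
    (h : Intertwines ρ ρ' φ) (h' : Intertwines ρ ρ' ψ) :
    Intertwines ρ ρ' (φ - ψ) := fun X x => by
  simp [h X x, h' X x]

lemma Intertwines.smul {ρ ρ' : osp m n →ₗ[ℂ] Module.End ℂ (Tens4 m n)} {φ : Module.End ℂ (Tens4 m n)}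
    (h : Intertwines ρ ρ' φ) (z : ℂ) : Intertwines ρ ρ' (z • φ) := fun X x => by
  simp [h X x]

lemma intertwines_one : Intertwines (act4 m n) (act4 m n) 1 := fun _ _ => rfl

lemma intertwines_braid12 : Intertwines (act4 m n) (act4 m n) (braid12 m n) :=
  intertwines_braid _

lemma intertwines_braid23 : Intertwines (act4 m n) (act4 m n) (braid23 m n) :=
  (intertwines_braid _).vecMap

lemma intertwines_braid34 : Intertwines (act4 m n) (act4 m n) (braid34 m n) :=
  (intertwines_braid _).vecMap.vecMap

lemma intertwines_insert23 : Intertwines (act2 m n) (act4 m n) (insert23 m n) :=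
  (intertwines_insertMetric _).vecMap

lemma intertwines_contract23 : Intertwines (act4 m n) (act2 m n) (contract23 m n) :=
  (intertwines_contract _).vecMap

lemma intertwines_anti : Intertwines (act4 m n) (act4 m n) (anti m n) :=
  intertwines_act4_of_mul (intertwines_one.sub intertwines_braid12)
    (intertwines_one.sub intertwines_braid34)

lemma intertwines_swap : Intertwines (act4 m n) (act4 m n) (swap m n) :=
  intertwines_act4_of_mul (intertwines_act4_of_mul (intertwines_act4_of_mul intertwines_braid23
    intertwines_braid12) intertwines_braid34) intertwines_braid23

lemma intertwines_full : Intertwines (act4 m n) (act4 m n) (full m n) :=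
  (intertwines_anti.add (intertwines_act4_of_mul intertwines_anti intertwines_swap)).sub
    (intertwines_act4_of_mul (intertwines_act4_of_mul intertwines_anti intertwines_braid23)
      intertwines_anti)

lemma intertwines_sep : Intertwines (act4 m n) (act4 m n) (sep m n) :=
  (intertwines_act4_of_mul intertwines_anti intertwines_braid23).add
    ((intertwines_act4_of_mul intertwines_anti
      (intertwines_insert23.comp intertwines_contract23)).smul _)

lemma act2_metric2 (X : osp m n) : act2 m n X (metric2 m n) = 0 := by
  have := intertwines_insertMetric (0 : osp m n →ₗ[ℂ] Module.End ℂ ℂ) X 1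
  exact this.symm.trans (map_zero _)

/-! ## Relations between insertion, contraction and braidings -/

/-- The braiding of `V ⊗ V`. -/
abbrev flip2 (m n : ℕ) : Module.End ℂ (Tens2 m n) := braid m n ℂ

/-- The contraction of `V ⊗ V`. -/
def trace2 (m n : ℕ) : Tens2 m n →ₗ[ℂ] ℂ := contract m n ℂ

lemma trace2_apply (x : Tens2 m n) :
    trace2 m n x = ∑ a, metricSign (idxRev a) * x a (idxRev a) := rfl

/-- The superdimension of V; every occurrence of m - 2n in the eigenvalues and norms stems from this
closed loop. -/
lemma sum_parity_sign :
    ∑ a : OspIdx m n, superSign (idxParity a) (idxParity a) = (m : ℂ) - 2 * n := by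
  simp [idxParity, Fintype.sum_sum_type, sub_eq_add_neg]

lemma trace2_metric2 : trace2 m n (metric2 m n) = (m : ℂ) - 2 * n := by
  rw [trace2_apply, ← sum_parity_sign]
  exact Finset.sum_congr rfl fun a _ => by rw [metric2_apply, if_pos rfl, metricSign_rev_mul]

lemma contract23_insert23 (x : Tens2 m n) :
    contract23 m n (insert23 m n x) = ((m : ℂ) - 2 * n) • x := by
  funext a d
  rw [contract23_apply, Pi.smul_apply, Pi.smul_apply, smul_eq_mul, ← sum_parity_sign,
    Finset.sum_mul]
  exact Finset.sum_congr rfl fun b _ => by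
    rw [insert23_apply, if_pos rfl, ← mul_assoc, metricSign_rev_mul]

lemma idxRev_eq_idxRev (a b : OspIdx m n) : idxRev a = idxRev b ↔ b = a := by
  rw [idxRev_eq_iff, idxRev_idxRev, eq_comm]

/-- A snake relation: one leg of the inserted metric is contracted and transports the label of x, so
no loop and no factor m - 2n arises. -/
lemma contract23_braid12_insert23 (x : Tens2 m n) :
    contract23 m n (braid12 m n (insert23 m n x)) = x := by
  funext a d
  simp only [contract23_apply, braid12_apply, insert23_apply, idxRev_eq_idxRev, ite_mul, zero_mul,
    mul_ite, mul_zero, Finset.sum_ite_eq, Finset.mem_univ, if_true]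
  have h1 := metricSign_rev_mul a
  have h2 := superSign_mul_self (idxParity a) (idxParity a)
  linear_combination (superSign (idxParity a) (idxParity a) * x a d) * h1 + x a d * h2

lemma contract23_braid34_insert23 (x : Tens2 m n) :
    contract23 m n (braid34 m n (insert23 m n x)) = x := by
  funext a d
  simp only [contract23_apply, braid34_apply, insert23_apply, idxParity_idxRev]
  rw [← sum_idxRev]
  simp only [idxRev_idxRev, idxParity_idxRev, ite_mul, zero_mul,
    mul_ite, mul_zero]
  have : ∀ b : OspIdx m n, (d = b) = (b = d) := fun b => propext eq_comm
  simp only [this, Finset.sum_ite_eq', Finset.mem_univ, if_true]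
  have h1 := metricSign_rev_mul d
  have h2 := superSign_mul_self (idxParity d) (idxParity d)
  linear_combination (superSign (idxParity d) (idxParity d) * x a d) * h1 + x a d * h2

/-- After both braidings the contraction closes up x itself and leaves the inserted metric in the
outer slots. -/
lemma contract23_braid12_braid34_insert23 (x : Tens2 m n) :
    contract23 m n (braid12 m n (braid34 m n (insert23 m n x))) =
      trace2 m n x • metric2 m n := by
  funext a d
  simp only [contract23_apply, braid34_apply, braid12_apply, insert23_apply, idxParity_idxRev,
    Pi.smul_apply, smul_eq_mul, metric2_apply]
  split_ifs with h
  · subst h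
    rw [trace2_apply, Finset.sum_mul]
    refine Finset.sum_congr rfl fun b _ => ?_
    rw [idxParity_idxRev, superSign_comm (idxParity b)]
    linear_combination (metricSign (idxRev b) * metricSign a * x b (idxRev b)) *
      superSign_mul_self (idxParity a) (idxParity b)
  · simp

lemma braid23_insert23 (x : Tens2 m n) : braid23 m n (insert23 m n x) = insert23 m n x := by
  refine tens4_ext fun a b c d => ?_
  rw [braid23_apply, insert23_apply, insert23_apply]
  by_cases h : c = idxRev b
  · subst h
    simp only [idxRev_idxRev, if_true, metricSign_idxRev, idxParity_idxRev]
    linear_combination metricSign b * x a d * superSign_mul_self (idxParity b) (idxParity b)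
  · have : ¬ b = idxRev c := fun h' => h (by rw [h', idxRev_idxRev])
    simp [h, this]

lemma braid23_braid12_braid34_insert23 (x : Tens2 m n) :
    braid23 m n (braid12 m n (braid34 m n (insert23 m n x))) =
      braid12 m n (braid34 m n (insert23 m n (flip2 m n x))) := by
  refine tens4_ext fun a b c d => ?_
  simp only [braid23_apply, braid12_apply, braid34_apply, insert23_apply, braid_apply,
    smul_eq_mul]
  split_ifs with h
  · subst h
    rw [idxParity_idxRev, superSign_comm (idxParity b) (idxParity a),
      superSign_comm (idxParity c) (idxParity a)]
    ring
  · simp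

end

/-! ### The spectrum of the separating operator on Λ²V ⊗ Λ²V -/

noncomputable section

variable {m n : ℕ}

/-! ## Eigenvectors of the separating operator -/

/-- The image of `𝔤 ⊗ 𝔤` in `V ⊗ V ⊗ V ⊗ V`. -/
def antiSub (m n : ℕ) : Submodule ℂ (Tens4 m n) :=
  LinearMap.ker (braid12 m n + 1) ⊓ LinearMap.ker (braid34 m n + 1)

lemma mem_antiSub {t : Tens4 m n} :
    t ∈ antiSub m n ↔ braid12 m n t = -t ∧ braid34 m n t = -t := by
  simp [antiSub, eq_neg_iff_add_eq_zero]

lemma anti_mem (t : Tens4 m n) : anti m n t ∈ antiSub m n := by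
  have h := coxeterRelations_braid (m := m) (n := n)
  exact mem_antiSub.2 ⟨LinearMap.congr_fun h.mul_pairAnti_left t,
    LinearMap.congr_fun h.mul_pairAnti_right t⟩

lemma full_mem (t : Tens4 m n) : full m n t ∈ antiSub m n := by
  have h := coxeterRelations_braid (m := m) (n := n)
  exact mem_antiSub.2 ⟨LinearMap.congr_fun h.left_mul_fullAnti t,
    LinearMap.congr_fun h.right_mul_fullAnti t⟩

lemma anti_of_mem {t : Tens4 m n} (ht : t ∈ antiSub m n) : anti m n t = (4 : ℂ) • t := by
  obtain ⟨h1, h2⟩ := mem_antiSub.1 ht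
  simp only [anti, pairAnti, Module.End.mul_apply, LinearMap.sub_apply, Module.End.one_apply, h1,
    h2, map_sub, map_neg]
  module

lemma swap_mem {t : Tens4 m n} (ht : t ∈ antiSub m n) : swap m n t ∈ antiSub m n := by
  have h := coxeterRelations_braid (m := m) (n := n)
  obtain ⟨h1, h2⟩ := mem_antiSub.1 ht
  refine mem_antiSub.2 ⟨(LinearMap.congr_fun h.left_mul_pairSwap t).trans ?_,
    (LinearMap.congr_fun h.right_mul_pairSwap t).trans ?_⟩
  · rw [Module.End.mul_apply, h2, map_neg]; rfl
  · rw [Module.End.mul_apply, h1, map_neg]; rfl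

lemma anti_braid12 (t : Tens4 m n) : anti m n (braid12 m n t) = -anti m n t :=
  LinearMap.congr_fun coxeterRelations_braid.pairAnti_mul_left t

lemma anti_braid34 (t : Tens4 m n) : anti m n (braid34 m n t) = -anti m n t :=
  LinearMap.congr_fun coxeterRelations_braid.pairAnti_mul_right t

lemma anti_swap (t : Tens4 m n) : anti m n (swap m n t) = swap m n (anti m n t) :=
  LinearMap.congr_fun coxeterRelations_braid.pairAnti_mul_pairSwap t

lemma swap_swap (t : Tens4 m n) : swap m n (swap m n t) = t :=
  LinearMap.congr_fun coxeterRelations_braid.pairSwap_mul_self t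

lemma swap_full (t : Tens4 m n) : swap m n (full m n t) = full m n t :=
  LinearMap.congr_fun coxeterRelations_braid.pairSwap_mul_fullAnti t

lemma full_full (t : Tens4 m n) : full m n (full m n t) = (24 : ℂ) • full m n t := by
  have := LinearMap.congr_fun
    (coxeterRelations_braid (m := m) (n := n)).fullAnti_mul_fullAnti t
  refine this.trans ?_
  rw [← Nat.cast_ofNat (R := Module.End ℂ (Tens4 m n)), ← nsmul_eq_mul]
  simp only [LinearMap.smul_apply]
  rw [← Nat.cast_smul_eq_nsmul ℂ]; rfl

lemma full_braid12 (t : Tens4 m n) : full m n (braid12 m n t) = -full m n t :=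
  LinearMap.congr_fun coxeterRelations_braid.fullAnti_mul_left t

lemma full_braid23 (t : Tens4 m n) : full m n (braid23 m n t) = -full m n t :=
  LinearMap.congr_fun coxeterRelations_braid.fullAnti_mul_swap t

lemma full_braid34 (t : Tens4 m n) : full m n (braid34 m n t) = -full m n t :=
  LinearMap.congr_fun coxeterRelations_braid.fullAnti_mul_right t

lemma full_swap (t : Tens4 m n) : full m n (swap m n t) = full m n t := by
  simp only [swap, pairSwap, Module.End.mul_apply, full_braid12, full_braid23, full_braid34,
    neg_neg]

lemma full_anti (t : Tens4 m n) : full m n (anti m n t) = (4 : ℂ) • full m n t := by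
  simp only [anti, pairAnti, Module.End.mul_apply, LinearMap.sub_apply, Module.End.one_apply,
    map_sub, full_braid12, full_braid34]
  module

lemma full_apply (t : Tens4 m n) : full m n t =
    anti m n t + anti m n (swap m n t) - anti m n (braid23 m n (anti m n t)) := rfl

/-- The double coset formula for the full antisymmetrizer, solved for its third term; on `antiSub`
the double antisymmetrizer is 4. Hence the permutation part of `sep` only depends on how the flip
and the full antisymmetrizer act. -/
lemma anti_braid23_of_mem {t : Tens4 m n} (ht : t ∈ antiSub m n) :
    anti m n (braid23 m n t) = t + swap m n t - (1 / 4 : ℂ) • full m n t := by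
  rw [full_apply, anti_of_mem ht, anti_of_mem (swap_mem ht), map_smul, map_smul]
  module

lemma sep_apply (t : Tens4 m n) : sep m n t = anti m n (braid23 m n t) +
    Complex.I • anti m n (insert23 m n (contract23 m n t)) := rfl

lemma sep_mem (t : Tens4 m n) : sep m n t ∈ antiSub m n :=
  add_mem (anti_mem _) (Submodule.smul_mem _ _ (anti_mem _))

/-- The projection (up to scale) to tensors of the symmetry of a Weyl tensor. -/
def weylVec (w : Tens4 m n) : Tens4 m n :=
  anti m n (w + swap m n w) - (1 / 3 : ℂ) • full m n w

/-- The projection (up to scale) to `Λ²(Λ²V)`. -/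
def altVec (w : Tens4 m n) : Tens4 m n := anti m n (w - swap m n w)

/-- The element of `Λ²V ⊗ Λ²V` obtained from an element of `V ⊗ V` and the metric. -/
def ricciVec (x : Tens2 m n) : Tens4 m n := anti m n (insert23 m n x)

lemma weylVec_mem (w : Tens4 m n) : weylVec w ∈ antiSub m n :=
  sub_mem (anti_mem _) (Submodule.smul_mem _ _ (full_mem _))

lemma altVec_mem (w : Tens4 m n) : altVec w ∈ antiSub m n := anti_mem _

lemma ricciVec_mem (x : Tens2 m n) : ricciVec x ∈ antiSub m n := anti_mem _

lemma swap_weylVec (w : Tens4 m n) : swap m n (weylVec w) = weylVec w := by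
  simp only [weylVec, map_sub, map_smul, map_add, ← anti_swap, swap_swap, swap_full]
  abel

/-- This fixes the constant 1/3: antisymmetrizing `anti (w + swap w)` gives 8 `full w`, and `full`
squares to 24 times itself. -/
lemma full_weylVec (w : Tens4 m n) : full m n (weylVec w) = 0 := by
  simp only [weylVec, map_sub, map_smul, map_add, full_anti, full_swap, full_full]
  module

lemma swap_altVec (w : Tens4 m n) : swap m n (altVec w) = -altVec w := by
  simp only [altVec, map_sub, ← anti_swap, swap_swap]
  abel

lemma full_altVec (w : Tens4 m n) : full m n (altVec w) = 0 := by
  simp only [altVec, map_sub, full_anti, full_swap, sub_self]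

lemma full_insert23 (x : Tens2 m n) : full m n (insert23 m n x) = 0 := by
  have := full_braid23 (insert23 m n x)
  rwa [braid23_insert23, self_eq_neg] at this

lemma anti_braid12_braid34 (t : Tens4 m n) :
    anti m n (braid12 m n (braid34 m n t)) = anti m n t := by
  rw [anti_braid12, anti_braid34, neg_neg]

lemma swap_ricciVec (x : Tens2 m n) : swap m n (ricciVec x) = ricciVec (flip2 m n x) := by
  rw [ricciVec, ricciVec, ← anti_swap, ← anti_braid12_braid34 (insert23 m n (flip2 m n x)),
    ← braid23_braid12_braid34_insert23]
  congr 1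
  simp only [swap, pairSwap, Module.End.mul_apply, braid23_insert23]

/-- Of the four terms of the double antisymmetrizer one closes a loop (m - 2n), two are snakes (-1
each) and the last is the trace term. -/
lemma contract23_ricciVec (x : Tens2 m n) : contract23 m n (ricciVec x) =
    ((m : ℂ) - 2 * n - 2) • x + trace2 m n x • metric2 m n := by
  simp only [ricciVec, anti, pairAnti, Module.End.mul_apply, LinearMap.sub_apply,
    Module.End.one_apply, map_sub, contract23_insert23, contract23_braid12_insert23,
    contract23_braid34_insert23, contract23_braid12_braid34_insert23]
  module

lemma sep_of_contract23_eq_zero {t : Tens4 m n} (ht : t ∈ antiSub m n)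
    (h : contract23 m n t = 0) :
    sep m n t = t + swap m n t - (1 / 4 : ℂ) • full m n t := by
  rw [sep_apply, h, map_zero, map_zero, smul_zero, add_zero, anti_braid23_of_mem ht]

lemma sep_ricciVec (x : Tens2 m n) : sep m n (ricciVec x) =
    ricciVec x + ricciVec (flip2 m n x) +
      Complex.I • (((m : ℂ) - 2 * n - 2) • ricciVec x +
        trace2 m n x • ricciVec (metric2 m n)) := by
  rw [sep_apply, anti_braid23_of_mem (ricciVec_mem x), swap_ricciVec, contract23_ricciVec]
  simp only [ricciVec, full_anti, full_insert23, map_add, map_smul, smul_zero, sub_zero]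

/-- `t` vanishes off the tensors with all indices in `S`. -/
def SupportedOn (S : Set (OspIdx m n)) (t : Tens4 m n) : Prop :=
  ∀ a b c d, ¬ (a ∈ S ∧ b ∈ S ∧ c ∈ S ∧ d ∈ S) → t a b c d = 0

namespace SupportedOn

variable {S : Set (OspIdx m n)} {t u : Tens4 m n}

lemma add (ht : SupportedOn S t) (hu : SupportedOn S u) : SupportedOn S (t + u) :=
  fun a b c d h => by
    change t a b c d + u a b c d = 0
    rw [ht a b c d h, hu a b c d h, add_zero]

lemma sub (ht : SupportedOn S t) (hu : SupportedOn S u) : SupportedOn S (t - u) :=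
  fun a b c d h => by
    change t a b c d - u a b c d = 0
    rw [ht a b c d h, hu a b c d h, sub_zero]

lemma smul (z : ℂ) (ht : SupportedOn S t) : SupportedOn S (z • t) :=
  fun a b c d h => by
    change z * t a b c d = 0
    rw [ht a b c d h, mul_zero]

lemma braid12 (ht : SupportedOn S t) : SupportedOn S (braid12 m n t) := fun a b c d h => by
  rw [braid12_apply, ht b a c d (by tauto), mul_zero]

lemma braid23 (ht : SupportedOn S t) : SupportedOn S (braid23 m n t) := fun a b c d h => by
  rw [braid23_apply, ht a c b d (by tauto), mul_zero]

lemma braid34 (ht : SupportedOn S t) : SupportedOn S (braid34 m n t) := fun a b c d h => by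
  rw [braid34_apply, ht a b d c (by tauto), mul_zero]

lemma anti (ht : SupportedOn S t) : SupportedOn S (anti m n t) :=
  have h : SupportedOn S (t - _root_.braid34 m n t) := ht.sub ht.braid34
  h.sub h.braid12

lemma swap (ht : SupportedOn S t) : SupportedOn S (swap m n t) :=
  ht.braid23.braid34.braid12.braid23

lemma full (ht : SupportedOn S t) : SupportedOn S (full m n t) :=
  (ht.anti.add ht.swap.anti).sub ht.anti.braid23.anti

/-- Tensors over an isotropic coordinate subspace are trace-free. This makes the Weyl, alternating
and fully antisymmetric vectors eigenvectors without subtracting traces. -/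
lemma contract23 (ht : SupportedOn S t) (hS : ∀ a ∈ S, idxRev a ∉ S) :
    contract23 m n t = 0 := by
  funext a d
  rw [contract23_apply]
  refine Finset.sum_eq_zero fun b _ => ?_
  rw [ht _ _ _ _ (fun h => hS b h.2.1 h.2.2.1), mul_zero]

end SupportedOn

/-- The eigenvalues of the separating operator. -/
def sepValue (m n : ℕ) : Fin 6 → ℂ :=
  ![2, 0, 2 + Complex.I * ((m : ℂ) - 2 * n - 2), -4, Complex.I * ((m : ℂ) - 2 * n - 2),
    2 + Complex.I * (2 * ((m : ℂ) - 2 * n) - 2)]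

/-- The signs by which the flip acts. -/
def swapValue : Fin 6 → ℂ := ![1, -1, 1, 1, -1, 1]

/-- The six vectors attached to tensors `w₁, w₂, w₄` in `V^{⊗4}` and `x₃, x₅` in `V^{⊗2}`. -/
def sixVec (w₁ w₂ w₄ : Tens4 m n) (x₃ x₅ : Tens2 m n) : Fin 6 → Tens4 m n :=
  ![weylVec w₁, altVec w₂, ricciVec (x₃ + flip2 m n x₃), full m n w₄,
    ricciVec (x₅ - flip2 m n x₅), ricciVec (metric2 m n)]

lemma flip2_metric2 : flip2 m n (metric2 m n) = metric2 m n := by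
  funext a b
  rw [braid_apply, metric2_apply, metric2_apply, smul_eq_mul]
  by_cases h : b = idxRev a
  · subst h
    simp only [idxRev_idxRev, if_true, metricSign_idxRev, idxParity_idxRev]
    linear_combination metricSign a * superSign_mul_self (idxParity a) (idxParity a)
  · have : ¬ a = idxRev b := fun h' => h (by rw [h', idxRev_idxRev])
    simp [h, this]

section

variable {w₁ w₂ w₄ : Tens4 m n} {x₃ x₅ : Tens2 m n}

lemma sixVec_mem (i : Fin 6) : sixVec w₁ w₂ w₄ x₃ x₅ i ∈ antiSub m n := by
  fin_cases i
  · exact weylVec_mem _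
  · exact anti_mem _
  · exact anti_mem _
  · exact full_mem _
  · exact anti_mem _
  · exact anti_mem _

lemma swap_sixVec (i : Fin 6) : swap m n (sixVec w₁ w₂ w₄ x₃ x₅ i) =
    swapValue i • sixVec w₁ w₂ w₄ x₃ x₅ i := by
  fin_cases i
  · exact (swap_weylVec w₁).trans (one_smul ℂ _).symm
  · exact (swap_altVec w₂).trans (neg_one_smul ℂ _).symm
  · refine (swap_ricciVec _).trans (Eq.trans ?_ (one_smul ℂ _).symm)
    rw [map_add, braid_braid, add_comm]; rfl
  · exact (swap_full w₄).trans (one_smul ℂ _).symm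
  · refine (swap_ricciVec _).trans (Eq.trans ?_ (neg_one_smul ℂ _).symm)
    rw [map_sub, braid_braid, ← neg_sub]
    simp only [ricciVec, map_neg]; rfl
  · refine (swap_ricciVec _).trans (Eq.trans ?_ (one_smul ℂ _).symm)
    rw [flip2_metric2]; rfl

/-- For the three trace-free types the eigenvalue is 1 + (flip sign) - (eigenvalue of `full`)/4,
giving 2, 0 and 1 + 1 - 24/4 = -4. For the Ricci types the flip contributes 2 or 0, and the
contraction contributes i(m - 2n - 2), with the trace term as well for the metric. -/
lemma sep_sixVec {S : Set (OspIdx m n)} (hS : ∀ a ∈ S, idxRev a ∉ S) (h₁ : SupportedOn S w₁)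
    (h₂ : SupportedOn S w₂) (h₄ : SupportedOn S w₄) (h₃ : trace2 m n (x₃ + flip2 m n x₃) = 0)
    (h₅ : trace2 m n (x₅ - flip2 m n x₅) = 0) (i : Fin 6) :
    sep m n (sixVec w₁ w₂ w₄ x₃ x₅ i) = sepValue m n i • sixVec w₁ w₂ w₄ x₃ x₅ i := by
  fin_cases i
  · change sep m n (weylVec w₁) = (2 : ℂ) • weylVec w₁
    rw [sep_of_contract23_eq_zero (weylVec_mem _), swap_weylVec, full_weylVec]
    · module
    · exact SupportedOn.contract23 ((h₁.add h₁.swap).anti.sub (h₁.full.smul _)) hS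
  · change sep m n (altVec w₂) = (0 : ℂ) • altVec w₂
    rw [sep_of_contract23_eq_zero (altVec_mem w₂), swap_altVec, full_altVec]
    · module
    · exact SupportedOn.contract23 (h₂.sub h₂.swap).anti hS
  · change sep m n (ricciVec _) = (2 + Complex.I * ((m : ℂ) - 2 * n - 2)) • ricciVec _
    rw [sep_ricciVec, map_add, braid_braid, add_comm (flip2 m n x₃), h₃]
    module
  · change sep m n (full m n w₄) = (-4 : ℂ) • full m n w₄
    rw [sep_of_contract23_eq_zero (full_mem _), swap_full, full_full]
    · module
    · exact SupportedOn.contract23 h₄.full hS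
  · change sep m n (ricciVec _) = (Complex.I * ((m : ℂ) - 2 * n - 2)) • ricciVec _
    have : flip2 m n (x₅ - flip2 m n x₅) = -(x₅ - flip2 m n x₅) := by
      rw [map_sub, braid_braid, neg_sub]
    rw [sep_ricciVec, this, h₅]
    simp only [ricciVec, map_neg]
    module
  · change sep m n (ricciVec _) = (2 + Complex.I * (2 * ((m : ℂ) - 2 * n) - 2)) • ricciVec _
    rw [sep_ricciVec, flip2_metric2, trace2_metric2]
    module

end

/-- The real parts are 2, 0, 2, -4, 0, 2. With M = m - 2n, the imaginary parts 0, M - 2, 2M - 2 must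
separate those with equal real part, which fails exactly for M = 2, 1, 0. -/
lemma sepValue_injective (h0 : (m : ℤ) - 2 * n ≠ 0) (h1 : (m : ℤ) - 2 * n ≠ 1)
    (h2 : (m : ℤ) - 2 * n ≠ 2) : Function.Injective (sepValue m n) := by
  have hre : ∀ i, (sepValue m n i).re = ((![2, 0, 2, -4, 0, 2] : Fin 6 → ℤ) i : ℝ) := by
    intro i
    fin_cases i <;> simp [sepValue]
  have him : ∀ i, (sepValue m n i).im = ((![0, 0, (m : ℤ) - 2 * n - 2, 0, (m : ℤ) - 2 * n - 2,
      2 * ((m : ℤ) - 2 * n) - 2] : Fin 6 → ℤ) i : ℝ) := by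
    intro i
    fin_cases i <;> simp [sepValue]
  intro i j hij
  have e1 := congrArg Complex.re hij
  have e2 := congrArg Complex.im hij
  rw [hre, hre, Int.cast_inj] at e1
  rw [him, him, Int.cast_inj] at e2
  fin_cases i <;> fin_cases j <;> simp at e1 e2 ⊢ <;> omega

end

/-! ### Orthogonal complements of invariant subspaces -/

noncomputable section

variable {m n : ℕ}

/-! ## A contravariant form -/

/-- The diagonal entries of the contravariant form on `V`. -/
def formCoeff : OspIdx m n → ℂ := Sum.elim (fun _ => 1) (fun _ => -Complex.I)

/-- The reason for -i on odd labels: the squares reproduce the parity sign by which the metric fails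
to be symmetric, so the twisted transposition preserves osp and contraction becomes adjoint to
insertion. -/
lemma formCoeff_mul_self (a : OspIdx m n) :
    formCoeff a * formCoeff a = superSign (idxParity a) (idxParity a) := by
  cases a <;> simp [formCoeff, idxParity]

lemma formCoeff_pow_four (a : OspIdx m n) : formCoeff a ^ 4 = 1 := by
  linear_combination (formCoeff a * formCoeff a + superSign (idxParity a) (idxParity a)) *
    formCoeff_mul_self a + superSign_mul_self (idxParity a) (idxParity a)

lemma formCoeff_ne_zero (a : OspIdx m n) : formCoeff a ≠ 0 := fun h => by
  simpa [h] using formCoeff_pow_four a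

lemma formCoeff_idxRev (a : OspIdx m n) : formCoeff (idxRev a) = formCoeff a := by
  cases a <;> rfl

/-- The antiautomorphism of `osp(m|2n)` given by a twisted transposition. -/
def transposeOsp (X : osp m n) : osp m n :=
  -- The cube is the inverse, as `formCoeff a` is a fourth root of unity.
  ⟨Matrix.of fun a b => formCoeff b * X.1 b a * formCoeff a ^ 3, by
    rw [mem_osp_iff]
    intro a b
    simp only [Matrix.of_apply, formCoeff_idxRev]
    rw [osp_entry X a b, metricSign_idxRev, metricSign_idxRev, ← formCoeff_mul_self,
      ← formCoeff_mul_self]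
    linear_combination (-(superSign (idxParity a) (idxParity b) * metricSign a * metricSign b *
      X.1 a (idxRev b) * formCoeff b ^ 3 * formCoeff a)) * formCoeff_pow_four a⟩

lemma transposeOsp_apply (X : osp m n) (a b : OspIdx m n) :
    (transposeOsp X).1 a b = formCoeff b * X.1 b a * formCoeff a ^ 3 := rfl

lemma transposeOsp_parityTwist (k : ZMod 2) (X : osp m n) :
    transposeOsp (parityTwist k X) = parityTwist k (transposeOsp X) :=
  osp_ext fun a b => by
    simp only [transposeOsp_apply, parityTwist_apply]
    rw [add_comm (idxParity b)]; ring

variable {N : Type*} [AddCommGroup N] [Module ℂ N]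

/-- The form on `V ⊗ N` induced by a form on `N`. -/
def vecForm (m n : ℕ) (B : N →ₗ[ℂ] N →ₗ[ℂ] ℂ) :
    (OspIdx m n → N) →ₗ[ℂ] (OspIdx m n → N) →ₗ[ℂ] ℂ :=
  LinearMap.mk₂ ℂ (fun f g => ∑ a, formCoeff a * B (f a) (g a))
    (fun f f' g => by simp [mul_add, Finset.sum_add_distrib])
    (fun z f g => by simp [-Fintype.sum_sum_type, Finset.mul_sum, mul_left_comm])
    (fun f g g' => by simp [mul_add, Finset.sum_add_distrib])
    (fun z f g => by simp [-Fintype.sum_sum_type, Finset.mul_sum, mul_left_comm])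

lemma vecForm_apply (B : N →ₗ[ℂ] N →ₗ[ℂ] ℂ) (f g : OspIdx m n → N) :
    vecForm m n B f g = ∑ a, formCoeff a * B (f a) (g a) := rfl

/-- The action is contravariant for the form `B`. -/
def IsContravariant (ρ : osp m n →ₗ[ℂ] Module.End ℂ N) (B : N →ₗ[ℂ] N →ₗ[ℂ] ℂ) : Prop :=
  ∀ X x y, B (ρ X x) y = B x (ρ (transposeOsp X) y)

/-- No Koszul signs enter the form: it is diagonal in the label of V, and the parity twist commutes
with the transposition. -/
lemma IsContravariant.vecForm {ρ : osp m n →ₗ[ℂ] Module.End ℂ N} {B : N →ₗ[ℂ] N →ₗ[ℂ] ℂ}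
    (h : IsContravariant ρ B) : IsContravariant (vecAct ρ) (vecForm m n B) := by
  intro X f g
  simp only [vecForm_apply, vecAct_apply, map_add, map_sum, LinearMap.add_apply, mul_add,
    Finset.sum_add_distrib, LinearMap.sum_apply, map_smul, LinearMap.smul_apply, smul_eq_mul,
    Finset.mul_sum, ← transposeOsp_parityTwist, h _ (f _)]
  congr 1
  rw [Finset.sum_comm]
  refine Finset.sum_congr rfl fun a _ => Finset.sum_congr rfl fun b _ => ?_
  rw [transposeOsp_apply]
  linear_combination -(formCoeff b * X.1 b a * (B (f a)) (g b)) * formCoeff_pow_four a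

/-- Every functional is represented by the form. -/
def RepresentsFunctionals (B : N →ₗ[ℂ] N →ₗ[ℂ] ℂ) : Prop :=
  ∀ f : N →ₗ[ℂ] ℂ, ∃ x, ∀ y, f y = B x y

lemma RepresentsFunctionals.vecForm {B : N →ₗ[ℂ] N →ₗ[ℂ] ℂ} (h : RepresentsFunctionals B) :
    RepresentsFunctionals (vecForm m n B) := by
  intro f
  choose x hx using fun a => h (f ∘ₗ LinearMap.single ℂ (fun _ : OspIdx m n => N) a)
  refine ⟨fun a => (formCoeff a)⁻¹ • x a, fun y => ?_⟩
  have : y = ∑ a, Pi.single a (y a) := (Finset.univ_sum_single y).symm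
  nth_rewrite 1 [this]
  rw [map_sum, vecForm_apply]
  refine Finset.sum_congr rfl fun a _ => ?_
  rw [map_smul, LinearMap.smul_apply, smul_eq_mul, mul_inv_cancel_left₀ (formCoeff_ne_zero a),
    ← hx]
  rfl

/-- The contravariant form on `V ⊗ V`. -/
def form2 (m n : ℕ) : Tens2 m n →ₗ[ℂ] Tens2 m n →ₗ[ℂ] ℂ :=
  vecForm m n (vecForm m n (LinearMap.mul ℂ ℂ))

/-- The contravariant form on `V ⊗ V ⊗ V ⊗ V`. -/
def form4 (m n : ℕ) : Tens4 m n →ₗ[ℂ] Tens4 m n →ₗ[ℂ] ℂ :=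
  vecForm m n (vecForm m n (form2 m n))

lemma form2_apply (x y : Tens2 m n) : form2 m n x y =
    ∑ a, ∑ b, formCoeff a * formCoeff b * (x a b * y a b) := by
  simp [-Fintype.sum_sum_type, form2, vecForm_apply, Finset.mul_sum, mul_assoc]

lemma form4_apply (t u : Tens4 m n) : form4 m n t u = ∑ a, ∑ b, ∑ c, ∑ d,
    formCoeff a * formCoeff b * formCoeff c * formCoeff d * (t a b c d * u a b c d) := by
  simp [-Fintype.sum_sum_type, form4, vecForm_apply, form2_apply, Finset.mul_sum, mul_assoc]

lemma contravariant_act4 : IsContravariant (act4 m n) (form4 m n) := by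
  have h : IsContravariant (0 : osp m n →ₗ[ℂ] Module.End ℂ ℂ) (LinearMap.mul ℂ ℂ) :=
    fun X x y => by simp
  exact h.vecForm.vecForm.vecForm.vecForm

lemma representsFunctionals_form4 : RepresentsFunctionals (form4 m n) := by
  have h : RepresentsFunctionals (LinearMap.mul ℂ ℂ) := fun f => ⟨f 1, fun y => by
    have := f.map_smul y 1
    rw [smul_eq_mul, mul_one] at this
    rw [this, smul_eq_mul, LinearMap.mul_apply', mul_comm]⟩
  exact h.vecForm.vecForm.vecForm.vecForm

lemma form4_braid12 (t u : Tens4 m n) :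
    form4 m n (braid12 m n t) u = form4 m n t (braid12 m n u) := by
  rw [form4_apply, form4_apply, Finset.sum_comm]
  refine Finset.sum_congr rfl fun a _ => Finset.sum_congr rfl fun b _ =>
    Finset.sum_congr rfl fun c _ => Finset.sum_congr rfl fun d _ => ?_
  rw [braid12_apply, braid12_apply, superSign_comm (idxParity b)]
  ring

lemma form4_braid23 (t u : Tens4 m n) :
    form4 m n (braid23 m n t) u = form4 m n t (braid23 m n u) := by
  rw [form4_apply, form4_apply]
  refine Finset.sum_congr rfl fun a _ => ?_
  rw [Finset.sum_comm]
  refine Finset.sum_congr rfl fun b _ =>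
    Finset.sum_congr rfl fun c _ => Finset.sum_congr rfl fun d _ => ?_
  rw [braid23_apply, braid23_apply, superSign_comm (idxParity c)]
  ring

lemma form4_braid34 (t u : Tens4 m n) :
    form4 m n (braid34 m n t) u = form4 m n t (braid34 m n u) := by
  rw [form4_apply, form4_apply]
  refine Finset.sum_congr rfl fun a _ => Finset.sum_congr rfl fun b _ => ?_
  rw [Finset.sum_comm]
  refine Finset.sum_congr rfl fun c _ => Finset.sum_congr rfl fun d _ => ?_
  rw [braid34_apply, braid34_apply, superSign_comm (idxParity d)]
  ring

lemma form4_anti (t u : Tens4 m n) : form4 m n (anti m n t) u = form4 m n t (anti m n u) := by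
  have h : braid12 m n (braid34 m n u) = braid34 m n (braid12 m n u) :=
    (LinearMap.congr_fun coxeterRelations_braid.ca u).symm
  simp only [anti, pairAnti, Module.End.mul_apply, LinearMap.sub_apply, Module.End.one_apply,
    map_sub, form4_braid12, form4_braid34, h]

lemma form4_swap (t u : Tens4 m n) : form4 m n (swap m n t) u = form4 m n t (swap m n u) := by
  have h : braid12 m n (braid34 m n (braid23 m n u)) =
      braid34 m n (braid12 m n (braid23 m n u)) :=
    (LinearMap.congr_fun coxeterRelations_braid.ca _).symm
  simp only [swap, pairSwap, Module.End.mul_apply, form4_braid12, form4_braid34, form4_braid23, h]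

lemma form4_full (t u : Tens4 m n) : form4 m n (full m n t) u = form4 m n t (full m n u) := by
  simp only [full_apply, map_add, map_sub, LinearMap.add_apply, LinearMap.sub_apply, form4_anti,
    form4_swap, form4_braid23, anti_swap]

/-- Adjointness reduces the norm of a Ricci-type tensor to a computation in V ⊗ V. -/
lemma form4_insert23 (x : Tens2 m n) (u : Tens4 m n) :
    form4 m n (insert23 m n x) u = form2 m n x (contract23 m n u) := by
  rw [form4_apply, form2_apply]
  refine Finset.sum_congr rfl fun a _ => ?_
  have : ∀ b, (∑ c, ∑ d, formCoeff a * formCoeff b * formCoeff c * formCoeff d *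
      (insert23 m n x a b c d * u a b c d)) = ∑ d, formCoeff a * formCoeff d *
        (x a d * (metricSign (idxRev b) * u a b (idxRev b) d)) := by
    intro b
    rw [Finset.sum_comm]
    refine Finset.sum_congr rfl fun d _ => ?_
    simp only [insert23_apply, ite_mul, zero_mul, mul_ite, mul_zero, Finset.sum_ite_eq',
      Finset.mem_univ, if_true, formCoeff_idxRev]
    rw [metricSign_idxRev]
    linear_combination (formCoeff a * formCoeff d * metricSign b * x a d * u a b (idxRev b) d) *
      formCoeff_mul_self b
  rw [Finset.sum_congr rfl fun b _ => this b, Finset.sum_comm]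
  refine Finset.sum_congr rfl fun d _ => ?_
  rw [contract23_apply, Finset.mul_sum, Finset.mul_sum]

/-- An invariant subspace of `V^{⊗4}`. -/
def Stable (U : Submodule ℂ (Tens4 m n)) : Prop := ∀ X : osp m n, ∀ t ∈ U, act4 m n X t ∈ U

/-- A stable subspace of the double antisymmetrizer's range is everything if it contains vectors
which are not isotropic and one of which lies in every nonzero stable subspace. -/
lemma eq_antiSub_of_stable {ι : Type*} {v : ι → Tens4 m n}
    (hv : ∀ i, form4 m n (v i) (v i) ≠ 0)
    (hU : ∀ U : Submodule ℂ (Tens4 m n), U ≤ antiSub m n → U ≠ ⊥ → Stable U → ∃ i, v i ∈ U)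
    {T : Submodule ℂ (Tens4 m n)} (hT : T ≤ antiSub m n) (hs : Stable T) (hvT : ∀ i, v i ∈ T) :
    T = antiSub m n := by
  refine le_antisymm hT fun t ht => ?_
  by_contra hn
  obtain ⟨f, hf, hfT⟩ := Submodule.exists_le_ker_of_notMem hn
  obtain ⟨τ, hτ⟩ := representsFunctionals_form4 f
  -- The orthogonal complement of `T` inside `antiSub`. Being nonzero and stable, it would contain
  -- some `v i`, which lies in `T` as well and would be isotropic.
  let U : Submodule ℂ (Tens4 m n) :=
    antiSub m n ⊓ ⨅ u : T, LinearMap.ker ((form4 m n).flip u)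
  have hmem : ∀ s, s ∈ U ↔ s ∈ antiSub m n ∧ ∀ u ∈ T, form4 m n s u = 0 := by
    intro s; simp [U]
  suffices h : U ≠ ⊥ ∧ Stable U by
    obtain ⟨i, hi⟩ := hU U inf_le_left h.1 h.2
    exact hv i (((hmem _).1 hi).2 _ (hvT i))
  refine ⟨?_, ?_⟩
  · intro h0
    -- The vector τ represents a functional vanishing on `T` but not at `t`. Its antisymmetrization
    -- represents 4 times this functional on `antiSub`, so it is orthogonal to `T` and nonzero.
    have h1 : anti m n τ ∈ U := by
      refine (hmem _).2 ⟨anti_mem _, fun u hu => ?_⟩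
      rw [form4_anti, anti_of_mem (hT hu), ← hτ, map_smul, LinearMap.mem_ker.1 (hfT hu), smul_zero]
    rw [h0, Submodule.mem_bot] at h1
    have h2 := form4_anti τ t
    rw [h1, anti_of_mem ht, ← hτ, map_smul] at h2
    simp [hf] at h2
  · intro X s h
    rw [hmem] at h ⊢
    refine ⟨?_, fun u hu => ?_⟩
    · obtain ⟨h1, h2⟩ := mem_antiSub.1 h.1
      refine mem_antiSub.2 ⟨?_, ?_⟩
      · rw [intertwines_braid12 X s, h1, map_neg]
      · rw [intertwines_braid34 X s, h2, map_neg]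
    · rw [contravariant_act4 X s u]
      exact h.2 _ (hs _ _ hu)

end

/-! ### Passing to the top degree of a grading -/

noncomputable section

variable {m n : ℕ} {N : Type*} [AddCommGroup N] [Module ℂ N]

/-! ## Root vectors -/

/-- The element `e_a ∧ e_b` of `osp(m|2n) ≅ Λ²V`. -/
def wedge (a b : OspIdx m n) : osp m n :=
  ⟨Matrix.of fun x z => metricSign z * ((if x = a ∧ z = idxRev b then 1 else 0) -
      superSign (idxParity a) (idxParity b) * if x = b ∧ z = idxRev a then 1 else 0), by
    rw [mem_osp_iff]
    intro x z
    simp only [Matrix.of_apply, idxRev_eq_iff]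
    have h1 := superSign_mul_self (idxParity a) (idxParity b)
    have h2 := metricSign_mul_self x
    by_cases hA : x = idxRev a ∧ z = idxRev b <;> by_cases hB : x = idxRev b ∧ z = idxRev a
    · have hA' : z = idxRev b ∧ x = idxRev a := hA.symm
      have hB' : z = idxRev a ∧ x = idxRev b := hB.symm
      have h3 : superSign (idxParity x) (idxParity z) =
          superSign (idxParity a) (idxParity b) := by
        rw [hA.1, hA.2, idxParity_idxRev, idxParity_idxRev]
      rw [if_pos hA, if_pos hB, if_pos hA', if_pos hB', h3]
      linear_combination (superSign (idxParity a) (idxParity b) -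
        superSign (idxParity a) (idxParity b) * superSign (idxParity a) (idxParity b)) *
          metricSign z * h2 - metricSign z * h1
    · have hA' : z = idxRev b ∧ x = idxRev a := hA.symm
      have hB' : ¬ (z = idxRev a ∧ x = idxRev b) := fun h => hB h.symm
      have h3 : superSign (idxParity x) (idxParity z) =
          superSign (idxParity a) (idxParity b) := by
        rw [hA.1, hA.2, idxParity_idxRev, idxParity_idxRev]
      rw [if_pos hA, if_neg hB, if_pos hA', if_neg hB', h3]
      linear_combination (-(metricSign z * superSign (idxParity a) (idxParity b) *
        superSign (idxParity a) (idxParity b))) * h2 - metricSign z * h1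
    · have hA' : ¬ (z = idxRev b ∧ x = idxRev a) := fun h => hA h.symm
      have hB' : z = idxRev a ∧ x = idxRev b := hB.symm
      have h3 : superSign (idxParity x) (idxParity z) =
          superSign (idxParity a) (idxParity b) := by
        rw [hB.1, hB.2, idxParity_idxRev, idxParity_idxRev, superSign_comm]
      rw [if_neg hA, if_pos hB, if_neg hA', if_pos hB', h3]
      linear_combination metricSign z * superSign (idxParity a) (idxParity b) * h2
    · have hA' : ¬ (z = idxRev b ∧ x = idxRev a) := fun h => hA h.symm
      have hB' : ¬ (z = idxRev a ∧ x = idxRev b) := fun h => hB h.symm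
      rw [if_neg hA, if_neg hB, if_neg hA', if_neg hB']
      ring⟩

lemma wedge_apply (a b x z : OspIdx m n) : (wedge a b).1 x z =
    metricSign z * ((if x = a ∧ z = idxRev b then 1 else 0) -
      superSign (idxParity a) (idxParity b) * if x = b ∧ z = idxRev a then 1 else 0) := rfl

lemma parityTwist_wedge (k : ZMod 2) (a b : OspIdx m n) :
    parityTwist k (wedge a b) = superSign k (idxParity a + idxParity b) • wedge a b :=
  osp_ext fun x z => by
    change _ = superSign k (idxParity a + idxParity b) * (wedge a b).1 x z
    rw [parityTwist_apply, wedge_apply]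
    by_cases hA : x = a ∧ z = idxRev b
    · rw [hA.1, hA.2, idxParity_idxRev]
    · by_cases hB : x = b ∧ z = idxRev a
      · rw [hB.1, hB.2, idxParity_idxRev, add_comm (idxParity b)]
      · rw [if_neg hA, if_neg hB]; ring

lemma vecAct_wedge_apply (ρ : osp m n →ₗ[ℂ] Module.End ℂ N) (a b : OspIdx m n)
    (f : OspIdx m n → N) (x : OspIdx m n) : vecAct ρ (wedge a b) f x =
      (if x = a then metricSign (idxRev b) else 0) • f (idxRev b) -
      (superSign (idxParity a) (idxParity b) * if x = b then metricSign (idxRev a) else 0) •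
        f (idxRev a) +
      superSign (idxParity x) (idxParity a + idxParity b) • ρ (wedge a b) (f x) := by
  rw [vecAct_apply, parityTwist_wedge, map_smul, LinearMap.smul_apply]
  congr 1
  simp only [wedge_apply, mul_sub, sub_smul, Finset.sum_sub_distrib, ite_and]
  congr 1
  · by_cases h : x = a <;> simp [h, ite_smul, -Fintype.sum_sum_type]
  · by_cases h : x = b
    · simp [h, ite_smul, -Fintype.sum_sum_type, mul_comm]
    · simp [h]

lemma act2_wedge_apply (a b : OspIdx m n) (y : Tens2 m n) (z w : OspIdx m n) :
    act2 m n (wedge a b) y z w =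
      (if z = a then metricSign (idxRev b) else 0) * y (idxRev b) w -
      superSign (idxParity a) (idxParity b) * (if z = b then metricSign (idxRev a) else 0) *
        y (idxRev a) w +
      superSign (idxParity z) (idxParity a + idxParity b) *
        ((if w = a then metricSign (idxRev b) else 0) * y z (idxRev b) -
        superSign (idxParity a) (idxParity b) * (if w = b then metricSign (idxRev a) else 0) *
          y z (idxRev a)) := by
  simp only [act2, vecAct_wedge_apply, Pi.add_apply, Pi.sub_apply, Pi.smul_apply, smul_eq_mul,
    LinearMap.zero_apply, mul_zero, add_zero]

lemma act4_wedge_apply (a b : OspIdx m n) (t : Tens4 m n) (x y z w : OspIdx m n) :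
    act4 m n (wedge a b) t x y z w =
      (if x = a then metricSign (idxRev b) else 0) * t (idxRev b) y z w -
      superSign (idxParity a) (idxParity b) * (if x = b then metricSign (idxRev a) else 0) *
        t (idxRev a) y z w +
      superSign (idxParity x) (idxParity a + idxParity b) *
        ((if y = a then metricSign (idxRev b) else 0) * t x (idxRev b) z w -
        superSign (idxParity a) (idxParity b) * (if y = b then metricSign (idxRev a) else 0) *
          t x (idxRev a) z w +
        superSign (idxParity y) (idxParity a + idxParity b) *
          act2 m n (wedge a b) (t x y) z w) := by
  simp only [act4, vecAct_wedge_apply, Pi.add_apply, Pi.sub_apply, Pi.smul_apply, smul_eq_mul]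

/-! ## The grading attached to an odd label -/

/-- The weight of `e_x` under the Cartan element `e_p ∧ e_{p'}`. -/
def idxDeg (p x : OspIdx m n) : ℤ := if x = p then 1 else if x = idxRev p then -1 else 0

lemma idxDeg_idxRev {p : OspIdx m n} (hp : p ≠ idxRev p) (x : OspIdx m n) :
    idxDeg p (idxRev x) = -idxDeg p x := by
  unfold idxDeg
  simp only [idxRev_eq_iff x p, idxRev_eq_idxRev x p]
  by_cases h1 : x = p
  · subst h1; simp [hp]
  · by_cases h2 : x = idxRev p
    · simp [h2, hp.symm]
    · simp [h1, h2, Ne.symm h1]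

lemma idxDeg_le (p x : OspIdx m n) : idxDeg p x ≤ 1 := by unfold idxDeg; split_ifs <;> simp

lemma le_idxDeg (p x : OspIdx m n) : -1 ≤ idxDeg p x := by unfold idxDeg; split_ifs <;> simp

/-- The filtration by degree on `V ⊗ N` induced by one on `N`. -/
def vecFilt (p : OspIdx m n) (Φ : ℤ → Submodule ℂ N) (k : ℤ) :
    Submodule ℂ (OspIdx m n → N) :=
  Submodule.pi Set.univ fun x => Φ (k - idxDeg p x)

lemma mem_vecFilt {p : OspIdx m n} {Φ : ℤ → Submodule ℂ N} {k : ℤ} {f : OspIdx m n → N} :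
    f ∈ vecFilt p Φ k ↔ ∀ x, f x ∈ Φ (k - idxDeg p x) := by simp [vecFilt, Submodule.mem_pi]

/-- `X` raises the filtration by `r`. -/
def Raises (ρ : osp m n →ₗ[ℂ] Module.End ℂ N) (Φ : ℤ → Submodule ℂ N) (X : osp m n) (r : ℤ) :
    Prop := ∀ k, ∀ x ∈ Φ k, ρ X x ∈ Φ (k + r)

/-- e_a ∧ e_b carries e_{b'}, of degree -deg b, to e_a, and e_{a'} to e_b; both raise the degree by
deg a + deg b. -/
lemma Raises.vecFilt {ρ : osp m n →ₗ[ℂ] Module.End ℂ N} {Φ : ℤ → Submodule ℂ N}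
    {p a b : OspIdx m n} (hp : p ≠ idxRev p)
    (h : Raises ρ Φ (wedge a b) (idxDeg p a + idxDeg p b)) :
    Raises (vecAct ρ) (vecFilt p Φ) (wedge a b) (idxDeg p a + idxDeg p b) := by
  intro k f hf
  rw [mem_vecFilt] at hf ⊢
  intro x
  rw [vecAct_wedge_apply]
  refine add_mem (sub_mem ?_ ?_) (Submodule.smul_mem _ _ ?_)
  · by_cases hx : x = a
    · subst hx
      refine Submodule.smul_mem _ _ ?_
      have := hf (idxRev b)
      rw [idxDeg_idxRev hp] at this
      convert this using 2
      ring
    · simp [hx]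
  · by_cases hx : x = b
    · subst hx
      refine Submodule.smul_mem _ _ ?_
      have := hf (idxRev a)
      rw [idxDeg_idxRev hp] at this
      convert this using 2
      ring
    · simp [hx]
  · convert h _ _ (hf x) using 2
    ring

/-- The filtration is exhausted below `-l` and vanishes above `l`. -/
def FiltBound (Φ : ℤ → Submodule ℂ N) (l : ℤ) : Prop :=
  (∀ k ≤ -l, Φ k = ⊤) ∧ ∀ k, l < k → Φ k = ⊥

lemma FiltBound.vecFilt {Φ : ℤ → Submodule ℂ N} {l : ℤ} (h : FiltBound Φ l)
    (p : OspIdx m n) : FiltBound (vecFilt p Φ) (l + 1) := by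
  refine ⟨fun k hk => ?_, fun k hk => ?_⟩
  · rw [eq_top_iff]
    intro f _
    rw [mem_vecFilt]
    intro x
    rw [h.1 _ (by linarith [le_idxDeg p x])]
    trivial
  · rw [eq_bot_iff]
    intro f hf
    rw [mem_vecFilt] at hf
    rw [Submodule.mem_bot]
    funext x
    have := hf x
    rwa [h.2 _ (by linarith [idxDeg_le p x]), Submodule.mem_bot] at this

/-- The degree filtration of `V^{⊗4}`. -/
def filt4 (p : OspIdx m n) : ℤ → Submodule ℂ (Tens4 m n) :=
  vecFilt p (vecFilt p (vecFilt p (vecFilt p fun k => if k ≤ 0 then ⊤ else ⊥)))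

lemma filtBound_filt4 (p : OspIdx m n) : FiltBound (filt4 p) 4 := by
  have h : FiltBound (N := ℂ) (fun k => if k ≤ 0 then ⊤ else ⊥) 0 :=
    ⟨fun k hk => if_pos (by simpa using hk), fun k hk => if_neg (by simpa using hk)⟩
  exact (((h.vecFilt p).vecFilt p).vecFilt p).vecFilt p

lemma raises_filt4 {p : OspIdx m n} (hp : p ≠ idxRev p) (a b : OspIdx m n) :
    Raises (act4 m n) (filt4 p) (wedge a b) (idxDeg p a + idxDeg p b) := by
  refine Raises.vecFilt hp (Raises.vecFilt hp (Raises.vecFilt hp (Raises.vecFilt hp ?_)))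
  intro k x _
  simp

/-- In a nonzero stable subspace there is a nonzero subspace annihilated by the root vectors of
positive degree and stable under those of degree zero. -/
lemma exists_top_degree {U : Submodule ℂ (Tens4 m n)} (hU : U ≠ ⊥) (hs : Stable U)
    {p : OspIdx m n} (hp : p ≠ idxRev p) : ∃ U' ≤ U, U' ≠ ⊥ ∧
      (∀ a b, 0 < idxDeg p a + idxDeg p b → ∀ t ∈ U', act4 m n (wedge a b) t = 0) ∧
      ∀ a b, idxDeg p a + idxDeg p b = 0 → ∀ t ∈ U', act4 m n (wedge a b) t ∈ U' := by
  -- `filt4 p k` consists of the tensors with all components in degree at least k. The filtration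
  -- avoids decomposing `U` into graded pieces: at the last level that meets `U`, raising the degree
  -- gives zero.
  obtain ⟨k, hk, hmax⟩ := Int.exists_greatest_of_bdd (P := fun k => U ⊓ filt4 p k ≠ ⊥)
    ⟨4, fun k hk => by
      by_contra hlt
      exact hk (by rw [(filtBound_filt4 p).2 k (not_le.1 hlt), inf_bot_eq])⟩
    ⟨-4, by rw [(filtBound_filt4 p).1 _ le_rfl, inf_top_eq]; exact hU⟩
  refine ⟨U ⊓ filt4 p k, inf_le_left, hk, fun a b hab t ht => ?_, fun a b hab t ht => ?_⟩
  · have h1 : U ⊓ filt4 p (k + (idxDeg p a + idxDeg p b)) = ⊥ := by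
      by_contra h
      have := hmax _ h
      omega
    rw [← Submodule.mem_bot ℂ, ← h1]
    exact ⟨hs _ _ ht.1, raises_filt4 hp a b k t ht.2⟩
  · refine ⟨hs _ _ ht.1, ?_⟩
    have := raises_filt4 hp a b k t ht.2
    rwa [hab, add_zero] at this

end

/-! ### Λ²V under the subalgebra of degree zero -/

noncomputable section

variable {m n : ℕ}

/-! ## Stable subspaces of `Λ²V` under the subalgebra of degree zero -/

/-- Two odd labels `p, q` such that `p, p', q, q'` are different. -/
structure OddFrame (p q : OspIdx m n) : Prop where
  hp : idxParity p = 1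
  hq : idxParity q = 1
  pp : p ≠ idxRev p
  qq : q ≠ idxRev q
  pq : p ≠ q
  pq' : p ≠ idxRev q

lemma metricSign_ne_zero (a : OspIdx m n) : metricSign a ≠ 0 := fun h => by
  simpa [h] using metricSign_mul_self a

lemma superSign_ne_zero (i j : ZMod 2) : superSign i j ≠ 0 := fun h => by
  simpa [h] using superSign_mul_self i j

/-- The element `e_a ⊗ e_b` of `V ⊗ V`. -/
def basis2 (a b : OspIdx m n) : Tens2 m n := Pi.single a (Pi.single b 1)

lemma basis2_apply (a b x y : OspIdx m n) :
    basis2 a b x y = if x = a ∧ y = b then 1 else 0 := by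
  by_cases h : x = a
  · subst h; simp [basis2, Pi.single_apply]
  · simp [basis2, h]

/-- The element `e_a ∧ e_b` of `V ⊗ V`. -/
def wedge2 (a b : OspIdx m n) : Tens2 m n := basis2 a b - flip2 m n (basis2 a b)

lemma wedge2_apply (a b x y : OspIdx m n) : wedge2 a b x y =
    (if x = a ∧ y = b then 1 else 0) -
      superSign (idxParity x) (idxParity y) * if y = a ∧ x = b then 1 else 0 := by
  simp [wedge2, braid_apply, basis2_apply]

lemma wedge2_apply_of_odd {a b : OspIdx m n} (ha : idxParity a = 1) (hb : idxParity b = 1)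
    (x y : OspIdx m n) : wedge2 a b x y =
    (if x = a ∧ y = b then 1 else 0) + if x = b ∧ y = a then 1 else 0 := by
  rw [wedge2_apply]
  by_cases h : x = b ∧ y = a
  · rw [if_pos h, if_pos h.symm, h.1, h.2, ha, hb, superSign_one_one]
    ring
  · rw [if_neg h, if_neg (fun h' : y = a ∧ x = b => h h'.symm)]
    ring

lemma wedge2_comm_of_odd {a b : OspIdx m n} (ha : idxParity a = 1) (hb : idxParity b = 1) :
    wedge2 a b = wedge2 b a := by
  funext x y
  rw [wedge2_apply_of_odd ha hb, wedge2_apply_of_odd hb ha, add_comm]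

/-- Lagrange interpolation: the product of g - j over the other values j of g vanishes off the level
set of k and is a nonzero constant on it. -/
lemma restrict_mem_of_mul_mem {Y : Submodule ℂ (Tens2 m n)} {g : OspIdx m n → OspIdx m n → ℤ}
    (hY : ∀ y ∈ Y, (fun z w => (g z w : ℂ) * y z w : Tens2 m n) ∈ Y) (k : ℤ) {y : Tens2 m n}
    (hy : y ∈ Y) : (fun z w => if g z w = k then y z w else 0 : Tens2 m n) ∈ Y := by
  have hprod : ∀ S : Finset ℤ,
      (fun z w => (∏ j ∈ S, ((g z w : ℂ) - j)) * y z w : Tens2 m n) ∈ Y := by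
    intro S
    induction S using Finset.induction_on with
    | empty => simpa using hy
    | insert j S hj ih =>
      have := sub_mem (hY _ ih) (Y.smul_mem (j : ℂ) ih)
      convert this using 1
      funext z w
      rw [Finset.prod_insert hj]
      simp only [Pi.sub_apply, Pi.smul_apply, smul_eq_mul]
      ring
  let S : Finset ℤ := (Finset.univ.image fun x : OspIdx m n × OspIdx m n => g x.1 x.2).erase k
  have hk : ∏ j ∈ S, ((k : ℂ) - j) ≠ 0 := by
    refine Finset.prod_ne_zero_iff.2 fun j hj => ?_
    rw [sub_ne_zero, Ne, Int.cast_inj]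
    exact (Finset.ne_of_mem_erase hj).symm
  convert Y.smul_mem (∏ j ∈ S, ((k : ℂ) - j))⁻¹ (hprod S) using 1
  funext z w
  simp only [Pi.smul_apply, smul_eq_mul]
  by_cases h : g z w = k
  · rw [if_pos h, h, ← mul_assoc, inv_mul_cancel₀ hk, one_mul]
  · have hS : g z w ∈ S :=
      Finset.mem_erase.2 ⟨h, Finset.mem_image.2 ⟨(z, w), Finset.mem_univ _, rfl⟩⟩
    have h0 : ∏ j ∈ S, ((g z w : ℂ) - j) = 0 := Finset.prod_eq_zero hS (sub_self _)
    rw [if_neg h, h0, zero_mul, mul_zero]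

/-- The hypotheses on the space of slices: antisymmetric tensors, stable under the part of
degree zero for the grading by `p`. -/
structure DegZeroStable (p : OspIdx m n) (Y : Submodule ℂ (Tens2 m n)) : Prop where
  anti : ∀ y ∈ Y, ∀ a b, y a b = -(superSign (idxParity a) (idxParity b) * y b a)
  wedge : ∀ a b, a ≠ p → a ≠ idxRev p → b ≠ p → b ≠ idxRev p → ∀ y ∈ Y,
    act2 m n (wedge a b) y ∈ Y
  deg : ∀ y ∈ Y, (fun z w => ((idxDeg p z + idxDeg p w : ℤ) : ℂ) * y z w : Tens2 m n) ∈ Y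

lemma idxDeg_self (p : OspIdx m n) : idxDeg p p = 1 := if_pos rfl

lemma idxDeg_of_ne {p x : OspIdx m n} (h : x ≠ p) (h' : x ≠ idxRev p) : idxDeg p x = 0 := by
  simp [idxDeg, h, h']

lemma OddFrame.rev_left {p q : OspIdx m n} (h : OddFrame p q) : OddFrame (idxRev p) q where
  hp := by rw [idxParity_idxRev, h.hp]
  hq := h.hq
  pp := by rw [idxRev_idxRev]; exact h.pp.symm
  qq := h.qq
  pq := fun h' => h.pq' ((idxRev_eq_iff _ _).1 h')
  pq' := fun h' => h.pq ((idxRev_eq_idxRev _ _).1 h').symm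

lemma DegZeroStable.rev {p : OspIdx m n} {Y : Submodule ℂ (Tens2 m n)}
    (hp : p ≠ idxRev p) (hY : DegZeroStable p Y) : DegZeroStable (idxRev p) Y where
  anti := hY.anti
  wedge a b h1 h2 h3 h4 := hY.wedge a b (by rwa [idxRev_idxRev] at h2) h1
    (by rwa [idxRev_idxRev] at h4) h3
  deg y hy := by
    convert Y.neg_mem (hY.deg y hy) using 1
    have : ∀ x : OspIdx m n, idxDeg (idxRev p) x = -idxDeg p x := by
      intro x
      rw [← idxDeg_idxRev hp]
      simp only [idxDeg, idxRev_eq_iff x p, idxRev_idxRev, idxRev_eq_idxRev x p, eq_comm (a := p)]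
    funext z w
    rw [this, this]
    change _ = -(((idxDeg p z + idxDeg p w : ℤ) : ℂ) * y z w)
    push_cast
    ring

section

variable {p q : OspIdx m n} {Y : Submodule ℂ (Tens2 m n)}

/-- The part of degree 2 of V ⊗ V is the line through e_p ⊗ e_p, and e_p ∧ e_p is twice this vector
because p is odd. -/
lemma wedge2_self_of_entry (hY : DegZeroStable p Y) (h : OddFrame p q) {y : Tens2 m n}
    (hy : y ∈ Y) (hpp : y p p ≠ 0) : wedge2 p p ∈ Y := by
  have h1 := restrict_mem_of_mul_mem hY.deg 2 hy
  convert Y.smul_mem (2 / y p p) h1 using 1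
  funext z w
  have h2 : idxDeg p z + idxDeg p w = 2 ↔ z = p ∧ w = p := by
    unfold idxDeg
    split_ifs <;> simp_all
  simp only [Pi.smul_apply, smul_eq_mul, h2, wedge2_apply]
  by_cases h3 : z = p ∧ w = p
  · obtain ⟨rfl, rfl⟩ := h3
    simp [h.hp]
    field_simp
    norm_num
  · rw [if_neg h3, if_neg h3, if_neg fun h' => h3 h'.symm]
    simp

lemma degree_one_iff (hp : p ≠ idxRev p) (z w : OspIdx m n) :
    idxDeg p z + idxDeg p w = 1 ↔
      (z = p ∧ w ≠ p ∧ w ≠ idxRev p) ∨ (w = p ∧ z ≠ p ∧ z ≠ idxRev p) := by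
  unfold idxDeg
  split_ifs <;> simp_all

/-- The part of degree 1 is e_p ∧ v with v orthogonal to e_p and e_{p'}; it remains to move v to e_q
by a root vector. If v has a component along e_{q'}, then e_q ∧ e_q does it. Otherwise e_q ∧ e_{c'}
carries e_c to e_q, and its other term, which acts on e_{q'}, contributes nothing. -/
lemma wedge2_of_degree_one (hY : DegZeroStable p Y) (h : OddFrame p q) {y : Tens2 m n}
    (hy : y ∈ Y) {c : OspIdx m n} (hc : c ≠ p) (hc' : c ≠ idxRev p) (hpc : y p c ≠ 0) :
    wedge2 p q ∈ Y := by
  obtain ⟨r, hr, hr1, hr2⟩ : ∃ r ∈ Y, (∀ z w, ¬ ((z = p ∧ w ≠ p ∧ w ≠ idxRev p) ∨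
      (w = p ∧ z ≠ p ∧ z ≠ idxRev p)) → r z w = 0) ∧ r p c ≠ 0 := by
    refine ⟨_, restrict_mem_of_mul_mem hY.deg 1 hy, fun z w hzw => ?_, ?_⟩
    · exact if_neg fun h' => hzw ((degree_one_iff h.pp z w).1 h')
    · rwa [if_pos ((degree_one_iff h.pp p c).2 (Or.inl ⟨rfl, hc, hc'⟩))]
  have hq'p : idxRev q ≠ p := h.pq'.symm
  have hq'p' : idxRev q ≠ idxRev p := fun h' => h.pq ((idxRev_eq_idxRev _ _).1 h')
  have hqp' : q ≠ idxRev p := fun h' => hq'p (by rw [h', idxRev_idxRev])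
  by_cases hq' : r p (idxRev q) = 0
  · have hcq : c ≠ idxRev q := fun h' => hr2 (by rw [h', hq'])
    have hc'q : idxRev c ≠ q := fun h' => hcq (by rw [← h', idxRev_idxRev])
    have hc'p : idxRev c ≠ p := fun h' => hc' (by rw [← h', idxRev_idxRev])
    have hc'p' : idxRev c ≠ idxRev p := fun h' => hc ((idxRev_eq_idxRev _ _).1 h').symm
    have hmem := hY.wedge q (idxRev c) h.pq.symm hqp' hc'p hc'p' r hr
    convert Y.smul_mem (-(superSign 1 (idxParity c) * metricSign c * r p c)⁻¹) hmem using 1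
    have h0 : superSign 1 (idxParity c) * metricSign c * r p c ≠ 0 :=
      mul_ne_zero (mul_ne_zero (superSign_ne_zero _ _) (metricSign_ne_zero _)) hr2
    have hqz : ∀ w, r (idxRev q) w = 0 := by
      intro w
      by_cases hw : w = p
      · rw [hw, hY.anti r hr, hq', mul_zero, neg_zero]
      · exact hr1 _ _ (by tauto)
    have hzq : ∀ w, r w (idxRev q) = 0 := by
      intro w
      rw [hY.anti r hr, hqz, mul_zero, neg_zero]
    funext z w
    rw [neg_smul, Pi.neg_apply, Pi.neg_apply, Pi.smul_apply, Pi.smul_apply, smul_eq_mul,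
      ← neg_eq_iff_eq_neg, eq_inv_mul_iff_mul_eq₀ h0]
    rw [act2_wedge_apply, hqz, hzq, idxRev_idxRev, wedge2_apply, h.hq]
    have hrc : ∀ w, w ≠ p → r c w = 0 := fun w hw => hr1 _ _ (by tauto)
    have hrc' : ∀ w, w ≠ p → r w c = 0 := fun w hw => hr1 _ _ (by tauto)
    have hcp := hY.anti r hr c p
    rw [h.hp, superSign_comm] at hcp
    have hpq := h.pq
    have hpar1 := h.hp
    have hpar2 := h.hq
    by_cases hz : z = q
    · by_cases hw : w = p
      · subst hz hw
        simp only [if_true, and_self, hpq, hpq.symm, if_false, hcp]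
        rw [hpar1, hpar2]
        simp
        ring
      · simp [hz, hw, hrc, idxParity_idxRev, h.hq, hpq.symm, hrc' _ hpq.symm]
    · by_cases hw : w = q
      · by_cases hzp : z = p
        · subst hzp hw
          simp [hz, superSign_add_right, idxParity_idxRev, hpar1]
          ring
        · simp [hz, hzp, hw, hrc' _ hzp]
      · simp [hz, hw]
  · have hmem := hY.wedge q q h.pq.symm hqp' h.pq.symm hqp' r hr
    convert Y.smul_mem (2 * metricSign (idxRev q) * r p (idxRev q))⁻¹ hmem using 1
    have h0 : 2 * metricSign (idxRev q) * r p (idxRev q) ≠ 0 :=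
      mul_ne_zero (mul_ne_zero two_ne_zero (metricSign_ne_zero _)) hq'
    have hrc : ∀ w, w ≠ p → r (idxRev q) w = 0 := fun w hw => hr1 _ _ (by tauto)
    have hrc' : ∀ w, w ≠ p → r w (idxRev q) = 0 := fun w hw => hr1 _ _ (by tauto)
    have hcp := hY.anti r hr (idxRev q) p
    have hpar1 := h.hp
    have hpar2 := h.hq
    have hpq := h.pq
    rw [idxParity_idxRev, h.hp, h.hq] at hcp
    funext z w
    rw [Pi.smul_apply, Pi.smul_apply, smul_eq_mul, eq_inv_mul_iff_mul_eq₀ h0,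
      act2_wedge_apply, wedge2_apply, h.hq, zmod_two_one_add_one]
    by_cases hz : z = q
    · by_cases hw : w = p
      · subst hz hw
        simp only [if_true, and_self, hpq, hpq.symm, if_false, hcp]
        rw [hpar1, hpar2]
        simp
        ring
      · simp [hz, hw, hrc, hpq.symm, hrc' _ hpq.symm]
    · by_cases hw : w = q
      · by_cases hzp : z = p
        · subst hzp hw
          simp [hz]
          ring
        · simp [hz, hzp, hw, hrc' _ hzp]
      · simp [hz, hw]

/-- e_q ∧ e_q maps e_{q'} to ±2e_q and kills all other basis vectors. Its square on V ⊗ V therefore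
sees only the entry at e_{q'} ⊗ e_{q'}. -/
lemma wedge2_self_of_degree_zero (hY : DegZeroStable p Y) (h : OddFrame p q) {y : Tens2 m n}
    (hy : y ∈ Y) (hq : y (idxRev q) (idxRev q) ≠ 0) : wedge2 q q ∈ Y := by
  have hq'p : idxRev q ≠ p := h.pq'.symm
  have hqp' : q ≠ idxRev p := fun h' => hq'p (by rw [h', idxRev_idxRev])
  have hmem := hY.wedge q q h.pq.symm hqp' h.pq.symm hqp' _
    (hY.wedge q q h.pq.symm hqp' h.pq.symm hqp' y hy)
  have h0 : 4 * y (idxRev q) (idxRev q) ≠ 0 := mul_ne_zero (by norm_num) hq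
  convert Y.smul_mem (4 * y (idxRev q) (idxRev q))⁻¹ hmem using 1
  funext z w
  have h1 := metricSign_mul_self (idxRev q)
  rw [Pi.smul_apply, Pi.smul_apply, smul_eq_mul, eq_inv_mul_iff_mul_eq₀ h0]
  simp only [act2_wedge_apply, wedge2_apply, h.hq, zmod_two_one_add_one, superSign_zero_right,
    superSign_one_one, if_neg h.qq.symm]
  by_cases hz : z = q
  · by_cases hw : w = q
    · subst hz hw
      simp [h.hq]
      linear_combination (-(8 * y (idxRev w) (idxRev w))) * h1
    · simp [hz, hw]
  · by_cases hw : w = q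
    · simp [hz, hw]
    · simp [hz, hw]

/-- e_{q'} ∧ e_{a'} carries e_a to e_{q'}. At (q', q') the contributions of the two slots agree by
antisymmetry and add up. -/
lemma exists_entry_of_column (hY : DegZeroStable p Y) (h : OddFrame p q) {y : Tens2 m n}
    (hy : y ∈ Y) {a : OspIdx m n} (ha : a ≠ p) (ha' : a ≠ idxRev p) (hya : y a (idxRev q) ≠ 0) :
    ∃ y' ∈ Y, y' (idxRev q) (idxRev q) ≠ 0 := by
  have hq'p : idxRev q ≠ p := h.pq'.symm
  have hq'p' : idxRev q ≠ idxRev p := fun h' => h.pq ((idxRev_eq_idxRev _ _).1 h')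
  have ha1 : idxRev a ≠ p := fun h' => ha' (by rw [← h', idxRev_idxRev])
  have ha2 : idxRev a ≠ idxRev p := fun h' => ha ((idxRev_eq_idxRev _ _).1 h').symm
  refine ⟨_, hY.wedge (idxRev q) (idxRev a) hq'p hq'p' ha1 ha2 y hy, ?_⟩
  have h1 := hY.anti y hy (idxRev q) a
  have h2 : idxRev q = idxRev a ↔ a = q := idxRev_eq_idxRev q a
  simp only [act2_wedge_apply, idxRev_idxRev, h2, if_true, idxParity_idxRev, h.hq]
  rw [idxParity_idxRev, h.hq] at h1
  by_cases haq : a = q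
  · subst haq
    rw [h.hq] at h1 ⊢
    rw [h1]
    simp [zmod_two_one_add_one]
    exact ⟨metricSign_ne_zero _, hya⟩
  · have : y a (idxRev q) * metricSign a ≠ 0 := mul_ne_zero hya (metricSign_ne_zero _)
    rw [h1]
    simp [haq, superSign_add_right]
    intro h3
    apply this
    have h4 := superSign_mul_self 1 (idxParity a)
    linear_combination h3 / 2 - (y a (idxRev q) * metricSign a / 2) * h4

/-- Otherwise all these columns at q' vanish throughout `Y`. Moving e_a to e_{q'} with e_{q'} ∧
e_{a'} turns the entry y_{ab} into a nonzero entry of row q', against antisymmetry. -/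
lemma exists_column_of_entry (hY : DegZeroStable p Y) (h : OddFrame p q) {y : Tens2 m n}
    (hy : y ∈ Y) {a b : OspIdx m n} (ha : a ≠ p) (ha' : a ≠ idxRev p) (hb : b ≠ p)
    (hb' : b ≠ idxRev p) (hyab : y a b ≠ 0) :
    ∃ y' ∈ Y, ∃ c, c ≠ p ∧ c ≠ idxRev p ∧ y' c (idxRev q) ≠ 0 := by
  by_contra! hcon
  have hq'p : idxRev q ≠ p := h.pq'.symm
  have hq'p' : idxRev q ≠ idxRev p := fun h' => h.pq ((idxRev_eq_idxRev _ _).1 h')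
  have hqp' : q ≠ idxRev p := fun h' => hq'p (by rw [h', idxRev_idxRev])
  have ha1 : idxRev a ≠ p := fun h' => ha' (by rw [← h', idxRev_idxRev])
  have ha2 : idxRev a ≠ idxRev p := fun h' => ha ((idxRev_eq_idxRev _ _).1 h').symm
  have hmem := hY.wedge (idxRev q) (idxRev a) hq'p hq'p' ha1 ha2 y hy
  have h1 := hcon _ hmem b hb hb'
  rw [hY.anti _ hmem, neg_eq_zero, mul_eq_zero, or_iff_right (superSign_ne_zero _ _)] at h1
  have h2 : idxRev q = idxRev a ↔ a = q := idxRev_eq_idxRev q a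
  have h3 : y (idxRev q) a = 0 := by rw [hY.anti y hy, hcon y hy a ha ha', mul_zero, neg_zero]
  have h4 : y (idxRev q) q = 0 := by
    rw [hY.anti y hy, hcon y hy q h.pq.symm hqp', mul_zero, neg_zero]
  simp only [act2_wedge_apply, idxRev_idxRev, h2, if_true, idxParity_idxRev, h.hq, h3, h4] at h1
  have h5 := mul_ne_zero (metricSign_ne_zero a) hyab
  by_cases haq : a = q
  · subst haq
    simp [h.hq] at h1
    exact h5 (by simpa using h1)
  · simp [haq] at h1
    exact h5 (by simpa using h1)

/-- A nonzero stable space of antisymmetric tensors contains one of six elements. -/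
lemma exists_wedge2_mem (hY : DegZeroStable p Y) (h : OddFrame p q) (hne : Y ≠ ⊥) :
    ∃ i : Fin 6, (![wedge2 q q, wedge2 p q, wedge2 q (idxRev p), wedge2 p p,
      wedge2 p (idxRev p), wedge2 (idxRev p) (idxRev p)] : Fin 6 → Tens2 m n) i ∈ Y := by
  by_contra! hcon
  obtain ⟨y, hy, hy0⟩ := (Submodule.ne_bot_iff Y).1 hne
  -- The hypotheses are symmetric under p ↔ p', so degrees -1 and -2 follow from degrees 1 and 2.
  have hY' := hY.rev h.pp
  have h' := h.rev_left
  have e1 : y p p = 0 := by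
    by_contra h0; exact hcon 3 (wedge2_self_of_entry hY h hy h0)
  have e2 : y (idxRev p) (idxRev p) = 0 := by
    by_contra h0; exact hcon 5 (wedge2_self_of_entry hY' h' hy h0)
  have e3 : ∀ c, c ≠ p → c ≠ idxRev p → y p c = 0 := by
    intro c hc hc'
    by_contra h0; exact hcon 1 (wedge2_of_degree_one hY h hy hc hc' h0)
  have e4 : ∀ c, c ≠ p → c ≠ idxRev p → y (idxRev p) c = 0 := by
    intro c hc hc'
    by_contra h0
    refine hcon 2 ?_
    have := wedge2_of_degree_one hY' h' hy hc' (by rwa [idxRev_idxRev]) h0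
    rwa [wedge2_comm_of_odd h'.hp h.hq] at this
  have e5 : ∀ a b, a ≠ p → a ≠ idxRev p → b ≠ p → b ≠ idxRev p → y a b = 0 := by
    intro a b ha ha' hb hb'
    by_contra h0
    obtain ⟨y₁, hy₁, c, hc, hc', h1⟩ := exists_column_of_entry hY h hy ha ha' hb hb' h0
    obtain ⟨y₂, hy₂, h2⟩ := exists_entry_of_column hY h hy₁ hc hc' h1
    exact hcon 0 (wedge2_self_of_degree_zero hY h hy₂ h2)
  have e6 : ∀ c, c ≠ p → c ≠ idxRev p → y c p = 0 := fun c hc hc' => by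
    rw [hY.anti y hy, e3 c hc hc', mul_zero, neg_zero]
  have e7 : ∀ c, c ≠ p → c ≠ idxRev p → y c (idxRev p) = 0 := fun c hc hc' => by
    rw [hY.anti y hy, e4 c hc hc', mul_zero, neg_zero]
  -- With five of the six elements excluded, only the line through e_p ∧ e_{p'} in degree zero is
  -- left.
  have key : y = y p (idxRev p) • wedge2 p (idxRev p) := by
    have hpp := h.pp
    have e8 := hY.anti y hy (idxRev p) p
    rw [idxParity_idxRev, h.hp] at e8
    funext z w
    rw [Pi.smul_apply, Pi.smul_apply, smul_eq_mul, wedge2_apply]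
    by_cases hz : z = p
    · subst hz
      by_cases hw : w = z
      · subst hw; simp [hpp, e1]
      · by_cases hw' : w = idxRev z
        · subst hw'; simp [hpp]
        · simp [e3 w hw hw', hw, hw']
    · by_cases hz' : z = idxRev p
      · subst hz'
        by_cases hw : w = p
        · subst hw; simp [hpp, e8, idxParity_idxRev, h.hp]
        · by_cases hw' : w = idxRev p
          · subst hw'; simp [hpp.symm, e2]
          · simp [e4 w hw hw', hw, hpp.symm]
      · by_cases hw : w = p
        · subst hw; simp [hz, hz', e6 z hz hz']
        · by_cases hw' : w = idxRev p
          · subst hw'; simp [hz, e7 z hz hz', hpp.symm]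
          · simp [e5 z w hz hz' hw hw', hw, hz]
  have hc : y p (idxRev p) ≠ 0 := fun h0 => hy0 (by rw [key, h0, zero_smul])
  refine hcon 4 ?_
  have := Y.smul_mem (y p (idxRev p))⁻¹ hy
  rw [key] at this
  rw [smul_smul] at this
  simpa [wedge2_apply, hc, h.pp] using this

end

end

/-! ### The standard vectors, and tensors determined by a slice -/

noncomputable section

variable {m n : ℕ} {N : Type*} [AddCommGroup N] [Module ℂ N]

/-! ## Basis tensors -/

/-- The element `e_a ⊗ e_b ⊗ e_c ⊗ e_d`. -/
def basis4 (a b c d : OspIdx m n) : Tens4 m n := Pi.single a (Pi.single b (basis2 c d))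

lemma basis4_apply (a b c d x y z w : OspIdx m n) :
    basis4 a b c d x y z w = if x = a ∧ y = b ∧ z = c ∧ w = d then 1 else 0 := by
  by_cases h : x = a
  · by_cases h' : y = b
    · subst h h'; simp [basis4, basis2_apply]
    · subst h; simp [basis4, h']
  · simp [basis4, h]

lemma vecAct_single (ρ : osp m n →ₗ[ℂ] Module.End ℂ N) (X : osp m n) (a : OspIdx m n) (x : N) :
    vecAct ρ X (Pi.single a x) = ∑ e, X.1 e a • (Pi.single e x : OspIdx m n → N) +
      Pi.single a (ρ (parityTwist (idxParity a) X) x) := by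
  funext b
  rw [vecAct_apply, Pi.add_apply, Finset.sum_apply]
  congr 1
  · rw [Finset.sum_eq_single a, Finset.sum_eq_single b]
    · simp
    · intro e _ he
      rw [Pi.smul_apply, Pi.single_eq_of_ne he.symm, smul_zero]
    · simp
    · intro e _ he
      rw [Pi.single_eq_of_ne he, smul_zero]
    · simp
  · by_cases h : b = a
    · subst h; simp
    · simp [h]

lemma single_sum {ι : Type*} (S : Finset ι) (a : OspIdx m n) (f : ι → N) :
    (Pi.single a (∑ e ∈ S, f e) : OspIdx m n → N) = ∑ e ∈ S, Pi.single a (f e) :=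
  map_sum (LinearMap.single ℂ (fun _ : OspIdx m n => N) a) f S

lemma act2_basis2 (X : osp m n) (a b : OspIdx m n) : act2 m n X (basis2 a b) =
    ∑ e, X.1 e a • basis2 e b +
    ∑ e, (superSign (idxParity a) (idxParity e + idxParity b) * X.1 e b) • basis2 a e := by
  rw [act2, basis2, vecAct_single, vecAct_single]
  simp only [LinearMap.zero_apply, Pi.single_zero, add_zero, single_sum, Pi.single_smul,
    parityTwist_apply]
  rfl

lemma act4_basis4 (X : osp m n) (a b c d : OspIdx m n) : act4 m n X (basis4 a b c d) =
    ∑ e, X.1 e a • basis4 e b c d +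
    ∑ e, (superSign (idxParity a) (idxParity e + idxParity b) * X.1 e b) • basis4 a e c d +
    ∑ e, (superSign (idxParity a + idxParity b) (idxParity e + idxParity c) * X.1 e c) •
      basis4 a b e d +
    ∑ e, (superSign (idxParity a + idxParity b + idxParity c) (idxParity e + idxParity d) *
      X.1 e d) • basis4 a b c e := by
  rw [act4, basis4, vecAct_single, vecAct_single, act2_basis2]
  simp only [Pi.single_add, single_sum, Pi.single_smul, parityTwist_apply, superSign_add_left]
  rw [add_assoc, add_assoc]
  refine congrArg₂ _ rfl (congrArg₂ _ rfl (congrArg₂ _ ?_ ?_)) <;>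
    refine Finset.sum_congr rfl fun e _ => ?_
  all_goals
    refine congrArg₂ _ ?_ rfl
    ring

lemma braid12_basis4 (a b c d : OspIdx m n) : braid12 m n (basis4 a b c d) =
    superSign (idxParity a) (idxParity b) • basis4 b a c d := by
  refine tens4_ext fun x y z w => ?_
  rw [braid12_apply]
  simp only [Pi.smul_apply, smul_eq_mul, basis4_apply]
  by_cases h : y = a ∧ x = b ∧ z = c ∧ w = d
  · rw [if_pos h, if_pos (by tauto), h.1, h.2.1, superSign_comm]
  · rw [if_neg h, if_neg (by tauto), mul_zero, mul_zero]

lemma braid23_basis4 (a b c d : OspIdx m n) : braid23 m n (basis4 a b c d) =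
    superSign (idxParity b) (idxParity c) • basis4 a c b d := by
  refine tens4_ext fun x y z w => ?_
  rw [braid23_apply]
  simp only [Pi.smul_apply, smul_eq_mul, basis4_apply]
  by_cases h : x = a ∧ z = b ∧ y = c ∧ w = d
  · rw [if_pos h, if_pos (by tauto), h.2.1, h.2.2.1, superSign_comm]
  · rw [if_neg h, if_neg (by tauto), mul_zero, mul_zero]

lemma braid34_basis4 (a b c d : OspIdx m n) : braid34 m n (basis4 a b c d) =
    superSign (idxParity c) (idxParity d) • basis4 a b d c := by
  refine tens4_ext fun x y z w => ?_
  rw [braid34_apply]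
  simp only [Pi.smul_apply, smul_eq_mul, basis4_apply]
  by_cases h : x = a ∧ y = b ∧ w = c ∧ z = d
  · rw [if_pos h, if_pos (by tauto), h.2.2.1, h.2.2.2, superSign_comm]
  · rw [if_neg h, if_neg (by tauto), mul_zero, mul_zero]

lemma swap_basis4 (a b c d : OspIdx m n) : swap m n (basis4 a b c d) =
    superSign (idxParity a + idxParity b) (idxParity c + idxParity d) • basis4 c d a b := by
  refine tens4_ext fun x y z w => ?_
  rw [swap_apply]
  simp only [Pi.smul_apply, smul_eq_mul, basis4_apply]
  by_cases h : z = a ∧ w = b ∧ x = c ∧ y = d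
  · rw [if_pos h, if_pos (by tauto), h.1, h.2.1, h.2.2.1, h.2.2.2, superSign_comm]
  · rw [if_neg h, if_neg (by tauto), mul_zero, mul_zero]

lemma flip2_basis2 (a b : OspIdx m n) : flip2 m n (basis2 a b) =
    superSign (idxParity a) (idxParity b) • basis2 b a := by
  funext x y
  rw [braid_apply]
  simp only [Pi.smul_apply, smul_eq_mul, basis2_apply]
  by_cases h : y = a ∧ x = b
  · rw [if_pos h, if_pos h.symm, h.1, h.2, superSign_comm]
  · rw [if_neg h, if_neg (by tauto), mul_zero, mul_zero]

/-! ## Vanishing of the projections -/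

lemma anti_eq_zero_of_braid12 {w : Tens4 m n} (h : braid12 m n w = w) : anti m n w = 0 := by
  have := anti_braid12 w
  rwa [h, self_eq_neg] at this

lemma anti_eq_zero_of_braid34 {w : Tens4 m n} (h : braid34 m n w = w) : anti m n w = 0 := by
  have := anti_braid34 w
  rwa [h, self_eq_neg] at this

lemma full_eq_zero_of_anti {w : Tens4 m n} (h : anti m n w = 0) : full m n w = 0 := by
  have := full_anti w
  rw [h, map_zero] at this
  exact (smul_eq_zero.1 this.symm).resolve_left (by norm_num)

lemma weylVec_eq_zero_of_anti {w : Tens4 m n} (h : anti m n w = 0) : weylVec w = 0 := by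
  rw [weylVec, map_add, anti_swap, h, map_zero, full_eq_zero_of_anti h]
  simp

lemma altVec_eq_zero_of_anti {w : Tens4 m n} (h : anti m n w = 0) : altVec w = 0 := by
  rw [altVec, map_sub, anti_swap, h, map_zero, sub_zero]

lemma altVec_eq_zero_of_swap {w : Tens4 m n} (h : swap m n w = w) : altVec w = 0 := by
  rw [altVec, h, sub_self, map_zero]

/-- The first Bianchi identity: a tensor antisymmetric in its first three factors has no Weyl part.
Here `full w` equals three times `anti (w + swap w)`. -/
lemma weylVec_eq_zero_of_braid {w : Tens4 m n} (h12 : braid12 m n w = -w)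
    (h23 : braid23 m n w = -w) : weylVec w = 0 := by
  have h1 : anti m n w = (2 : ℂ) • (w - braid34 m n w) := by
    have hc : braid12 m n (braid34 m n w) = braid34 m n (braid12 m n w) :=
      (LinearMap.congr_fun coxeterRelations_braid.ca w).symm
    simp only [anti, pairAnti, Module.End.mul_apply, LinearMap.sub_apply, Module.End.one_apply,
      map_sub, hc, h12, map_neg]
    module
  have h2 : swap m n w = braid23 m n (braid34 m n w) := by
    have hc : braid12 m n (braid34 m n w) = braid34 m n (braid12 m n w) :=
      (LinearMap.congr_fun coxeterRelations_braid.ca w).symm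
    simp only [swap, pairSwap, Module.End.mul_apply, h23, map_neg, hc, h12, neg_neg]
  have h3 : anti m n (braid23 m n (anti m n w)) =
      -(2 : ℂ) • (anti m n w + anti m n (swap m n w)) := by
    rw [h1, map_smul, map_smul, map_sub, map_sub, h23, ← h2, map_neg, ← h1]
    module
  rw [weylVec, full_apply, h3, map_add]
  module

lemma weylVec_add (w w' : Tens4 m n) : weylVec (w + w') = weylVec w + weylVec w' := by
  simp only [weylVec, map_add, smul_add]; abel

lemma weylVec_smul (z : ℂ) (w : Tens4 m n) : weylVec (z • w) = z • weylVec w := by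
  simp only [weylVec, map_add, map_smul, smul_add, smul_sub, smul_comm z]

lemma altVec_add (w w' : Tens4 m n) : altVec (w + w') = altVec w + altVec w' := by
  simp only [altVec, map_add, map_sub]; abel

lemma altVec_smul (z : ℂ) (w : Tens4 m n) : altVec (z • w) = z • altVec w := by
  simp only [altVec, map_sub, map_smul, smul_sub]

lemma altVec_sum_smul {ι : Type*} (S : Finset ι) (c : ι → ℂ) (v : ι → Tens4 m n) :
    altVec (∑ x ∈ S, c x • v x) = ∑ x ∈ S, c x • altVec (v x) := by
  have h : ∀ w : Tens4 m n, altVec w = (anti m n - anti m n ∘ₗ swap m n) w := fun w =>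
    map_sub (anti m n) _ _
  simp only [h, map_sum, map_smul]

lemma act4_weylVec (X : osp m n) (w : Tens4 m n) :
    act4 m n X (weylVec w) = weylVec (act4 m n X w) := by
  simp only [weylVec, map_sub, map_add, map_smul, intertwines_anti X _, intertwines_swap X _,
    intertwines_full X _]

lemma act4_altVec (X : osp m n) (w : Tens4 m n) :
    act4 m n X (altVec w) = altVec (act4 m n X w) := by
  simp only [altVec, map_sub, intertwines_anti X _, intertwines_swap X _]

lemma act4_ricciVec (X : osp m n) (x : Tens2 m n) :
    act4 m n X (ricciVec x) = ricciVec (act2 m n X x) := by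
  rw [ricciVec, ricciVec, intertwines_insert23 X, intertwines_anti X]

lemma ricciVec_zero : ricciVec (0 : Tens2 m n) = 0 := by simp [ricciVec]

lemma act2_flip2 (X : osp m n) (x : Tens2 m n) :
    act2 m n X (flip2 m n x) = flip2 m n (act2 m n X x) :=
  (intertwines_braid _ X x).symm

/-! ## The vectors for the standard root system -/

/-- The six vectors for the standard root system. -/
def stdVec (p q : OspIdx m n) : Fin 6 → Tens4 m n :=
  sixVec (basis4 p p q q) (basis4 p p p q) (basis4 p p p p) (basis2 p q) (basis2 p p)

lemma sum_smul_eq_single {v : OspIdx m n → N} {c : OspIdx m n → ℂ} (p : OspIdx m n)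
    (h : ∀ x, x ≠ p → c x = 0) : ∑ x, c x • v x = c p • v p :=
  Finset.sum_eq_single p (fun x _ hx => by rw [h x hx, zero_smul]) (by simp)

lemma sum_smul_eq_zero {v : OspIdx m n → N} {c : OspIdx m n → ℂ}
    (h : ∀ x, c x = 0) : ∑ x, c x • v x = 0 :=
  Finset.sum_eq_zero fun x _ => by rw [h x, zero_smul]

section

variable {p q : OspIdx m n}

lemma weylVec_pppq (hp : idxParity p = 1) (q : OspIdx m n) :
    weylVec (basis4 p p p q) = 0 := by
  apply weylVec_eq_zero_of_braid
  · rw [braid12_basis4, hp]; simp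
  · rw [braid23_basis4, hp]; simp

/-- X kills e_p and sends e_q to a multiple of e_p, so it can only replace a q by a p. The replaced
tensors vanish: three e_p's have no Weyl part, pppp is fixed by the flip, and e_p ⊗ e_p has no
braiding-symmetric part as p is odd. The hypotheses cover both the positive root vectors and the e_p
∧ e_c with c ≠ p'. -/
lemma act4_stdVec_eq_zero (hp : idxParity p = 1) (hq : idxParity q = 1) {X : osp m n}
    (hXp : ∀ x, X.1 x p = 0) (hXq : ∀ x, x ≠ p → X.1 x q = 0) (i : Fin 6) :
    act4 m n X (stdVec p q i) = 0 := by
  have hpp : act2 m n X (basis2 p p) = 0 := by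
    rw [act2_basis2, sum_smul_eq_zero fun x => hXp x,
      sum_smul_eq_zero fun x => by rw [hXp x, mul_zero], add_zero]
  fin_cases i
  · refine (act4_weylVec X _).trans ?_
    rw [act4_basis4, sum_smul_eq_zero fun x => hXp x,
      sum_smul_eq_zero fun x => by rw [hXp x, mul_zero],
      sum_smul_eq_single p fun x hx => by rw [hXq x hx, mul_zero],
      sum_smul_eq_single p fun x hx => by rw [hXq x hx, mul_zero], zero_add, zero_add,
      weylVec_add, weylVec_smul, weylVec_smul, weylVec_pppq hp]
    have : weylVec (basis4 p p q p) = 0 := by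
      have h1 : braid34 m n (basis4 p p p q) = -basis4 p p q p := by
        rw [braid34_basis4, hp, hq]; simp
      have h2 := weylVec_pppq hp q
      rw [weylVec, map_add, anti_swap] at h2
      have h3 : weylVec (braid34 m n (basis4 p p p q)) = -weylVec (basis4 p p p q) := by
        rw [weylVec, weylVec, map_add, anti_swap, anti_braid34, full_braid34, map_add, anti_swap,
          map_neg]
        module
      rw [h1, weylVec_pppq hp q, neg_zero] at h3
      have h4 := weylVec_smul (-1) (basis4 p p q p)
      rw [neg_one_smul, neg_one_smul, h3] at h4
      exact neg_eq_zero.1 h4.symm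
    rw [this]; simp
  · refine (act4_altVec X _).trans ?_
    rw [act4_basis4, sum_smul_eq_zero fun x => hXp x,
      sum_smul_eq_zero fun x => by rw [hXp x, mul_zero],
      sum_smul_eq_zero fun x => by rw [hXp x, mul_zero],
      sum_smul_eq_single p fun x hx => by rw [hXq x hx, mul_zero], zero_add, zero_add, zero_add,
      altVec_smul, altVec_eq_zero_of_swap, smul_zero]
    rw [swap_basis4, hp]
    simp [zmod_two_one_add_one]
  · refine (act4_ricciVec X _).trans ?_
    rw [map_add, act2_flip2, act2_basis2, sum_smul_eq_zero fun x => hXp x,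
      sum_smul_eq_single p fun x hx => by rw [hXq x hx, mul_zero], zero_add, map_smul,
      flip2_basis2, ← smul_add, hp, superSign_one_one, neg_one_smul, add_neg_cancel, smul_zero,
      ricciVec_zero]
  · refine (intertwines_full X _).symm.trans ?_
    rw [act4_basis4, sum_smul_eq_zero fun x => hXp x,
      sum_smul_eq_zero fun x => by rw [hXp x, mul_zero],
      sum_smul_eq_zero fun x => by rw [hXp x, mul_zero],
      sum_smul_eq_zero fun x => by rw [hXp x, mul_zero]]
    simp
  · refine (act4_ricciVec X _).trans ?_
    rw [map_sub, act2_flip2, hpp, map_zero, sub_zero, ricciVec_zero]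
  · refine (act4_ricciVec X _).trans ?_
    rw [act2_metric2, ricciVec_zero]

/-- A tensor annihilated by the root vectors of positive degree is determined by its slice at
`e_p ⊗ e_p`. -/
lemma eq_zero_of_slice (h : OddFrame p q) {t : Tens4 m n} (h34 : braid34 m n t = -t)
    (hkill : ∀ c, c ≠ idxRev p → act4 m n (wedge p c) t = 0) (hs : ∀ a b, t a b p p = 0) :
    t = 0 := by
  have hpp := h.pp
  have hanti : ∀ a b c d, t a b c d = -(superSign (idxParity c) (idxParity d) * t a b d c) := by
    intro a b c d
    have := congrFun (congrFun (congrFun (congrFun h34 a) b) c) d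
    rw [braid34_apply] at this
    exact (neg_eq_iff_eq_neg.2 this).symm
  -- When the slice at (z, w) vanishes, the terms with the root vector on the first two factors drop
  -- out, leaving a relation among slices only. Starting from (p, p), these relations reach all
  -- slices.
  have hrule : ∀ c, c ≠ idxRev p → ∀ z w, (∀ a b, t a b z w = 0) → ∀ a b,
      act2 m n (wedge p c) (t a b) z w = 0 := by
    intro c hc z w hzw a b
    have h1 := congrFun (congrFun (congrFun (congrFun (hkill c hc) a) b) z) w
    rw [act4_wedge_apply] at h1
    simp only [hzw, mul_zero, sub_zero, zero_add] at h1
    rw [← mul_assoc] at h1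
    exact (mul_eq_zero.1 h1).resolve_left
      (mul_ne_zero (superSign_ne_zero _ _) (superSign_ne_zero _ _))
  have hk := metricSign_ne_zero (idxRev p)
  have e1 : ∀ a b, t a b (idxRev p) p = 0 := by
    intro a b
    -- e_p ∧ e_p carries e_{p'} to a multiple of e_p. Its component at (p, p) combines the slices at
    -- (p', p) and (p, p'), which agree by oddness and add up.
    have h1 := hrule p hpp p p hs a b
    have h2 := hanti a b p (idxRev p)
    rw [idxParity_idxRev, h.hp] at h2
    simp only [act2_wedge_apply, if_true, h.hp, zmod_two_one_add_one] at h1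
    rw [h2] at h1
    simp at h1
    exact h1.resolve_left hk
  have e1' : ∀ a b, t a b p (idxRev p) = 0 := fun a b => by
    rw [hanti, e1, mul_zero, neg_zero]
  have e2 : ∀ a b, t a b (idxRev p) (idxRev p) = 0 := by
    intro a b
    have h1 := hrule p hpp (idxRev p) p e1 a b
    simp [act2_wedge_apply, h.hp, hpp.symm, zmod_two_one_add_one] at h1
    exact h1.resolve_left hk
  have e3 : ∀ c, c ≠ p → c ≠ idxRev p → ∀ a b, t a b c p = 0 := by
    intro c hc hc' a b
    have hcc : idxRev c ≠ idxRev p := fun h' => hc ((idxRev_eq_idxRev _ _).1 h').symm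
    have hcp : p ≠ idxRev c := fun h' => hc' (by rw [h', idxRev_idxRev])
    have h1 := hrule (idxRev c) hcc p p hs a b
    have h2 := hanti a b p c
    rw [h.hp] at h2
    simp only [act2_wedge_apply, if_true, if_neg hcp, h.hp, idxParity_idxRev, idxRev_idxRev] at h1
    rw [h2, superSign_add_right] at h1
    simp at h1
    have h4 := superSign_mul_self 1 (idxParity c)
    have : 2 * (metricSign c * t a b c p) = 0 := by
      linear_combination h1 - metricSign c * t a b c p * h4
    simpa [metricSign_ne_zero c] using this
  have e3' : ∀ c, c ≠ p → c ≠ idxRev p → ∀ a b, t a b p c = 0 := fun c hc hc' a b => by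
    rw [hanti, e3 c hc hc', mul_zero, neg_zero]
  have e4 : ∀ c, c ≠ p → c ≠ idxRev p → ∀ a b, t a b c (idxRev p) = 0 := by
    intro c hc hc' a b
    have h1 := hrule p hpp c p (e3 c hc hc') a b
    simp [act2_wedge_apply, h.hp, hc, zmod_two_one_add_one] at h1
    exact h1.resolve_left hk
  have e4' : ∀ c, c ≠ p → c ≠ idxRev p → ∀ a b, t a b (idxRev p) c = 0 := fun c hc hc' a b => by
    rw [hanti, e4 c hc hc', mul_zero, neg_zero]
  have e5 : ∀ c d, c ≠ p → c ≠ idxRev p → d ≠ p → d ≠ idxRev p → ∀ a b, t a b c d = 0 := by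
    intro c d hc hc' hd hd' a b
    have hdd : idxRev d ≠ idxRev p := fun h' => hd ((idxRev_eq_idxRev _ _).1 h').symm
    have hdp : p ≠ idxRev d := fun h' => hd' (by rw [h', idxRev_idxRev])
    -- e_p ∧ e_{d'} carries e_d to e_p, so the component at (c, p) returns the slice at (c, d), up
    -- to one at (p', p) already known to vanish.
    have h1 := hrule (idxRev d) hdd c p (e3 c hc hc') a b
    rw [act2_wedge_apply, e1, if_neg hc, if_neg hdp, idxRev_idxRev] at h1
    simpa [metricSign_ne_zero, superSign_ne_zero] using h1
  refine tens4_ext fun a b c d => ?_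
  change _ = (0 : ℂ)
  by_cases hc : c = p
  · subst hc
    by_cases hd : d = c
    · rw [hd, hs]
    · by_cases hd' : d = idxRev c
      · rw [hd', e1']
      · rw [e3' d hd hd']
  · by_cases hc' : c = idxRev p
    · subst hc'
      by_cases hd : d = p
      · rw [hd, e1]
      · by_cases hd' : d = idxRev p
        · rw [hd', e2]
        · rw [e4' d hd hd']
    · by_cases hd : d = p
      · rw [hd, e3 c hc hc']
      · by_cases hd' : d = idxRev p
        · rw [hd', e4 c hc hc']
        · rw [e5 c d hc hc' hd hd']

end

end

/-! ### The six vectors: slices, presence in every invariant subspace, norms -/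

noncomputable section

variable {m n : ℕ}

lemma anti_basis4_of_odd {a b c d : OspIdx m n} (ha : idxParity a = 1) (hb : idxParity b = 1)
    (hc : idxParity c = 1) (hd : idxParity d = 1) : anti m n (basis4 a b c d) =
    basis4 a b c d + basis4 b a c d + basis4 a b d c + basis4 b a d c := by
  simp only [anti, pairAnti, Module.End.mul_apply, LinearMap.sub_apply, Module.End.one_apply,
    map_sub, map_smul, braid12_basis4, braid34_basis4, ha, hb, hc, hd, superSign_one_one]
  module

lemma swap_basis4_of_odd {a b c d : OspIdx m n} (ha : idxParity a = 1) (hb : idxParity b = 1)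
    (hc : idxParity c = 1) (hd : idxParity d = 1) :
    swap m n (basis4 a b c d) = basis4 c d a b := by
  simp [swap_basis4, ha, hb, hc, hd, zmod_two_one_add_one]

lemma braid23_basis4_of_odd {a b c d : OspIdx m n} (hb : idxParity b = 1)
    (hc : idxParity c = 1) : braid23 m n (basis4 a b c d) = -basis4 a c b d := by
  simp [braid23_basis4, hb, hc]

section

variable {p q : OspIdx m n}

lemma weylVec_ppqq (hp : idxParity p = 1) (hq : idxParity q = 1) : weylVec (basis4 p p q q) =
    (8 / 3 : ℂ) • (basis4 p p q q + basis4 q q p p) - (4 / 3 : ℂ) •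
      (basis4 p q p q + basis4 q p p q + basis4 p q q p + basis4 q p q p) := by
  simp only [weylVec, full_apply, map_add, swap_basis4_of_odd hp hp hq hq,
    anti_basis4_of_odd hp hp hq hq, anti_basis4_of_odd hq hq hp hp, braid23_basis4_of_odd hp hq,
    map_neg, anti_basis4_of_odd hp hq hp hq]
  module

lemma altVec_pppq (hp : idxParity p = 1) (hq : idxParity q = 1) : altVec (basis4 p p p q) =
    (2 : ℂ) • (basis4 p p p q + basis4 p p q p - basis4 p q p p - basis4 q p p p) := by
  simp only [altVec, map_sub, swap_basis4_of_odd hp hp hp hq,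
    anti_basis4_of_odd hp hp hp hq, anti_basis4_of_odd hp hq hp hp]
  module

lemma full_pppp (hp : idxParity p = 1) :
    full m n (basis4 p p p p) = (24 : ℂ) • basis4 p p p p := by
  simp only [full_apply, map_add, swap_basis4_of_odd hp hp hp hp,
    anti_basis4_of_odd hp hp hp hp, braid23_basis4_of_odd hp hp, map_neg]
  module

/-- The slices of the six vectors. -/
def stdSlice (p q : OspIdx m n) : Fin 6 → Tens2 m n :=
  ![wedge2 q q, wedge2 p q, wedge2 q (idxRev p), wedge2 p p,
      wedge2 p (idxRev p), wedge2 (idxRev p) (idxRev p)]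

lemma ricciVec_slice (hp : idxParity p = 1) (x : Tens2 m n) (a b : OspIdx m n) :
    ricciVec x a b p p = 2 * metricSign (idxRev p) *
      ((if b = idxRev p then x a p else 0) -
        superSign (idxParity a) (idxParity b) * if a = idxRev p then x b p else 0) := by
  have h : ∀ e : OspIdx m n, p = idxRev e ↔ e = idxRev p := fun e => by
    rw [eq_comm, idxRev_eq_iff]
  rw [ricciVec, anti_apply]
  simp only [insert23_apply, hp, h, superSign_one_one]
  by_cases ha : a = idxRev p <;> by_cases hb : b = idxRev p <;> simp [ha, hb] <;> ring

/-- Pairs the six vectors with the six elements of `exists_wedge2_mem`; this is where the two lists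
meet. -/
lemma stdVec_slice (h : OddFrame p q) (i : Fin 6) : ∃ c : ℂ, c ≠ 0 ∧
    ∀ a b, stdVec p q i a b p p = c * stdSlice p q i a b := by
  have hpq := h.pq
  have hp' : idxParity (idxRev p) = 1 := by rw [idxParity_idxRev, h.hp]
  have hk := metricSign_ne_zero (idxRev p)
  fin_cases i
  · refine ⟨4 / 3, by norm_num, fun a b => ?_⟩
    change weylVec (basis4 p p q q) a b p p = 4 / 3 * wedge2 q q a b
    rw [weylVec_ppqq h.hp h.hq, wedge2_apply_of_odd h.hq h.hq]
    simp only [Pi.sub_apply, Pi.smul_apply, Pi.add_apply, basis4_apply, smul_eq_mul]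
    by_cases h1 : a = q <;> by_cases h2 : b = q <;> simp [h1, h2, hpq]
    norm_num
  · refine ⟨-2, by norm_num, fun a b => ?_⟩
    change altVec (basis4 p p p q) a b p p = -2 * wedge2 p q a b
    rw [altVec_pppq h.hp h.hq, wedge2_apply_of_odd h.hp h.hq]
    simp only [Pi.sub_apply, Pi.smul_apply, Pi.add_apply, basis4_apply, smul_eq_mul]
    by_cases h1 : a = p <;> by_cases h2 : b = p <;> simp [h1, h2, hpq] <;> split_ifs <;> simp
  · refine ⟨-2 * metricSign (idxRev p), by simpa using hk, fun a b => ?_⟩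
    change ricciVec (basis2 p q + flip2 m n (basis2 p q)) a b p p =
      -2 * metricSign (idxRev p) * wedge2 q (idxRev p) a b
    rw [ricciVec_slice h.hp, wedge2_apply, flip2_basis2, h.hp, h.hq]
    simp only [Pi.smul_apply, Pi.add_apply, basis2_apply, smul_eq_mul]
    have hqp' : idxRev p ≠ q := fun h' => h.pq' (by rw [← h', idxRev_idxRev])
    by_cases h1 : a = idxRev p <;> by_cases h2 : b = idxRev p <;> by_cases h3 : a = q <;>
      by_cases h4 : b = q <;> simp [*, hqp'.symm]
  · refine ⟨12, by norm_num, fun a b => ?_⟩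
    change full m n (basis4 p p p p) a b p p = 12 * wedge2 p p a b
    rw [full_pppp h.hp, wedge2_apply_of_odd h.hp h.hp]
    simp only [Pi.smul_apply, basis4_apply, smul_eq_mul]
    by_cases h1 : a = p <;> by_cases h2 : b = p <;> simp [h1, h2]
    norm_num
  · refine ⟨4 * metricSign (idxRev p), by simpa using hk, fun a b => ?_⟩
    change ricciVec (basis2 p p - flip2 m n (basis2 p p)) a b p p =
      4 * metricSign (idxRev p) * wedge2 p (idxRev p) a b
    rw [ricciVec_slice h.hp, wedge2_apply, flip2_basis2, h.hp]
    simp only [Pi.sub_apply, Pi.smul_apply, basis2_apply, smul_eq_mul]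
    have hpp := h.pp
    by_cases h1 : a = idxRev p <;> by_cases h2 : b = idxRev p <;> by_cases h3 : a = p <;>
      by_cases h4 : b = p <;> simp [h1, h2, h3, h4, hpp, hpp.symm] <;> ring
  · refine ⟨2, by norm_num, fun a b => ?_⟩
    change ricciVec (metric2 m n) a b p p = 2 * wedge2 (idxRev p) (idxRev p) a b
    have hr : ∀ e : OspIdx m n, p = idxRev e ↔ e = idxRev p := fun e => by
      rw [eq_comm, idxRev_eq_iff]
    have hm := metricSign_mul_self (idxRev p)
    rw [ricciVec_slice h.hp, wedge2_apply]
    simp only [metric2_apply, hr a, hr b]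
    by_cases h1 : a = idxRev p <;> by_cases h2 : b = idxRev p <;> simp [h1, h2, hp']
    linear_combination 4 * hm

/-- Every nonzero stable subspace contains one of the six vectors. -/
theorem exists_stdVec_mem (h : OddFrame p q) {U : Submodule ℂ (Tens4 m n)}
    (hU : U ≤ antiSub m n) (hne : U ≠ ⊥) (hs : Stable U) : ∃ i, stdVec p q i ∈ U := by
  obtain ⟨U', hU', hne', hpos, hzero⟩ := exists_top_degree hne hs h.pp
  have hdeg : ∀ c, c ≠ idxRev p → 0 < idxDeg p p + idxDeg p c := by
    intro c hc
    by_cases hcp : c = p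
    · rw [hcp, idxDeg_self]; norm_num
    · rw [idxDeg_self, idxDeg_of_ne hcp hc]; norm_num
  let slice : Tens4 m n →ₗ[ℂ] Tens2 m n :=
    { toFun := fun t a b => t a b p p
      map_add' := fun _ _ => rfl
      map_smul' := fun _ _ => rfl }
  have hslice : ∀ t a b, slice t a b = t a b p p := fun _ _ _ => rfl
  have hinj : ∀ t ∈ antiSub m n, (∀ c, c ≠ idxRev p → act4 m n (wedge p c) t = 0) →
      slice t = 0 → t = 0 := fun t ht hk h0 =>
    eq_zero_of_slice h (mem_antiSub.1 ht).2 hk fun a b => congrFun (congrFun h0 a) b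
  have hY : DegZeroStable p (U'.map slice) := by
    refine ⟨?_, ?_, ?_⟩
    · rintro _ ⟨t, ht, rfl⟩ a b
      have h1 := congrFun (congrFun (congrFun (congrFun
        (mem_antiSub.1 (hU (hU' ht))).1 a) b) p) p
      rw [braid12_apply] at h1
      exact (neg_eq_iff_eq_neg.2 h1).symm
    · rintro a b ha ha' hb hb' _ ⟨t, ht, rfl⟩
      refine ⟨_, hzero a b (by rw [idxDeg_of_ne ha ha', idxDeg_of_ne hb hb', add_zero]) t ht, ?_⟩
      funext x y
      rw [hslice, act4_wedge_apply, act2_wedge_apply, act2_wedge_apply]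
      simp only [if_neg ha.symm, if_neg hb.symm, hslice]
      ring
    · rintro _ ⟨t, ht, rfl⟩
      have hmem := hzero p (idxRev p) (by rw [idxDeg_idxRev h.pp, add_neg_cancel]) t ht
      -- After normalization by `metricSign p`, the Cartan element e_p ∧ e_{p'} acts by the degree.
      -- The two factors e_p fixed by the slice account for 2.
      refine ⟨metricSign p • act4 m n (wedge p (idxRev p)) t - (2 : ℂ) • t,
        sub_mem (U'.smul_mem _ hmem) (U'.smul_mem _ ht), ?_⟩
      have hk := metricSign_mul_self p
      have hk' := metricSign_idxRev p
      rw [h.hp, superSign_one_one] at hk'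
      rw [map_sub, map_smul, map_smul]
      funext x y
      simp only [Pi.sub_apply, Pi.smul_apply, smul_eq_mul, hslice, act4_wedge_apply,
        act2_wedge_apply, idxRev_idxRev, idxParity_idxRev, h.hp, zmod_two_one_add_one,
        superSign_zero_right, superSign_one_one, if_true, if_neg h.pp, idxDeg, hk']
      have hpp := h.pp
      by_cases hx : x = p
      · by_cases hy : y = p
        · simp [hx, hy, hpp]
          linear_combination 4 * t p p p p * hk
        · by_cases hy' : y = idxRev p
          · simp [hx, hy', hpp, hpp.symm]
            linear_combination 2 * t p (idxRev p) p p * hk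
          · simp [hx, hy, hy', hpp]
            linear_combination 3 * t p y p p * hk
      · by_cases hx' : x = idxRev p
        · by_cases hy : y = p
          · simp [hx', hy, hpp, hpp.symm]
            linear_combination 2 * t (idxRev p) p p p * hk
          · by_cases hy' : y = idxRev p
            · simp [hx', hy', hpp.symm]
            · simp [hx', hy, hy', hpp.symm]
              linear_combination t (idxRev p) y p p * hk
        · by_cases hy : y = p
          · simp [hx, hx', hy, hpp]
            linear_combination 3 * t x p p p * hk
          · by_cases hy' : y = idxRev p
            · simp [hx, hx', hy', hpp.symm]
              linear_combination t x (idxRev p) p p * hk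
            · simp [hx, hx', hy, hy']
              linear_combination 2 * t x y p p * hk
  have hYne : U'.map slice ≠ ⊥ := by
    obtain ⟨t, ht, ht0⟩ := (Submodule.ne_bot_iff U').1 hne'
    refine (Submodule.ne_bot_iff _).2 ⟨slice t, ⟨t, ht, rfl⟩, fun h0 => ht0 ?_⟩
    exact hinj t (hU (hU' ht)) (fun c hc => hpos _ _ (hdeg c hc) t ht) h0
  obtain ⟨i, t, ht, hti⟩ := exists_wedge2_mem hY h hYne
  obtain ⟨c, hc, hci⟩ := stdVec_slice h i
  refine ⟨i, ?_⟩
  -- The difference is killed by the positive root vectors e_p ∧ e_e and has slice zero, so it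
  -- vanishes.
  have hv : stdVec p q i = c • t := by
    rw [← sub_eq_zero]
    have hqp' : q ≠ idxRev p := fun h' => h.pq' (by rw [h', idxRev_idxRev])
    refine hinj _ (sub_mem (sixVec_mem i) (Submodule.smul_mem _ _ (hU (hU' ht))))
      (fun e he => ?_) ?_
    · rw [map_sub, map_smul, hpos _ _ (hdeg e he) t ht, smul_zero, sub_zero]
      have hep : p ≠ idxRev e := fun h' => he (by rw [h', idxRev_idxRev])
      refine act4_stdVec_eq_zero h.hp h.hq (fun x => ?_) (fun x hx => ?_) i
      · simp [wedge_apply, hep, h.pp]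
      · simp [wedge_apply, hx, hqp']
    · rw [map_sub, map_smul, hti]
      funext a b
      change stdVec p q i a b p p - c * stdSlice p q i a b = 0
      rw [hci, sub_self]
  rw [hv]
  exact U.smul_mem _ (hU' ht)

/-! ## The six vectors are not isotropic -/

lemma form4_basis4 (a b c d : OspIdx m n) (t : Tens4 m n) : form4 m n (basis4 a b c d) t =
    formCoeff a * formCoeff b * formCoeff c * formCoeff d * t a b c d := by
  rw [form4_apply, Finset.sum_eq_single a, Finset.sum_eq_single b, Finset.sum_eq_single c,
    Finset.sum_eq_single d]
  · simp [basis4_apply]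
  all_goals first | (intro e _ he; simp [basis4_apply, he]) | simp

lemma form2_basis2 (a b : OspIdx m n) (t : Tens2 m n) : form2 m n (basis2 a b) t =
    formCoeff a * formCoeff b * t a b := by
  rw [form2_apply, Finset.sum_eq_single a, Finset.sum_eq_single b]
  · simp [basis2_apply]
  all_goals first | (intro e _ he; simp [basis2_apply, he]) | simp

lemma form2_metric2 : form2 m n (metric2 m n) (metric2 m n) = (m : ℂ) - 2 * n := by
  rw [form2_apply, ← sum_parity_sign]
  refine Finset.sum_congr rfl fun a _ => ?_
  rw [Finset.sum_eq_single (idxRev a)]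
  · rw [metric2_apply, if_pos rfl, metricSign_mul_self, formCoeff_idxRev, mul_one,
      formCoeff_mul_self]
  · intro b _ hb
    rw [metric2_apply, if_neg hb]; ring
  · simp

/-- Self-adjointness of the double antisymmetrizer gives the 4; adjointness of insertion and
contraction gives the rest. -/
lemma form4_ricciVec (x : Tens2 m n) : form4 m n (ricciVec x) (ricciVec x) =
    4 * (((m : ℂ) - 2 * n - 2) * form2 m n x x + trace2 m n x * form2 m n x (metric2 m n)) := by
  have : ricciVec x ∈ antiSub m n := anti_mem _
  nth_rewrite 1 [ricciVec]
  rw [form4_anti, anti_of_mem this, map_smul, form4_insert23, contract23_ricciVec, map_add,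
    map_smul, map_smul]
  rfl

lemma trace2_basis2 {a b : OspIdx m n} (h : a ≠ idxRev b) : trace2 m n (basis2 a b) = 0 := by
  rw [trace2_apply]
  refine Finset.sum_eq_zero fun e _ => ?_
  rw [basis2_apply, if_neg, mul_zero]
  rintro ⟨rfl, rfl⟩
  exact h (idxRev_idxRev _).symm

lemma trace2_flip2_basis2 {a b : OspIdx m n} (h : a ≠ idxRev b) :
    trace2 m n (flip2 m n (basis2 a b)) = 0 := by
  rw [flip2_basis2, map_smul, trace2_basis2, smul_zero]
  exact fun h' => h (by rw [h', idxRev_idxRev])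

/-- Self-adjointness turns the norms of the Weyl and alternating vectors into single entries; the
fully antisymmetric one is 24 e_p^{⊗4}. With M = m - 2n, the Ricci vectors have norms proportional
to M - 2, M - 2 and 8M(M - 1), so the excluded values of M are those where a vector becomes
isotropic. -/
lemma form4_stdVec_ne_zero (h : OddFrame p q) (h0 : (m : ℤ) - 2 * n ≠ 0)
    (h1 : (m : ℤ) - 2 * n ≠ 1) (h2 : (m : ℤ) - 2 * n ≠ 2) (i : Fin 6) :
    form4 m n (stdVec p q i) (stdVec p q i) ≠ 0 := by
  have hpq := h.pq
  have h0' : (m : ℂ) - 2 * n ≠ 0 := fun e => h0 (by exact_mod_cast e)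
  have h1' : (m : ℂ) - 2 * n ≠ 1 := fun e => h1 (by exact_mod_cast e)
  have h2' : (m : ℂ) - 2 * n - 2 ≠ 0 := fun e => h2 (by
    have := sub_eq_zero.1 e
    exact_mod_cast this)
  have hE : ∀ a : OspIdx m n, formCoeff a ≠ 0 := formCoeff_ne_zero
  fin_cases i
  · change form4 m n (weylVec (basis4 p p q q)) (weylVec (basis4 p p q q)) ≠ 0
    have hmem := weylVec_mem (basis4 p p q q)
    nth_rewrite 1 [weylVec]
    rw [map_sub, map_smul, LinearMap.sub_apply, LinearMap.smul_apply, form4_full, form4_anti,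
      full_weylVec, map_zero, smul_zero, sub_zero, anti_of_mem hmem, map_smul, map_add,
      LinearMap.add_apply, form4_swap, swap_weylVec, form4_basis4, weylVec_ppqq h.hp h.hq]
    simp [basis4_apply, hpq, hpq.symm, hE]
  · change form4 m n (altVec (basis4 p p p q)) (altVec (basis4 p p p q)) ≠ 0
    have hmem := altVec_mem (basis4 p p p q)
    nth_rewrite 1 [altVec]
    rw [form4_anti, anti_of_mem hmem, map_smul, map_sub, LinearMap.sub_apply, form4_swap,
      swap_altVec, map_neg, form4_basis4, altVec_pppq h.hp h.hq]
    simp [basis4_apply, hpq, hpq.symm, hE]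
  · change form4 m n (ricciVec _) (ricciVec _) ≠ 0
    have ht : trace2 m n (basis2 p q + flip2 m n (basis2 p q)) = 0 := by
      rw [map_add, trace2_flip2_basis2 h.pq', trace2_basis2 h.pq', add_zero]
    rw [form4_ricciVec, ht, flip2_basis2]
    simp only [map_add, map_smul, LinearMap.add_apply, LinearMap.smul_apply, form2_basis2, h.hp,
      h.hq]
    simp [basis2_apply, hpq, hpq.symm]
    refine ⟨h2', ?_⟩
    have : formCoeff p * formCoeff q + formCoeff q * formCoeff p =
      2 * (formCoeff p * formCoeff q) := by ring
    rw [this]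
    simp [hE]
  · change form4 m n (full m n (basis4 p p p p)) (full m n (basis4 p p p p)) ≠ 0
    rw [full_pppp h.hp, map_smul, map_smul, LinearMap.smul_apply, form4_basis4]
    simp [basis4_apply, hE]
  · change form4 m n (ricciVec _) (ricciVec _) ≠ 0
    have ht : trace2 m n (basis2 p p - flip2 m n (basis2 p p)) = 0 := by
      rw [map_sub, trace2_flip2_basis2 h.pp, trace2_basis2 h.pp, sub_zero]
    rw [form4_ricciVec, ht, flip2_basis2]
    simp only [map_sub, map_smul, LinearMap.sub_apply, LinearMap.smul_apply, form2_basis2, h.hp]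
    simp [basis2_apply, h2']
    have : formCoeff p * formCoeff p + formCoeff p * formCoeff p -
        (-(formCoeff p * formCoeff p) + -(formCoeff p * formCoeff p)) =
      4 * (formCoeff p * formCoeff p) := by ring
    rw [this]
    simp [hE]
  · change form4 m n (ricciVec _) (ricciVec _) ≠ 0
    rw [form4_ricciVec, trace2_metric2, form2_metric2]
    have : (4 : ℂ) * (((m : ℂ) - 2 * n - 2) * (m - 2 * n) + (m - 2 * n) * (m - 2 * n)) =
      8 * (((m : ℂ) - 2 * n) - 1) * (m - 2 * n) := by ring
    rw [this]
    exact mul_ne_zero (mul_ne_zero (by norm_num) (sub_ne_zero.2 h1')) h0'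

end

end

/-! ### Transfer between 𝔤 ⊗ 𝔤 and Λ²V ⊗ Λ²V -/

noncomputable section

variable {m n : ℕ}

/-! ## The embedding of `𝔤 ⊗ 𝔤` into `V ⊗ V ⊗ V ⊗ V` -/

/-- The embedding of `𝔤` into `V ⊗ V`. -/
def emb2 (m n : ℕ) : osp m n →ₗ[ℂ] Tens2 m n where
  toFun X a b := X.1 a (idxRev b) * metricSign (idxRev b)
  map_add' X Y := by funext a b; simp [add_mul]
  map_smul' t X := by funext a b; simp [mul_assoc]

lemma emb2_apply (X : osp m n) (a b : OspIdx m n) :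
    emb2 m n X a b = X.1 a (idxRev b) * metricSign (idxRev b) := rfl

lemma emb2_antisymm (X : osp m n) (a b : OspIdx m n) : emb2 m n X a b =
    -(superSign (idxParity a) (idxParity b) * emb2 m n X b a) := by
  rw [emb2_apply, emb2_apply, osp_entry X a b]
  linear_combination (-(metricSign (idxRev b) * X.1 a (idxRev b))) *
      superSign_mul_self (idxParity a) (idxParity b) -
    (metricSign (idxRev b) * X.1 a (idxRev b)) *
      superSign (idxParity a) (idxParity b) * superSign (idxParity a) (idxParity b) *
      metricSign_mul_self (idxRev a)

/-- The term XY of the bracket is the action on the first factor. The term YX becomes the action on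
the second factor once the osp equation moves X to the other side of the metric. -/
lemma emb2_ospAd (X Y : osp m n) : emb2 m n (ospAd m n X Y) = act2 m n X (emb2 m n Y) := by
  funext a b
  rw [act2, vecAct_vecAct_apply, emb2_apply]
  change superBracket X.1 Y.1 a (idxRev b) * metricSign (idxRev b) = _
  simp only [superBracket, Matrix.of_apply, LinearMap.zero_apply, add_zero, smul_eq_mul,
    Finset.sum_sub_distrib, sub_mul, emb2_apply, Finset.sum_mul, idxParity_idxRev]
  rw [sub_eq_add_neg]
  refine congrArg₂ _ (Finset.sum_congr rfl fun e _ => by ring) ?_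
  rw [← sum_idxRev, ← Finset.sum_neg_distrib]
  refine Finset.sum_congr rfl fun e _ => ?_
  have h1 := osp_entry X (idxRev e) b
  rw [idxRev_idxRev, idxParity_idxRev] at h1
  rw [h1, idxParity_idxRev]
  simp only [superSign_add_left, superSign_add_right]
  rw [superSign_comm (idxParity e) (idxParity a), superSign_comm (idxParity b) (idxParity a),
    superSign_comm (idxParity b) (idxParity e), ← metricSign_rev_mul e]
  ring

/-- The embedding of `𝔤 ⊗ 𝔤` into `V ⊗ V ⊗ V ⊗ V`. -/
def emb4 (m n : ℕ) : OspSq m n →ₗ[ℂ] Tens4 m n :=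
  TensorProduct.lift (LinearMap.mk₂ ℂ
    (fun X Y a b => emb2 m n X a b • emb2 m n Y)
    (fun X X' Y => by funext a b; simp [add_smul])
    (fun t X Y => by funext a b; simp [mul_smul])
    (fun X Y Y' => by funext a b; simp)
    (fun t X Y => by funext a b; simp [smul_comm t]))

lemma emb4_tmul (X Y : osp m n) (a b : OspIdx m n) :
    emb4 m n (X ⊗ₜ Y) a b = emb2 m n X a b • emb2 m n Y := rfl

lemma emb4_tmul_apply (X Y : osp m n) (a b c d : OspIdx m n) :
    emb4 m n (X ⊗ₜ Y) a b c d = emb2 m n X a b * emb2 m n Y c d := rfl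

lemma emb2_ospPart (k : ZMod 2) (X : osp m n) (a b : OspIdx m n) :
    emb2 m n (ospPart m n k X) a b =
      if idxParity a + idxParity b = k then emb2 m n X a b else 0 := by
  rw [emb2_apply, emb2_apply, ospPart_apply, idxParity_idxRev, ite_mul, zero_mul]

lemma ospSqAct_tmul (X U Y : osp m n) : ospSqAct m n X (U ⊗ₜ Y) = ospAd m n X U ⊗ₜ Y +
    ∑ i : ZMod 2, ∑ j : ZMod 2, superSign i j •
      (ospPart m n j U ⊗ₜ[ℂ] ospAd m n (ospPart m n i X) Y) := by
  simp [ospSqAct, LinearMap.sum_apply]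

lemma emb4_ospSqAct (X : osp m n) (M : OspSq m n) :
    emb4 m n (ospSqAct m n X M) = act4 m n X (emb4 m n M) := by
  induction M using TensorProduct.induction_on with
  | zero => simp
  | add M M' h h' => rw [map_add, map_add, h, h', map_add, map_add]
  | tmul U Y =>
    rw [ospSqAct_tmul]
    simp only [map_add, map_sum, map_smul]
    funext a b
    have h1 := congrFun (congrFun (emb2_ospAd X U) a) b
    rw [act2, vecAct_vecAct_apply, LinearMap.zero_apply, LinearMap.zero_apply, add_zero] at h1
    rw [act4, vecAct_vecAct_apply]
    simp only [Pi.add_apply, Finset.sum_apply, Pi.smul_apply, emb4_tmul]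
    rw [h1, add_smul]
    simp only [Finset.sum_smul, smul_smul, smul_eq_mul, map_smul]
    congr 1
    rw [parityTwist_eq_sum, map_sum, LinearMap.sum_apply, Finset.smul_sum]
    refine Finset.sum_congr rfl fun i _ => ?_
    rw [Finset.sum_eq_single (idxParity a + idxParity b)]
    · rw [emb2_ospPart, if_pos rfl, emb2_ospAd, map_smul, LinearMap.smul_apply, smul_smul,
        mul_comm]
    · intro j _ hj
      rw [emb2_ospPart, if_neg hj.symm, mul_zero, zero_smul]
    · simp

lemma emb4_mem (M : OspSq m n) : emb4 m n M ∈ antiSub m n := by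
  induction M using TensorProduct.induction_on with
  | zero => simp
  | add M M' h h' => rw [map_add]; exact add_mem h h'
  | tmul U Y =>
    refine mem_antiSub.2 ⟨tens4_ext fun a b c d => ?_, tens4_ext fun a b c d => ?_⟩
    · change braid12 m n _ a b c d = -(emb4 m n (U ⊗ₜ[ℂ] Y) a b c d)
      rw [braid12_apply, emb4_tmul_apply, emb4_tmul_apply, emb2_antisymm U a b]
      ring
    · change braid34 m n _ a b c d = -(emb4 m n (U ⊗ₜ[ℂ] Y) a b c d)
      rw [braid34_apply, emb4_tmul_apply, emb4_tmul_apply, emb2_antisymm Y c d]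
      ring

/-- The projection from `V ⊗ V ⊗ V ⊗ V` to `𝔤 ⊗ 𝔤`. -/
def proj4 (m n : ℕ) : Tens4 m n →ₗ[ℂ] OspSq m n where
  toFun t := (1 / 4 : ℂ) • ∑ a, ∑ b, ∑ c, ∑ d, t a b c d • (wedge a b ⊗ₜ[ℂ] wedge c d)
  map_add' t u := by simp [add_smul, Finset.sum_add_distrib, -Fintype.sum_sum_type]
  map_smul' z t := by
    simp only [Pi.smul_apply, smul_eq_mul, mul_smul, ← Finset.smul_sum, RingHom.id_apply]
    rw [smul_comm]

lemma proj4_apply (t : Tens4 m n) : proj4 m n t =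
    (1 / 4 : ℂ) • ∑ a, ∑ b, ∑ c, ∑ d, t a b c d • (wedge a b ⊗ₜ[ℂ] wedge c d) := rfl

lemma emb2_wedge (a b : OspIdx m n) : emb2 m n (wedge a b) = wedge2 a b := by
  funext x y
  rw [emb2_apply, wedge_apply, wedge2_apply]
  simp only [idxRev_eq_idxRev, eq_comm (a := b) (b := y), eq_comm (a := a) (b := y)]
  have h := metricSign_mul_self (idxRev y)
  by_cases h2 : x = b ∧ y = a
  · rw [if_pos h2, if_pos h2.symm, h2.1, h2.2, superSign_comm (idxParity b)]
    linear_combination ((if b = a ∧ a = b then 1 else 0) -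
      superSign (idxParity a) (idxParity b) : ℂ) * metricSign_mul_self (idxRev a)
  · rw [if_neg h2, if_neg (show ¬ (y = a ∧ x = b) from fun h' => h2 h'.symm)]
    linear_combination (if x = a ∧ y = b then 1 else 0 : ℂ) * h

lemma emb4_wedge_tmul (a b c d : OspIdx m n) :
    emb4 m n (wedge a b ⊗ₜ wedge c d) = anti m n (basis4 a b c d) := by
  refine tens4_ext fun x y z w => ?_
  rw [emb4_tmul_apply, emb2_wedge, emb2_wedge, anti_apply, wedge2_apply, wedge2_apply]
  simp only [basis4_apply, ite_and]
  split_ifs <;> ring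

lemma sum_smul_basis4 (t : Tens4 m n) :
    ∑ a, ∑ b, ∑ c, ∑ d, t a b c d • basis4 a b c d = t := by
  refine tens4_ext fun x y z w => ?_
  simp only [Finset.sum_apply, Pi.smul_apply, basis4_apply, smul_eq_mul, mul_ite, mul_one,
    mul_zero, ite_and]
  rw [Finset.sum_eq_single x, Finset.sum_eq_single y, Finset.sum_eq_single z,
    Finset.sum_eq_single w]
  · simp
  all_goals first | (intro e _ he; simp [he.symm]) | simp

lemma emb4_proj4 (t : Tens4 m n) : emb4 m n (proj4 m n t) = (1 / 4 : ℂ) • anti m n t := by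
  rw [proj4_apply]
  simp only [map_smul, map_sum, emb4_wedge_tmul]
  nth_rewrite 2 [← sum_smul_basis4 t]
  simp only [map_sum, map_smul]

lemma emb4_proj4_of_mem {t : Tens4 m n} (ht : t ∈ antiSub m n) :
    emb4 m n (proj4 m n t) = t := by
  rw [emb4_proj4, anti_of_mem ht, smul_smul]
  norm_num

/-- Each e_a ∧ e_b is counted in both orders, hence 2; the tensor square of this is the source of
the 1/4 in `proj4`. -/
lemma sum_emb2_smul_wedge (X : osp m n) :
    ∑ a, ∑ b, emb2 m n X a b • wedge a b = (2 : ℂ) • X := by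
  have hval : ∀ (x z : OspIdx m n), (∑ a, ∑ b, emb2 m n X a b • wedge a b : osp m n).1 x z =
      ∑ a, ∑ b, emb2 m n X a b * (wedge a b).1 x z := by
    intro x z
    simp [Matrix.sum_apply, -Fintype.sum_sum_type]
  refine osp_ext fun x z => ?_
  rw [hval]
  change _ = 2 * X.1 x z
  have hz : ∀ b : OspIdx m n, z = idxRev b ↔ b = idxRev z := fun b => by
    rw [eq_comm, idxRev_eq_iff]
  simp only [wedge_apply, mul_sub, Finset.sum_sub_distrib, hz, ite_and, mul_ite, mul_one, mul_zero]
  rw [Finset.sum_eq_single x (fun a _ ha => by simp [ha.symm]) (by simp),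
    Finset.sum_eq_single (idxRev z) (fun b _ hb => by simp [hb]) (by simp),
    Finset.sum_eq_single (idxRev z) (fun a _ ha => by simp [ha]) (by simp),
    Finset.sum_eq_single x (fun b _ hb => by simp [hb.symm]) (by simp)]
  simp only [if_true]
  have h1 := emb2_antisymm X x (idxRev z)
  have h2 : emb2 m n X x (idxRev z) = X.1 x z * metricSign z := by
    rw [emb2_apply, idxRev_idxRev]
  rw [superSign_comm] at h1
  have h3 := metricSign_mul_self z
  linear_combination (-metricSign z) * h1 + 2 * metricSign z * h2 + 2 * X.1 x z * h3

lemma proj4_emb4 (M : OspSq m n) : proj4 m n (emb4 m n M) = M := by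
  induction M using TensorProduct.induction_on with
  | zero => simp
  | add M M' h h' => rw [map_add, map_add, h, h']
  | tmul X Y =>
    have : ∑ a, ∑ b, ∑ c, ∑ d, emb4 m n (X ⊗ₜ Y) a b c d • (wedge a b ⊗ₜ[ℂ] wedge c d) =
        (∑ a, ∑ b, emb2 m n X a b • wedge a b) ⊗ₜ[ℂ] (∑ c, ∑ d, emb2 m n Y c d • wedge c d) := by
      rw [TensorProduct.sum_tmul]
      refine Finset.sum_congr rfl fun a _ => ?_
      rw [TensorProduct.sum_tmul]
      refine Finset.sum_congr rfl fun b _ => ?_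
      rw [TensorProduct.tmul_sum]
      refine Finset.sum_congr rfl fun c _ => ?_
      rw [TensorProduct.tmul_sum]
      refine Finset.sum_congr rfl fun d _ => ?_
      rw [emb4_tmul_apply, TensorProduct.smul_tmul_smul]
    rw [proj4_apply, this, sum_emb2_smul_wedge, sum_emb2_smul_wedge,
      TensorProduct.smul_tmul_smul, smul_smul]
    norm_num

lemma emb4_injective : Function.Injective (emb4 m n) :=
  Function.LeftInverse.injective proj4_emb4

/-! ## Parity -/

/-- The component of parity `k` in `V^{⊗4}`. -/
def tensPart (k : ZMod 2) : Module.End ℂ (Tens4 m n) where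
  toFun t a b c d := (if idxParity a + idxParity b + idxParity c + idxParity d = k then 1 else 0) *
    t a b c d
  map_add' t u := tens4_ext fun a b c d => by simp [mul_add]
  map_smul' z t := tens4_ext fun a b c d => by simp

lemma tensPart_apply (k : ZMod 2) (t : Tens4 m n) (a b c d : OspIdx m n) :
    tensPart k t a b c d =
      (if idxParity a + idxParity b + idxParity c + idxParity d = k then 1 else 0) *
        t a b c d := rfl

lemma emb4_ospSqPart (k : ZMod 2) (M : OspSq m n) :
    emb4 m n (ospSqPart m n k M) = tensPart k (emb4 m n M) := by
  induction M using TensorProduct.induction_on with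
  | zero => simp
  | add M M' h h' => rw [map_add, map_add, h, h', map_add, map_add]
  | tmul U Y =>
    refine tens4_ext fun a b c d => ?_
    simp only [ospSqPart, LinearMap.sum_apply, TensorProduct.map_tmul, map_sum, Finset.sum_apply,
      emb4_tmul_apply, emb2_ospPart, tensPart_apply]
    rw [Finset.sum_eq_single (idxParity a + idxParity b) (fun i _ hi => by simp [hi.symm])
      (by simp), if_pos rfl]
    have : idxParity c + idxParity d = k - (idxParity a + idxParity b) ↔
        idxParity a + idxParity b + idxParity c + idxParity d = k := by
      rw [eq_sub_iff_add_eq, add_comm, ← add_assoc]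
    simp only [this]
    split_ifs <;> simp

lemma tensPart_braid12 (k : ZMod 2) (t : Tens4 m n) :
    tensPart k (braid12 m n t) = braid12 m n (tensPart k t) :=
  tens4_ext fun a b c d => by
    rw [tensPart_apply, braid12_apply, braid12_apply, tensPart_apply,
      add_comm (idxParity b) (idxParity a)]
    ring

lemma tensPart_braid23 (k : ZMod 2) (t : Tens4 m n) :
    tensPart k (braid23 m n t) = braid23 m n (tensPart k t) :=
  tens4_ext fun a b c d => by
    rw [tensPart_apply, braid23_apply, braid23_apply, tensPart_apply,
      add_right_comm (idxParity a) (idxParity c) (idxParity b)]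
    ring

lemma tensPart_braid34 (k : ZMod 2) (t : Tens4 m n) :
    tensPart k (braid34 m n t) = braid34 m n (tensPart k t) :=
  tens4_ext fun a b c d => by
    rw [tensPart_apply, braid34_apply, braid34_apply, tensPart_apply,
      add_right_comm _ (idxParity d) (idxParity c)]
    ring

lemma tensPart_anti (k : ZMod 2) (t : Tens4 m n) :
    tensPart k (anti m n t) = anti m n (tensPart k t) := by
  simp only [anti, pairAnti, Module.End.mul_apply, LinearMap.sub_apply, Module.End.one_apply,
    map_sub, tensPart_braid12, tensPart_braid34]

lemma tensPart_insert23_contract23 (k : ZMod 2) (t : Tens4 m n) :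
    tensPart k (insert23 m n (contract23 m n t)) =
      insert23 m n (contract23 m n (tensPart k t)) :=
  tens4_ext fun a b c d => by
    simp only [tensPart_apply, insert23_apply, contract23_apply, idxParity_idxRev]
    have h : ∀ e : OspIdx m n, idxParity a + idxParity e + idxParity e + idxParity d =
        idxParity a + idxParity d := fun e => by
      rw [add_assoc (idxParity a), CharTwo.add_self_eq_zero, add_zero]
    simp only [h]
    by_cases hc : c = idxRev b
    · subst hc
      rw [if_pos rfl, idxParity_idxRev, h, ← mul_assoc, mul_comm _ (metricSign b), mul_assoc,
        Finset.mul_sum]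
      congr 1
      exact Finset.sum_congr rfl fun e _ => by ring
    · simp [hc]

/-- `sep` is even, so its eigenspaces are graded, as subrepresentations are required to be. -/
lemma tensPart_sep (k : ZMod 2) (t : Tens4 m n) :
    tensPart k (sep m n t) = sep m n (tensPart k t) := by
  rw [sep_apply, sep_apply, map_add, map_smul, tensPart_anti, tensPart_anti, tensPart_braid23,
    tensPart_insert23_contract23]

end

/-! ### Decomposition into irreducibles and the supersymmetric square -/

noncomputable section

variable {m n : ℕ}

/-! ## Eigenspaces of an invariant operator -/

section

variable {M ι : Type*} [AddCommGroup M] [Module ℂ M]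

/-- The eigenspaces of `f` for the eigenvalues `c i` are stable under the action and contain
vectors `v i`, one of which lies in each nonzero stable subspace, and which together generate. -/
structure IsCyclicSpectral (act : osp m n →ₗ[ℂ] Module.End ℂ M) (f : Module.End ℂ M) (c : ι → ℂ)
    (v : ι → M) : Prop where
  injective : Function.Injective c
  stable : ∀ i X, ∀ x ∈ Module.End.eigenspace f (c i), act X x ∈ Module.End.eigenspace f (c i)
  mem : ∀ i, v i ∈ Module.End.eigenspace f (c i)
  ne_zero : ∀ i, v i ≠ 0
  exists_mem : ∀ U : Submodule ℂ M, (∀ X, ∀ x ∈ U, act X x ∈ U) → U ≠ ⊥ → ∃ i, v i ∈ U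
  eq_top : ∀ T : Submodule ℂ M, (∀ X, ∀ x ∈ T, act X x ∈ T) → (∀ i, v i ∈ T) → T = ⊤

namespace IsCyclicSpectral

variable {act : osp m n →ₗ[ℂ] Module.End ℂ M} {f : Module.End ℂ M} {c : ι → ℂ} {v : ι → M}
  (h : IsCyclicSpectral act f c v)

include h

lemma iSupIndep_eigenspace : iSupIndep fun i => Module.End.eigenspace f (c i) :=
  (Module.End.eigenspaces_iSupIndep f).comp h.injective

lemma iSup_eq_top : ⨆ i, Module.End.eigenspace f (c i) = ⊤ := by
  refine h.eq_top _ (fun X => ?_) fun i => Submodule.mem_iSup_of_mem i (h.mem i)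
  have : ⨆ i, Module.End.eigenspace f (c i) ≤
      (⨆ i, Module.End.eigenspace f (c i)).comap (act X) :=
    iSup_le fun i x hx => Submodule.mem_iSup_of_mem i (h.stable i X x hx)
  exact this

lemma isInternal [DecidableEq ι] :
    DirectSum.IsInternal fun i => Module.End.eigenspace f (c i) :=
  (DirectSum.isInternal_submodule_iff_iSupIndep_and_iSup_eq_top _).2
    ⟨h.iSupIndep_eigenspace, h.iSup_eq_top⟩

/-- U together with the other eigenspaces contains every v i and so is everything; modularity of the
lattice of subspaces then forces U to fill its eigenspace. -/
lemma eq_of_mem {U : Submodule ℂ M} {j : ι} (hU : ∀ X, ∀ x ∈ U, act X x ∈ U)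
    (hj : U ≤ Module.End.eigenspace f (c j)) (hv : v j ∈ U) :
    U = Module.End.eigenspace f (c j) := by
  have htop : U ⊔ ⨆ (i) (_ : i ≠ j), Module.End.eigenspace f (c i) = ⊤ := by
    refine h.eq_top _ (fun X => ?_) fun i => ?_
    · have : U ⊔ ⨆ (i) (_ : i ≠ j), Module.End.eigenspace f (c i) ≤
          (U ⊔ ⨆ (i) (_ : i ≠ j), Module.End.eigenspace f (c i)).comap (act X) :=
        sup_le (fun x hx => Submodule.mem_sup_left (hU X x hx))
          (iSup₂_le fun i hi x hx => Submodule.mem_sup_right (Submodule.mem_iSup_of_mem i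
            (Submodule.mem_iSup_of_mem hi (h.stable i X x hx))))
      exact this
    · obtain rfl | hij := eq_or_ne i j
      · exact Submodule.mem_sup_left hv
      · exact Submodule.mem_sup_right (Submodule.mem_iSup_of_mem i
          (Submodule.mem_iSup_of_mem hij (h.mem i)))
  exact eq_of_le_of_inf_le_of_sup_le hj (by rw [(h.iSupIndep_eigenspace j).eq_bot]; exact bot_le)
    (by rw [htop]; exact le_top)

/-- A nonzero U contains some v i, and i = j because distinct eigenspaces meet in zero. The grading
of U is not needed, so the eigenspaces have no proper nonzero invariant subspaces even among
ungraded ones. -/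
lemma isIrreducibleSubrep {pr : ZMod 2 → Module.End ℂ M} {j : ι}
    (hj : IsSubrep act pr (Module.End.eigenspace f (c j))) :
    IsIrreducibleSubrep act pr (Module.End.eigenspace f (c j)) := by
  refine ⟨hj, fun h3 => h.ne_zero j ((Submodule.mem_bot ℂ).1 (h3 ▸ h.mem j)), fun U hUj hU => ?_⟩
  refine or_iff_not_imp_left.2 fun hne => h.eq_of_mem hU.1 hUj ?_
  obtain ⟨i, hi⟩ := h.exists_mem U hU.1 hne
  obtain rfl | hij := eq_or_ne i j
  · exact hi
  · exact absurd (Submodule.disjoint_def.1 (h.iSupIndep_eigenspace.pairwiseDisjoint hij) _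
      (h.mem i) (hUj hi)) (h.ne_zero i)

end IsCyclicSpectral

end

/-! ## The decomposition of `𝔤 ⊗ 𝔤` -/

lemma proj4_eq_iff {t : Tens4 m n} (ht : t ∈ antiSub m n) (M : OspSq m n) :
    proj4 m n t = M ↔ t = emb4 m n M := by
  rw [← emb4_injective.eq_iff, emb4_proj4_of_mem ht]

/-- The separating operator on `𝔤 ⊗ 𝔤`. -/
def sepSq (m n : ℕ) : Module.End ℂ (OspSq m n) := proj4 m n ∘ₗ sep m n ∘ₗ emb4 m n

lemma emb4_sepSq (M : OspSq m n) : emb4 m n (sepSq m n M) = sep m n (emb4 m n M) :=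
  emb4_proj4_of_mem (sep_mem _)

/-- The summands of `𝔤 ⊗ 𝔤`. -/
def sqComponent (m n : ℕ) (i : Fin 6) : Submodule ℂ (OspSq m n) :=
  Module.End.eigenspace (M := OspSq m n) (sepSq m n) (sepValue m n i)

lemma mem_sqComponent {M : OspSq m n} {i : Fin 6} :
    M ∈ sqComponent m n i ↔ sep m n (emb4 m n M) = sepValue m n i • emb4 m n M := by
  rw [sqComponent, Module.End.mem_eigenspace_iff, ← emb4_injective.eq_iff, emb4_sepSq, map_smul]

lemma proj4_mem_sqComponent {t : Tens4 m n} (ht : t ∈ antiSub m n) {i : Fin 6}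
    (h : sep m n t = sepValue m n i • t) : proj4 m n t ∈ sqComponent m n i := by
  rw [mem_sqComponent, emb4_proj4_of_mem ht, h]

lemma isSubrep_sqComponent (i : Fin 6) :
    IsSubrep (M := OspSq m n) (ospSqAct m n) (ospSqPart m n) (sqComponent m n i) := by
  refine ⟨fun X M hM => ?_, fun k M hM => ?_⟩ <;> rw [mem_sqComponent] at *
  · rw [emb4_ospSqAct, intertwines_sep X, hM, map_smul]
  · rw [emb4_ospSqPart, ← tensPart_sep, hM, map_smul]

lemma stable_map_emb4 {U : Submodule ℂ (OspSq m n)}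
    (hU : ∀ X, ∀ M ∈ U, ospSqAct m n X M ∈ U) : Stable (U.map (emb4 m n)) := by
  rintro X _ ⟨M, hM, rfl⟩
  exact ⟨_, hU X M hM, emb4_ospSqAct X M⟩

lemma map_emb4_le (U : Submodule ℂ (OspSq m n)) : U.map (emb4 m n) ≤ antiSub m n := by
  rintro _ ⟨M, -, rfl⟩
  exact emb4_mem M

section

variable {p q : OspIdx m n}

lemma stdVec_mem (i : Fin 6) : stdVec p q i ∈ antiSub m n := sixVec_mem i

lemma exists_proj4_stdVec_mem (h : OddFrame p q) {U : Submodule ℂ (OspSq m n)}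
    (hU : ∀ X, ∀ M ∈ U, ospSqAct m n X M ∈ U) (hne : U ≠ ⊥) :
    ∃ i, proj4 m n (stdVec p q i) ∈ U := by
  obtain ⟨i, M, hM, hi⟩ := exists_stdVec_mem h (map_emb4_le U)
    (fun h0 => hne ((Submodule.eq_bot_iff U).2 fun M hM => emb4_injective (by
      rw [map_zero, ← Submodule.mem_bot ℂ, ← h0]; exact Submodule.mem_map_of_mem hM)))
    (stable_map_emb4 hU)
  exact ⟨i, by rwa [← hi, proj4_emb4]⟩

lemma eq_top_of_proj4_stdVec_mem (h : OddFrame p q) (h0 : (m : ℤ) - 2 * n ≠ 0)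
    (h1 : (m : ℤ) - 2 * n ≠ 1) (h2 : (m : ℤ) - 2 * n ≠ 2) {T : Submodule ℂ (OspSq m n)}
    (hT : ∀ X, ∀ M ∈ T, ospSqAct m n X M ∈ T) (hv : ∀ i, proj4 m n (stdVec p q i) ∈ T) :
    T = ⊤ := by
  have h3 := eq_antiSub_of_stable (form4_stdVec_ne_zero h h0 h1 h2)
    (fun U => exists_stdVec_mem h) (map_emb4_le T) (stable_map_emb4 hT)
    (fun i => ⟨_, hv i, emb4_proj4_of_mem (stdVec_mem i)⟩)
  refine eq_top_iff.2 fun M _ => ?_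
  have h4 := emb4_mem M
  rw [← h3] at h4
  obtain ⟨M', hM', he⟩ := h4
  rwa [← emb4_injective he]

lemma supportedOn_basis4 {S : Set (OspIdx m n)} {a b c d : OspIdx m n} (ha : a ∈ S) (hb : b ∈ S)
    (hc : c ∈ S) (hd : d ∈ S) : SupportedOn S (basis4 a b c d) := fun x y z w h => by
  rw [basis4_apply, if_neg]
  rintro ⟨rfl, rfl, rfl, rfl⟩
  exact h ⟨ha, hb, hc, hd⟩

lemma sep_stdVec (h : OddFrame p q) (i : Fin 6) :
    sep m n (stdVec p q i) = sepValue m n i • stdVec p q i := by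
  have hp : p ∈ ({p, q} : Set (OspIdx m n)) := by simp
  have hq : q ∈ ({p, q} : Set (OspIdx m n)) := by simp
  refine sep_sixVec (S := {p, q}) ?_ (supportedOn_basis4 hp hp hq hq)
    (supportedOn_basis4 hp hp hp hq) (supportedOn_basis4 hp hp hp hp) ?_ ?_ i
  · have h1 := h.pp
    have h2 := h.qq
    have h3 := h.pq'
    have h4 : q ≠ idxRev p := fun e => h3 (by rw [e, idxRev_idxRev])
    rintro a (rfl | rfl) <;> simp [h1.symm, h2.symm, h3.symm, h4.symm]
  · rw [map_add, trace2_flip2_basis2 h.pq', trace2_basis2 h.pq', add_zero]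
  · rw [map_sub, trace2_flip2_basis2 h.pp, trace2_basis2 h.pp, sub_zero]

lemma proj4_stdVec_mem (h : OddFrame p q) (i : Fin 6) :
    proj4 m n (stdVec p q i) ∈ sqComponent m n i :=
  proj4_mem_sqComponent (stdVec_mem i) (sep_stdVec h i)

variable (h : OddFrame p q) (h0 : (m : ℤ) - 2 * n ≠ 0) (h1 : (m : ℤ) - 2 * n ≠ 1)
  (h2 : (m : ℤ) - 2 * n ≠ 2)

include h h0 h1 h2

lemma proj4_stdVec_ne_zero (i : Fin 6) : proj4 m n (stdVec p q i) ≠ 0 := fun h3 =>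
  form4_stdVec_ne_zero h h0 h1 h2 i
    (by rw [(proj4_eq_iff (stdVec_mem i) _).1 h3, map_zero, map_zero])

lemma isCyclicSpectral_sepSq : IsCyclicSpectral (M := OspSq m n) (ospSqAct m n) (sepSq m n)
    (sepValue m n) (fun i => proj4 m n (stdVec p q i)) where
  injective := sepValue_injective h0 h1 h2
  stable i X M hM := (isSubrep_sqComponent i).1 X M hM
  mem i := proj4_stdVec_mem h i
  ne_zero := proj4_stdVec_ne_zero h h0 h1 h2
  exists_mem _ hU hne := exists_proj4_stdVec_mem h hU hne
  eq_top _ hT hv := eq_top_of_proj4_stdVec_mem h h0 h1 h2 hT hv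

lemma isInternal_sqComponent : DirectSum.IsInternal (sqComponent m n) :=
  (isCyclicSpectral_sepSq h h0 h1 h2).isInternal

lemma iSup_sqComponent : ⨆ i, sqComponent m n i = ⊤ :=
  (isCyclicSpectral_sepSq h h0 h1 h2).iSup_eq_top

lemma eq_sqComponent_of_proj4_stdVec_mem {U : Submodule ℂ (OspSq m n)} {j : Fin 6}
    (hU : ∀ X, ∀ M ∈ U, ospSqAct m n X M ∈ U) (hj : U ≤ sqComponent m n j)
    (hv : proj4 m n (stdVec p q j) ∈ U) : U = sqComponent m n j :=
  (isCyclicSpectral_sepSq h h0 h1 h2).eq_of_mem hU hj hv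

lemma isIrreducibleSubrep_sqComponent (j : Fin 6) :
    IsIrreducibleSubrep (M := OspSq m n) (ospSqAct m n) (ospSqPart m n) (sqComponent m n j) :=
  (isCyclicSpectral_sepSq h h0 h1 h2).isIrreducibleSubrep (isSubrep_sqComponent j)

/-! ## The supersymmetric square -/

/-- The flip is invariant, so the vectors of a summand on which it acts by the given sign form an
invariant subspace. It contains the standard vector, hence is the whole summand. -/
lemma swap_emb4_of_mem {j : Fin 6} {M : OspSq m n} (hM : M ∈ sqComponent m n j) :
    swap m n (emb4 m n M) = swapValue j • emb4 m n M := by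
  let U : Submodule ℂ (OspSq m n) := sqComponent m n j ⊓
    LinearMap.ker ((swap m n - swapValue j • 1) ∘ₗ emb4 m n)
  have hmem : ∀ M, M ∈ U ↔ M ∈ sqComponent m n j ∧
      swap m n (emb4 m n M) = swapValue j • emb4 m n M := fun M => by
    simp [U, sub_eq_zero]
  have hU : U = sqComponent m n j := by
    refine eq_sqComponent_of_proj4_stdVec_mem h h0 h1 h2 (fun X M hM => ?_) inf_le_left ?_
    · rw [hmem] at *
      refine ⟨(isSubrep_sqComponent j).1 X M hM.1, ?_⟩
      rw [emb4_ospSqAct, intertwines_swap X, hM.2, map_smul]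
    · rw [hmem, emb4_proj4_of_mem (stdVec_mem j)]
      exact ⟨proj4_stdVec_mem h j, swap_sixVec j⟩
  exact ((hmem M).1 (hU ▸ hM)).2

end

lemma emb2_apply_of_part {X : osp m n} {i : ZMod 2} (h : ospPart m n i X = X) (a b : OspIdx m n) :
    emb2 m n X a b = if idxParity a + idxParity b = i then emb2 m n X a b else 0 := by
  rw [← emb2_ospPart, h]

lemma swap_emb4_tmul {X Y : osp m n} {i j : ZMod 2} (hX : ospPart m n i X = X)
    (hY : ospPart m n j Y = Y) :
    swap m n (emb4 m n (X ⊗ₜ Y)) = superSign i j • emb4 m n (Y ⊗ₜ X) := by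
  refine tens4_ext fun a b c d => ?_
  change _ = superSign i j * emb4 m n (Y ⊗ₜ X) a b c d
  rw [swap_apply, emb4_tmul_apply, emb4_tmul_apply, emb2_apply_of_part hX, emb2_apply_of_part hY]
  by_cases h1 : idxParity c + idxParity d = i
  · by_cases h2 : idxParity a + idxParity b = j
    · rw [if_pos h1, if_pos h2, h1, h2, superSign_comm]; ring
    · rw [if_neg h2]; ring
  · rw [if_neg h1]; ring

lemma ospPart_idem (k : ZMod 2) (X : osp m n) :
    ospPart m n k (ospPart m n k X) = ospPart m n k X :=
  osp_ext fun a b => by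
    rw [ospPart_apply, ospPart_apply]; split_ifs <;> rfl

lemma sum_ospPart (X : osp m n) : ∑ k, ospPart m n k X = X :=
  Eq.trans (by rw [parityTwist_eq_sum]; simp) (parityTwist_zero X)

lemma exists_mem_ospSymSq (M : OspSq m n) :
    ∃ M' ∈ ospSymSq m n, emb4 m n M' = emb4 m n M + swap m n (emb4 m n M) := by
  induction M using TensorProduct.induction_on with
  | zero => exact ⟨0, zero_mem _, by simp⟩
  | add M N hM hN =>
    obtain ⟨M', hM', e⟩ := hM
    obtain ⟨N', hN', e'⟩ := hN
    refine ⟨M' + N', add_mem hM' hN', ?_⟩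
    simp only [map_add, e, e']
    abel
  | tmul X Y =>
    refine ⟨∑ i, ∑ j, (ospPart m n i X ⊗ₜ[ℂ] ospPart m n j Y +
      superSign i j • (ospPart m n j Y ⊗ₜ[ℂ] ospPart m n i X)),
      sum_mem fun i _ => sum_mem fun j _ => Submodule.subset_span
        ⟨i, j, _, _, ospPart_idem i X, ospPart_idem j Y, rfl⟩, ?_⟩
    conv_rhs => rw [← sum_ospPart X, ← sum_ospPart Y]
    simp only [TensorProduct.sum_tmul, TensorProduct.tmul_sum, map_sum, map_add, map_smul,
      ← Finset.sum_add_distrib]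
    rw [Finset.sum_comm]
    refine Finset.sum_congr rfl fun j _ => Finset.sum_congr rfl fun i _ => ?_
    rw [swap_emb4_tmul (ospPart_idem _ X) (ospPart_idem _ Y)]

/-- Inside V^{⊗4} the super flip of 𝔤 ⊗ 𝔤 is the permutation `swap`. The converse writes M as half
of M plus its flip. -/
lemma mem_ospSymSq (M : OspSq m n) :
    M ∈ ospSymSq m n ↔ swap m n (emb4 m n M) = emb4 m n M := by
  constructor
  · intro hM
    induction hM using Submodule.span_induction with
    | mem M hM =>
      obtain ⟨i, j, X, Y, hX, hY, rfl⟩ := hM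
      simp only [map_add, map_smul, swap_emb4_tmul hX hY, swap_emb4_tmul hY hX]
      rw [superSign_comm j i, smul_smul, superSign_mul_self, one_smul, add_comm]
    | zero => simp
    | add M N _ _ hM hN => simp only [map_add, hM, hN]
    | smul z M _ hM => simp only [map_smul, hM]
  · intro hM
    obtain ⟨M', hM', e⟩ := exists_mem_ospSymSq M
    rw [hM, ← map_add] at e
    have h1 := emb4_injective e
    have h2 : M = (1 / 2 : ℂ) • M' := by rw [h1]; module
    rw [h2]
    exact Submodule.smul_mem _ _ hM'

lemma ospSymSq_eq {p q : OspIdx m n} (h : OddFrame p q) (h0 : (m : ℤ) - 2 * n ≠ 0)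
    (h1 : (m : ℤ) - 2 * n ≠ 1) (h2 : (m : ℤ) - 2 * n ≠ 2) : ospSymSq m n =
    sqComponent m n 0 ⊔ sqComponent m n 2 ⊔ sqComponent m n 3 ⊔ sqComponent m n 5 := by
  have hs : ∀ j, swapValue j = 1 → sqComponent m n j ≤ ospSymSq m n := fun j hj M hM => by
    rw [mem_ospSymSq, swap_emb4_of_mem h h0 h1 h2 hM, hj, one_smul]
  refine le_antisymm (fun M hM => ?_)
    (sup_le (sup_le (sup_le (hs 0 rfl) (hs 2 rfl)) (hs 3 rfl)) (hs 5 rfl))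
  -- Twice the projection onto flip-invariants: it is 2 on four summands and 0 on the two with sign
  -- -1.
  let σ : Module.End ℂ (OspSq m n) := proj4 m n ∘ₗ (1 + swap m n) ∘ₗ emb4 m n
  have hσ : ∀ (z : ℂ) M, swap m n (emb4 m n M) = z • emb4 m n M → σ M = (1 + z) • M := by
    intro z M hM
    change proj4 m n (emb4 m n M + swap m n (emb4 m n M)) = _
    rw [hM, map_add, map_smul, proj4_emb4]
    module
  have hle : ⨆ i, sqComponent m n i ≤ (sqComponent m n 0 ⊔ sqComponent m n 2 ⊔
      sqComponent m n 3 ⊔ sqComponent m n 5).comap σ := by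
    refine iSup_le fun i M hM => ?_
    rw [Submodule.mem_comap, hσ _ M (swap_emb4_of_mem h h0 h1 h2 hM)]
    fin_cases i
    · exact Submodule.smul_mem _ _ (Submodule.mem_sup_left (Submodule.mem_sup_left
        (Submodule.mem_sup_left hM)))
    · simp [swapValue]
    · exact Submodule.smul_mem _ _ (Submodule.mem_sup_left (Submodule.mem_sup_left
        (Submodule.mem_sup_right hM)))
    · exact Submodule.smul_mem _ _ (Submodule.mem_sup_left (Submodule.mem_sup_right hM))
    · simp [swapValue]
    · exact Submodule.smul_mem _ _ (Submodule.mem_sup_right hM)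
  rw [iSup_sqComponent h h0 h1 h2] at hle
  have h3 := hle (Submodule.mem_top (x := M))
  rw [Submodule.mem_comap, hσ 1 M (by rw [one_smul]; exact (mem_ospSymSq M).1 hM)] at h3
  have h4 := Submodule.smul_mem _ (1 / 2 : ℂ) h3
  rw [smul_smul] at h4
  norm_num at h4
  exact h4

end

/-! ### Weights and positive roots in terms of matrix entries -/

noncomputable section

variable {m n : ℕ}

/-! ## Evaluation of weights -/

lemma wtEval_add (α β : OspWeight m n) (H : osp m n) :
    wtEval (α + β) H = wtEval α H + wtEval β H := by
  simp only [wtEval, Pi.add_apply, Int.cast_add, add_mul, Finset.sum_add_distrib]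
  ring

lemma wtEval_neg (α : OspWeight m n) (H : osp m n) : wtEval (-α) H = -wtEval α H := by
  simp only [wtEval, Pi.neg_apply, Int.cast_neg, neg_mul, Finset.sum_neg_distrib]
  ring

lemma wtEval_sub (α β : OspWeight m n) (H : osp m n) :
    wtEval (α - β) H = wtEval α H - wtEval β H := by
  rw [sub_eq_add_neg, wtEval_add, wtEval_neg, ← sub_eq_add_neg]

lemma wtEval_zero (H : osp m n) : wtEval (0 : OspWeight m n) H = 0 := by
  simp [wtEval]

lemma wtEval_nsmul (k : ℕ) (α : OspWeight m n) (H : osp m n) :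
    wtEval (k • α) H = k * wtEval α H := by
  simp only [wtEval, Pi.smul_apply, nsmul_eq_mul, Int.cast_mul, Int.cast_natCast, mul_add,
    Finset.mul_sum, mul_assoc]

/-- The label of `e_i` for even `i`, counted from one. -/
abbrev evenIdx (n : ℕ) {m : ℕ} (i : ℕ) (h : i - 1 < m) : OspIdx m n := Sum.inl ⟨i - 1, h⟩

/-- The label of the odd basis vector number `j`, counted from one. -/
abbrev oddIdx (m : ℕ) {n : ℕ} (j : ℕ) (h : j - 1 < 2 * n) : OspIdx m n := Sum.inr ⟨j - 1, h⟩

lemma wtEval_wtEps {i : ℕ} (h1 : 1 ≤ i) (h2 : i ≤ m / 2) (H : osp m n) (h : i - 1 < m) :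
    wtEval (wtEps m n i) H = H.1 (evenIdx n i h) (evenIdx n i h) := by
  rw [wtEval, Finset.sum_eq_single (⟨i - 1, by omega⟩ : Fin (m / 2))]
  · simp only [wtEps, Sum.elim_inl, Sum.elim_inr]
    rw [if_pos (by omega)]
    simp [evenIdx, Fin.castLE]
  · intro k _ hk
    have : ¬ (k.val + 1 = i) := fun h' => hk (Fin.ext (by simp; omega))
    simp [wtEps, this]
  · simp

lemma wtEval_wtDelta {j : ℕ} (h1 : 1 ≤ j) (h2 : j ≤ n) (H : osp m n) (h : j - 1 < 2 * n) :
    wtEval (wtDelta m n j) H = H.1 (oddIdx m j h) (oddIdx m j h) := by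
  rw [wtEval, Finset.sum_eq_single (⟨j - 1, by omega⟩ : Fin n)]
  · simp only [wtDelta, Sum.elim_inl, Sum.elim_inr]
    rw [if_pos (by omega)]
    simp [oddIdx, Fin.castLE]
  · intro k _ hk
    have : ¬ (k.val + 1 = j) := fun h' => hk (Fin.ext (by simp; omega))
    simp [wtDelta, this]
  · simp

/-! ## Positive root vectors -/

/-- A diagonal element of `𝔤` with integral eigenvalues. -/
def diagOsp (φ : OspIdx m n → ℤ) (hφ : ∀ a, φ (idxRev a) = -φ a) : osp m n :=
  ⟨Matrix.diagonal fun a => (φ a : ℂ), (mem_osp_iff _).2 fun a b => by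
    by_cases h : idxRev a = b
    · subst h
      rw [idxRev_idxRev, Matrix.diagonal_apply_eq, Matrix.diagonal_apply_eq, hφ, idxParity_idxRev,
        metricSign_idxRev]
      push_cast
      linear_combination (φ a : ℂ) * metricSign_mul_self a +
        (φ a * metricSign a * metricSign a : ℂ) * superSign_mul_self (idxParity a) (idxParity a)
    · have h' : idxRev b ≠ a := fun h' => h (by rw [← h', idxRev_idxRev])
      rw [Matrix.diagonal_apply_ne _ h, Matrix.diagonal_apply_ne _ h']
      ring⟩

lemma diagOsp_apply_self (φ : OspIdx m n → ℤ) (hφ : ∀ a, φ (idxRev a) = -φ a) (a : OspIdx m n) :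
    (diagOsp φ hφ).1 a a = φ a := Matrix.diagonal_apply_eq _ _

lemma isDiag_diagOsp (φ : OspIdx m n → ℤ) (hφ : ∀ a, φ (idxRev a) = -φ a) :
    (diagOsp φ hφ).1.IsDiag := Matrix.isDiag_diagonal _

lemma ospAd_apply_of_isDiag {H : osp m n} (hH : H.1.IsDiag) (X : osp m n) (a b : OspIdx m n) :
    (ospAd m n H X).1 a b = (H.1 a a - H.1 b b) * X.1 a b := by
  change ∑ c, (H.1 a c * X.1 c b - superSign (idxParity c + idxParity b)
    (idxParity a + idxParity c) * (X.1 a c * H.1 c b)) = _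
  rw [Finset.sum_sub_distrib, Finset.sum_eq_single a (fun c _ hc => by rw [hH hc.symm, zero_mul])
    (by simp), Finset.sum_eq_single b (fun c _ hc => by rw [hH hc, mul_zero, mul_zero]) (by simp),
    CharTwo.add_self_eq_zero, superSign_zero_left]
  ring

/-- A positive root vector raises the degree, for a grading in which the simple roots are
positive. -/
lemma entry_eq_zero_of_isPositiveRootVector {φ : OspIdx m n → ℤ}
    {hφ : ∀ a, φ (idxRev a) = -φ a} {simple : Set (OspWeight m n)}
    (hs : ∀ α ∈ simple, ∃ k : ℤ, 0 < k ∧ wtEval α (diagOsp φ hφ) = k) {X : osp m n}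
    (hX : IsPositiveRootVector simple X) {a b : OspIdx m n} (hab : φ a ≤ φ b) : X.1 a b = 0 := by
  obtain ⟨α, hα, hne, hw⟩ := hX
  -- A sum of simple roots is positive on the grading element unless it is empty. Hence X has
  -- positive degree, while its entry (a, b) has degree φ a - φ b ≤ 0.
  have hpos : α = 0 ∨ ∃ k : ℤ, 0 < k ∧ wtEval α (diagOsp φ hφ) = k := by
    clear hne hw
    induction hα using AddSubmonoid.closure_induction with
    | mem α h => exact Or.inr (hs α h)
    | zero => exact Or.inl rfl
    | add α β _ _ h h' =>
      rcases h with rfl | ⟨k, hk, e⟩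
      · rwa [zero_add]
      · rcases h' with rfl | ⟨l, hl, e'⟩
        · rw [add_zero]; exact Or.inr ⟨k, hk, e⟩
        · exact Or.inr ⟨k + l, by omega, by rw [wtEval_add, e, e']; push_cast; rfl⟩
  obtain ⟨k, hk, e⟩ := hpos.resolve_left hne
  have h1 := congrArg (fun Y : osp m n => Y.1 a b) (hw _ (isDiag_diagOsp φ hφ))
  have h2 : (((φ a - φ b - k : ℤ)) : ℂ) * X.1 a b = 0 := by
    have h3 : (ospAd m n (diagOsp φ hφ) X).1 a b = wtEval α (diagOsp φ hφ) * X.1 a b := h1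
    rw [ospAd_apply_of_isDiag (isDiag_diagOsp φ hφ), e, diagOsp_apply_self,
      diagOsp_apply_self] at h3
    push_cast
    linear_combination h3
  refine (mul_eq_zero.1 h2).resolve_left (Int.cast_ne_zero.2 ?_)
  omega

/-- The gradings used for the two root systems. -/
def gradeFn (A B : ℤ) : OspIdx m n → ℤ :=
  -- Degrees descend in steps of 2 and are antisymmetric under duality; `A` and `B` lift the
  -- positive even and positive odd labels, which decides the order of the ε's and δ's.
  Sum.elim (fun i => (m - 1 - 2 * i.val : ℤ) + A * Int.sign (m - 1 - 2 * i.val))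
    (fun j => (2 * n - 1 - 2 * j.val : ℤ) + B * Int.sign (2 * n - 1 - 2 * j.val))

lemma gradeFn_idxRev (A B : ℤ) (a : OspIdx m n) : gradeFn A B (idxRev a) = -gradeFn A B a := by
  cases a with
  | inl i =>
    have h : (m - 1 - 2 * ((Fin.rev i).val : ℤ)) = -(m - 1 - 2 * i.val : ℤ) := by
      have := i.isLt
      rw [Fin.val_rev]; omega
    simp only [gradeFn, idxRev, Sum.map_inl, Sum.elim_inl]
    rw [h, Int.sign_neg]; ring
  | inr j =>
    have h : (2 * n - 1 - 2 * ((Fin.rev j).val : ℤ)) = -(2 * n - 1 - 2 * j.val : ℤ) := by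
      have := j.isLt
      rw [Fin.val_rev]; omega
    simp only [gradeFn, idxRev, Sum.map_inr, Sum.elim_inr]
    rw [h, Int.sign_neg]; ring

lemma gradeFn_inl_of_lt (A B : ℤ) {i : Fin m} (h : 2 * i.val + 1 < m) :
    gradeFn (n := n) A B (Sum.inl i) = m - 1 - 2 * i.val + A := by
  rw [gradeFn, Sum.elim_inl, Int.sign_eq_one_of_pos (by omega), mul_one]

lemma gradeFn_inr_of_lt (A B : ℤ) {j : Fin (2 * n)} (h : j.val < n) :
    gradeFn (m := m) A B (Sum.inr j) = 2 * n - 1 - 2 * j.val + B := by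
  rw [gradeFn, Sum.elim_inr, Int.sign_eq_one_of_pos (by omega), mul_one]

lemma gradeFn_inl_le {A : ℤ} (hA : 0 ≤ A) (B : ℤ) (i : Fin m) :
    gradeFn (n := n) A B (Sum.inl i) ≤ m - 1 - 2 * i.val + A := by
  rw [gradeFn, Sum.elim_inl]
  rcases lt_trichotomy ((m : ℤ) - 1 - 2 * i.val) 0 with h | h | h
  · rw [Int.sign_eq_neg_one_of_neg h]; omega
  · rw [h]; simpa
  · rw [Int.sign_eq_one_of_pos h]; omega

lemma gradeFn_inl_le_zero {A : ℤ} (hA : 0 ≤ A) (B : ℤ) {i : Fin m} (h : m ≤ 2 * i.val + 1) :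
    gradeFn (n := n) A B (Sum.inl i) ≤ 0 := by
  rw [gradeFn, Sum.elim_inl]
  rcases (show (m : ℤ) - 1 - 2 * i.val ≤ 0 by omega).lt_or_eq with h | h
  · rw [Int.sign_eq_neg_one_of_neg h]; omega
  · rw [h]; simp

lemma gradeFn_inr_le (A : ℤ) {B : ℤ} (hB : 0 ≤ B) (j : Fin (2 * n)) :
    gradeFn (m := m) A B (Sum.inr j) ≤ 2 * n - 1 - 2 * j.val + B := by
  rw [gradeFn, Sum.elim_inr]
  rcases lt_trichotomy ((2 * n : ℤ) - 1 - 2 * j.val) 0 with h | h | h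
  · rw [Int.sign_eq_neg_one_of_neg h]; omega
  · rw [h]; simpa
  · rw [Int.sign_eq_one_of_pos h]; omega

section

variable (A B : ℤ)

lemma wtEval_wtEps_gradeFn {i : ℕ} (h1 : 1 ≤ i) (h2 : i ≤ m / 2) :
    wtEval (wtEps m n i) (diagOsp (gradeFn A B) (gradeFn_idxRev A B)) =
      ((m + 1 - 2 * i + A : ℤ) : ℂ) := by
  rw [wtEval_wtEps h1 h2 _ (by omega), diagOsp_apply_self, gradeFn_inl_of_lt _ _ (by simp; omega)]
  congr 1
  simp only
  omega

lemma wtEval_wtDelta_gradeFn {j : ℕ} (h1 : 1 ≤ j) (h2 : j ≤ n) :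
    wtEval (wtDelta m n j) (diagOsp (gradeFn A B) (gradeFn_idxRev A B)) =
      ((2 * n + 1 - 2 * j + B : ℤ) : ℂ) := by
  rw [wtEval_wtDelta h1 h2 _ (by omega), diagOsp_apply_self, gradeFn_inr_of_lt _ _ (by simp; omega)]
  congr 1
  simp only
  omega

end

/-- The shift B = m puts every δ above every ε; δ_n gets degree m + 1 and ε₁ gets m - 1. -/
lemma standardSimpleRoots_pos (hm : 4 < m) (hn : 1 < n) {α : OspWeight m n}
    (hα : α ∈ standardSimpleRoots m n) : ∃ k : ℤ, 0 < k ∧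
      wtEval α (diagOsp (gradeFn 0 m) (gradeFn_idxRev 0 m)) = k := by
  rcases hα with ((⟨j, h1, h2, rfl⟩ | rfl) | ⟨i, h1, h2, rfl⟩) | rfl
  · refine ⟨2, by norm_num, ?_⟩
    rw [wtEval_sub, wtEval_wtDelta_gradeFn _ _ h1 (by omega),
      wtEval_wtDelta_gradeFn _ _ (by omega) (by omega)]
    push_cast; ring
  · refine ⟨2, by norm_num, ?_⟩
    rw [wtEval_sub, wtEval_wtDelta_gradeFn _ _ (by omega) le_rfl,
      wtEval_wtEps_gradeFn _ _ le_rfl (by omega)]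
    push_cast; ring
  · refine ⟨2, by norm_num, ?_⟩
    rw [wtEval_sub, wtEval_wtEps_gradeFn _ _ h1 (by omega),
      wtEval_wtEps_gradeFn _ _ (by omega) (by omega)]
    push_cast; ring
  · split_ifs with h
    · refine ⟨m + 1 - 2 * (m / 2 : ℕ) + 0, by omega, ?_⟩
      rw [wtEval_wtEps_gradeFn _ _ (by omega) le_rfl]
    · refine ⟨(m + 1 - 2 * (m / 2 - 1 : ℕ) + 0) + (m + 1 - 2 * (m / 2 : ℕ) + 0), by omega, ?_⟩
      rw [wtEval_add, wtEval_wtEps_gradeFn _ _ (by omega) (by omega),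
        wtEval_wtEps_gradeFn _ _ (by omega) le_rfl, ← Int.cast_add]

/-- The shift A = 2n puts every ε above every δ; ε_d exceeds δ₁ by 2 for even m and by 3 for odd m.
-/
lemma nonstandardSimpleRoots_pos (hm : 4 < m) (hn : 1 < n) {α : OspWeight m n}
    (hα : α ∈ nonstandardSimpleRoots m n) : ∃ k : ℤ, 0 < k ∧
      wtEval α (diagOsp (gradeFn (2 * n) 0) (gradeFn_idxRev (2 * n) 0)) = k := by
  rcases hα with ((⟨i, h1, h2, rfl⟩ | rfl) | ⟨j, h1, h2, rfl⟩) | rfl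
  · refine ⟨2, by norm_num, ?_⟩
    rw [wtEval_sub, wtEval_wtEps_gradeFn _ _ h1 (by omega),
      wtEval_wtEps_gradeFn _ _ (by omega) (by omega)]
    push_cast; ring
  · refine ⟨(m + 1 - 2 * (m / 2 : ℕ) + 2 * n) - (2 * n + 1 - 2 * (1 : ℕ) + 0), by omega, ?_⟩
    rw [wtEval_sub, wtEval_wtDelta_gradeFn _ _ le_rfl (by omega),
      wtEval_wtEps_gradeFn _ _ (by omega) le_rfl, Int.cast_sub]
  · refine ⟨2, by norm_num, ?_⟩
    rw [wtEval_sub, wtEval_wtDelta_gradeFn _ _ h1 (by omega),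
      wtEval_wtDelta_gradeFn _ _ (by omega) (by omega)]
    push_cast; ring
  · split_ifs with h
    · refine ⟨1, by norm_num, ?_⟩
      rw [wtEval_wtDelta_gradeFn _ _ (by omega) le_rfl]
      push_cast; ring
    · refine ⟨2, by norm_num, ?_⟩
      rw [wtEval_nsmul, wtEval_wtDelta_gradeFn _ _ (by omega) le_rfl]
      push_cast; ring

/-! ## Highest weight vectors -/

lemma isHighestWeightVector_proj4 {simple : Set (OspWeight m n)} {μ : OspWeight m n}
    {t : Tens4 m n} (ht : t ∈ antiSub m n) (h0 : t ≠ 0) (hw : HasWeight (act4 m n) μ t)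
    (hk : ∀ X, IsPositiveRootVector simple X → act4 m n X t = 0) :
    IsHighestWeightVector (M := OspSq m n) (ospSqAct m n) simple μ (proj4 m n t) := by
  refine ⟨fun h => h0 (by rw [(proj4_eq_iff ht _).1 h, map_zero]), fun H hH => ?_, fun X hX => ?_⟩
  · apply emb4_injective
    rw [emb4_ospSqAct, emb4_proj4_of_mem ht, hw H hH, map_smul, emb4_proj4_of_mem ht]
  · apply emb4_injective
    rw [emb4_ospSqAct, emb4_proj4_of_mem ht, hk X hX, map_zero]

lemma act2_basis2_of_isDiag {H : osp m n} (hH : H.1.IsDiag) (a b : OspIdx m n) :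
    act2 m n H (basis2 a b) = (H.1 a a + H.1 b b) • basis2 a b := by
  rw [act2_basis2, sum_smul_eq_single a fun x hx => hH hx,
    sum_smul_eq_single b fun x hx => by rw [hH hx, mul_zero], CharTwo.add_self_eq_zero,
    superSign_zero_right]
  module

lemma act4_basis4_of_isDiag {H : osp m n} (hH : H.1.IsDiag) (a b c d : OspIdx m n) :
    act4 m n H (basis4 a b c d) =
      (H.1 a a + H.1 b b + H.1 c c + H.1 d d) • basis4 a b c d := by
  rw [act4_basis4, sum_smul_eq_single a fun x hx => hH hx,
    sum_smul_eq_single b fun x hx => by rw [hH hx, mul_zero],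
    sum_smul_eq_single c fun x hx => by rw [hH hx, mul_zero],
    sum_smul_eq_single d fun x hx => by rw [hH hx, mul_zero]]
  simp only [CharTwo.add_self_eq_zero, superSign_zero_right]
  module

lemma ricciVec_smul (z : ℂ) (x : Tens2 m n) : ricciVec (z • x) = z • ricciVec x := by
  simp only [ricciVec, map_smul]

lemma act4_sixVec_of_smul {X : osp m n} {w₁ w₂ w₄ : Tens4 m n} {x₃ x₅ : Tens2 m n}
    {c : Fin 6 → ℂ} (h₁ : act4 m n X w₁ = c 0 • w₁) (h₂ : act4 m n X w₂ = c 1 • w₂)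
    (h₃ : act2 m n X x₃ = c 2 • x₃) (h₄ : act4 m n X w₄ = c 3 • w₄)
    (h₅ : act2 m n X x₅ = c 4 • x₅) (h₆ : c 5 = 0) (i : Fin 6) :
    act4 m n X (sixVec w₁ w₂ w₄ x₃ x₅ i) = c i • sixVec w₁ w₂ w₄ x₃ x₅ i := by
  fin_cases i
  · exact (act4_weylVec X w₁).trans (by rw [h₁, weylVec_smul]; rfl)
  · exact (act4_altVec X w₂).trans (by rw [h₂, altVec_smul]; rfl)
  · exact (act4_ricciVec X _).trans (by
      rw [map_add, act2_flip2, h₃, map_smul, ← smul_add, ricciVec_smul]; rfl)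
  · exact (intertwines_full X w₄).symm.trans (by rw [h₄, map_smul]; rfl)
  · exact (act4_ricciVec X _).trans (by
      rw [map_sub, act2_flip2, h₅, map_smul, ← smul_sub, ricciVec_smul]; rfl)
  · exact (act4_ricciVec X _).trans (by
      rw [act2_metric2, ricciVec_zero]
      change 0 = c 5 • _
      rw [h₆, zero_smul])

lemma hasWeight_sixVec {μ : Fin 6 → OspWeight m n} {a₁ b₁ c₁ d₁ a₂ b₂ c₂ d₂ a₃ b₃ a₄ b₄ c₄ d₄ a₅ b₅ :
    OspIdx m n} (h : ∀ H : osp m n, ∀ i, wtEval (μ i) H =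
      ![H.1 a₁ a₁ + H.1 b₁ b₁ + H.1 c₁ c₁ + H.1 d₁ d₁, H.1 a₂ a₂ + H.1 b₂ b₂ + H.1 c₂ c₂ + H.1 d₂ d₂,
        H.1 a₃ a₃ + H.1 b₃ b₃, H.1 a₄ a₄ + H.1 b₄ b₄ + H.1 c₄ c₄ + H.1 d₄ d₄,
        H.1 a₅ a₅ + H.1 b₅ b₅, 0] i) (i : Fin 6) :
    HasWeight (act4 m n) (μ i) (sixVec (basis4 a₁ b₁ c₁ d₁) (basis4 a₂ b₂ c₂ d₂)
      (basis4 a₄ b₄ c₄ d₄) (basis2 a₃ b₃) (basis2 a₅ b₅) i) := by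
  intro H hH
  refine act4_sixVec_of_smul (c := fun i => wtEval (μ i) H) ?_ ?_ ?_ ?_ ?_ ?_ i
  · rw [act4_basis4_of_isDiag hH, h]; rfl
  · rw [act4_basis4_of_isDiag hH, h]; rfl
  · rw [act2_basis2_of_isDiag hH, h]; rfl
  · rw [act4_basis4_of_isDiag hH, h]; rfl
  · rw [act2_basis2_of_isDiag hH, h]; rfl
  · exact h H 5

end

/-! ### Highest weight vectors for the two root systems -/

noncomputable section

variable {m n : ℕ}

/-! ## The standard root system -/

lemma oddFrame_std (hn : 1 < n) :
    OddFrame (oddIdx m 1 (by omega) : OspIdx m n) (oddIdx m 2 (by omega)) where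
  hp := rfl
  hq := rfl
  pp h := by simp [oddIdx, idxRev, Fin.ext_iff] at h; omega
  qq h := by simp [oddIdx, idxRev, Fin.ext_iff] at h; omega
  pq h := by simp [oddIdx] at h
  pq' h := by simp [oddIdx, idxRev, Fin.ext_iff] at h; omega

lemma wtEval_standardWeights (hn : 1 < n) (H : osp m n) (i : Fin 6) :
    wtEval (standardWeights m n i) H =
      let p := H.1 (oddIdx m 1 (by omega)) (oddIdx m 1 (by omega))
      let q := H.1 (oddIdx m 2 (by omega)) (oddIdx m 2 (by omega))
      ![p + p + q + q, p + p + p + q, p + q, p + p + p + p, p + p, 0] i := by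
  have e1 := wtEval_wtDelta (m := m) le_rfl hn.le H (by omega)
  have e2 := wtEval_wtDelta (m := m) one_le_two hn H (by omega)
  fin_cases i <;>
    simp only [standardWeights, Fin.isValue, Fin.zero_eta, Fin.mk_one, Fin.reduceFinMk,
      Matrix.cons_val, wtEval_add, wtEval_nsmul, wtEval_zero, e1, e2] <;> push_cast <;> ring

lemma isHighestWeightVector_standard (hm : 4 < m) (hn : 1 < n) (h0 : (m : ℤ) - 2 * n ≠ 0)
    (h1 : (m : ℤ) - 2 * n ≠ 1) (h2 : (m : ℤ) - 2 * n ≠ 2) (i : Fin 6) :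
    IsHighestWeightVector (M := OspSq m n) (ospSqAct m n) (standardSimpleRoots m n)
      (standardWeights m n i)
      (proj4 m n (stdVec (oddIdx m 1 (by omega)) (oddIdx m 2 (by omega)) i)) := by
  refine isHighestWeightVector_proj4 (stdVec_mem i) (fun h3 =>
    form4_stdVec_ne_zero (oddFrame_std hn) h0 h1 h2 i (by rw [h3, map_zero]))
    (hasWeight_sixVec (fun H i => wtEval_standardWeights hn H i) i) fun X hX => ?_
  have hz : ∀ a b, gradeFn 0 m a ≤ gradeFn 0 m b → X.1 a b = 0 := fun a b =>
    entry_eq_zero_of_isPositiveRootVector (fun α => standardSimpleRoots_pos hm hn) hX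
  -- The label of δ₁ has the largest degree and that of δ₂ the largest among the others.
  refine act4_stdVec_eq_zero rfl rfl (fun x => hz _ _ ?_) (fun x hx => hz _ _ ?_) i
  · rw [gradeFn_inr_of_lt _ _ (by simp; omega)]
    rcases x with i | j
    · exact (gradeFn_inl_le le_rfl _ i).trans (by simp; omega)
    · exact (gradeFn_inr_le _ (by omega) j).trans (by simp; omega)
  · rw [gradeFn_inr_of_lt _ _ (by simp; omega)]
    rcases x with i | j
    · exact (gradeFn_inl_le le_rfl _ i).trans (by simp; omega)
    · have hj : j.val ≠ 0 := fun h => hx (congrArg Sum.inr (Fin.ext h))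
      exact (gradeFn_inr_le _ (by omega) j).trans (by simp; omega)

/-! ## The non-standard root system -/

/-- The six vectors for the non-standard root system. -/
def nonstdVec (a b c d : OspIdx m n) : Fin 6 → Tens4 m n :=
  sixVec (basis4 a b a b) (basis4 a b a c) (basis4 a b c d) (basis2 a a) (basis2 a b)

section

variable {a b c d : OspIdx m n}

lemma full_basis4_eq_zero_left (h : idxParity a = 0) : full m n (basis4 a a b c) = 0 := by
  have := full_braid12 (basis4 a a b c)
  rwa [braid12_basis4, h, superSign_zero_left, one_smul, self_eq_neg] at this

lemma full_basis4_eq_zero_mid (h : idxParity b = 0) : full m n (basis4 a b b c) = 0 := by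
  have := full_braid23 (basis4 a b b c)
  rwa [braid23_basis4, h, superSign_zero_left, one_smul, self_eq_neg] at this

lemma full_basis4_eq_zero_right (h : idxParity c = 0) : full m n (basis4 a b c c) = 0 := by
  have := full_braid34 (basis4 a b c c)
  rwa [braid34_basis4, h, superSign_zero_left, one_smul, self_eq_neg] at this

lemma full_basis4_eq_zero_odd (h : idxParity a = 0) : full m n (basis4 a b a c) = 0 := by
  have := full_braid12 (basis4 a b a c)
  rw [braid12_basis4, h, superSign_zero_left, one_smul, full_basis4_eq_zero_mid h] at this
  exact neg_eq_zero.1 this.symm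

lemma full_basis4_eq_zero_even (h : idxParity b = 0) : full m n (basis4 a b c b) = 0 := by
  have := full_braid34 (basis4 a b c b)
  rw [braid34_basis4, h, superSign_zero_right, one_smul, full_basis4_eq_zero_mid h] at this
  exact neg_eq_zero.1 this.symm

lemma full_basis4_eq_zero_outer (h : idxParity a = 0) : full m n (basis4 a b c a) = 0 := by
  have := full_braid34 (basis4 a b c a)
  rw [braid34_basis4, h, superSign_zero_right, one_smul, full_basis4_eq_zero_odd h] at this
  exact neg_eq_zero.1 this.symm

lemma anti_basis4_eq_zero_left (h : idxParity a = 0) : anti m n (basis4 a a b c) = 0 :=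
  anti_eq_zero_of_braid12 (by rw [braid12_basis4, h, superSign_zero_left, one_smul])

lemma anti_basis4_eq_zero_right (h : idxParity c = 0) : anti m n (basis4 a b c c) = 0 :=
  anti_eq_zero_of_braid34 (by rw [braid34_basis4, h, superSign_zero_left, one_smul])

lemma sum_smul_eq_zero_of_or {N : Type*} [AddCommGroup N] [Module ℂ N] {v : OspIdx m n → N}
    {z : OspIdx m n → ℂ} (h : ∀ x, z x = 0 ∨ v x = 0) : ∑ x, z x • v x = 0 :=
  Finset.sum_eq_zero fun x _ => by rcases h x with h | h <;> rw [h] <;> simp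

/-- X moves each label only to earlier ones, where antisymmetry in repeated even labels kills the
result, or abab is fixed by the flip. An odd c may coincide with d, since e_c ∧ e_c does not vanish
then; this is why a step from d to c is tolerated only for even c. -/
lemma act4_nonstdVec_eq_zero (ha : idxParity a = 0) (hb : idxParity b = 0) {X : osp m n}
    (hXa : ∀ x, X.1 x a = 0) (hXb : ∀ x, x ≠ a → X.1 x b = 0)
    (hXc : ∀ x, x ≠ a → x ≠ b → X.1 x c = 0)
    (hXd : ∀ x, x ≠ a → x ≠ b → (x = c → idxParity c = 1) → X.1 x d = 0) (i : Fin 6) :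
    act4 m n X (nonstdVec a b c d i) = 0 := by
  have hc : ∀ x, X.1 x c = 0 ∨ x = a ∨ x = b := fun x => by have := hXc x; tauto
  have hd : ∀ x, X.1 x d = 0 ∨ x = a ∨ x = b ∨ (x = c ∧ idxParity c = 0) := fun x => by
    have := hXd x
    have := zmod_two_cases (idxParity c)
    tauto
  fin_cases i
  · refine (act4_weylVec X _).trans ?_
    rw [act4_basis4, sum_smul_eq_zero fun x => hXa x,
      sum_smul_eq_single a fun x hx => by rw [hXb x hx, mul_zero],
      sum_smul_eq_zero fun x => by rw [hXa x, mul_zero],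
      sum_smul_eq_single a fun x hx => by rw [hXb x hx, mul_zero], zero_add, add_zero,
      weylVec_add, weylVec_smul, weylVec_smul,
      weylVec_eq_zero_of_anti (anti_basis4_eq_zero_left ha),
      weylVec_eq_zero_of_anti (anti_basis4_eq_zero_right ha), smul_zero, smul_zero, add_zero]
  · refine (act4_altVec X _).trans ?_
    rw [act4_basis4, sum_smul_eq_zero fun x => hXa x,
      sum_smul_eq_single a fun x hx => by rw [hXb x hx, mul_zero],
      sum_smul_eq_zero fun x => by rw [hXa x, mul_zero], zero_add, add_zero,
      altVec_add, altVec_smul, altVec_eq_zero_of_anti (anti_basis4_eq_zero_left ha), smul_zero,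
      zero_add, altVec_sum_smul]
    refine sum_smul_eq_zero_of_or fun x => ?_
    rcases hc x with h | rfl | rfl
    · exact Or.inl (by rw [h, mul_zero])
    · exact Or.inr (altVec_eq_zero_of_anti (anti_basis4_eq_zero_right ha))
    · exact Or.inr (altVec_eq_zero_of_swap (by rw [swap_basis4, ha, hb]; simp))
  · refine (act4_ricciVec X _).trans ?_
    rw [map_add, act2_flip2, act2_basis2, sum_smul_eq_zero fun x => hXa x,
      sum_smul_eq_zero fun x => by rw [hXa x, mul_zero]]
    simp [ricciVec_zero]
  · refine (intertwines_full X _).symm.trans ?_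
    rw [act4_basis4, sum_smul_eq_zero fun x => hXa x,
      sum_smul_eq_single a fun x hx => by rw [hXb x hx, mul_zero], zero_add]
    simp only [map_add, map_sum, map_smul]
    rw [full_basis4_eq_zero_left ha, smul_zero, zero_add, sum_smul_eq_zero_of_or,
      sum_smul_eq_zero_of_or, add_zero]
    · intro x
      rcases hd x with h | rfl | rfl | ⟨rfl, h⟩
      · exact Or.inl (by rw [h, mul_zero])
      · exact Or.inr (full_basis4_eq_zero_outer ha)
      · exact Or.inr (full_basis4_eq_zero_even hb)
      · exact Or.inr (full_basis4_eq_zero_right h)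
    · intro x
      rcases hc x with h | rfl | rfl
      · exact Or.inl (by rw [h, mul_zero])
      · exact Or.inr (full_basis4_eq_zero_odd ha)
      · exact Or.inr (full_basis4_eq_zero_mid hb)
  · refine (act4_ricciVec X _).trans ?_
    rw [map_sub, act2_flip2, act2_basis2, sum_smul_eq_zero fun x => hXa x,
      sum_smul_eq_single a fun x hx => by rw [hXb x hx, mul_zero], zero_add, map_smul,
      flip2_basis2, ha]
    simp [ricciVec_zero]
  · refine (act4_ricciVec X _).trans ?_
    rw [act2_metric2, ricciVec_zero]

/-- Basis labels spanning an isotropic subspace, the last two of which may agree if odd. -/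
structure EvenFrame (a b c d : OspIdx m n) : Prop where
  ha : idxParity a = 0
  hb : idxParity b = 0
  ab : a ≠ b
  ac : a ≠ c
  ad : a ≠ d
  bc : b ≠ c
  bd : b ≠ d
  cd : c = d → idxParity c = 1
  isotropic : ∀ x ∈ ({a, b, c, d} : Set (OspIdx m n)), idxRev x ∉ ({a, b, c, d} : Set _)

variable (h : EvenFrame a b c d)

include h

lemma EvenFrame.trace_symm : trace2 m n (basis2 a a + flip2 m n (basis2 a a)) = 0 := by
  have h1 : a ≠ idxRev a := fun e => h.isotropic a (by simp) (by rw [← e]; simp)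
  rw [map_add, trace2_flip2_basis2 h1, trace2_basis2 h1, add_zero]

lemma EvenFrame.trace_anti : trace2 m n (basis2 a b - flip2 m n (basis2 a b)) = 0 := by
  have h1 : a ≠ idxRev b := fun e => h.isotropic b (by simp) (by rw [← e]; simp)
  rw [map_sub, trace2_flip2_basis2 h1, trace2_basis2 h1, sub_zero]

lemma sep_nonstdVec (i : Fin 6) :
    sep m n (nonstdVec a b c d i) = sepValue m n i • nonstdVec a b c d i :=
  sep_sixVec h.isotropic (supportedOn_basis4 (by simp) (by simp) (by simp) (by simp))
    (supportedOn_basis4 (by simp) (by simp) (by simp) (by simp))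
    (supportedOn_basis4 (by simp) (by simp) (by simp) (by simp)) h.trace_symm h.trace_anti i

/-- For Weyl, alternating and fully antisymmetric type one entry is evaluated. A trace-free x is
recovered from its Ricci tensor by contraction, up to the factor m - 2n - 2. -/
lemma nonstdVec_ne_zero (h2 : (m : ℤ) - 2 * n ≠ 2) (h6 : ricciVec (metric2 m n) ≠ 0) (i : Fin 6) :
    nonstdVec a b c d i ≠ 0 := by
  obtain ⟨ha, hb, hab, hac, had, hbc, hbd, hcd, -⟩ := id h
  have h2' : (m : ℂ) - 2 * n - 2 ≠ 0 := fun e => h2 (by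
    have := sub_eq_zero.1 e
    exact_mod_cast this)
  have hricci : ∀ x : Tens2 m n, trace2 m n x = 0 → x ≠ 0 → ricciVec x ≠ 0 := by
    intro x hx hx0 h3
    have h4 := contract23_ricciVec x
    rw [h3, hx, map_zero, zero_smul, add_zero] at h4
    exact (smul_ne_zero h2' hx0) h4.symm
  fin_cases i
  · change weylVec _ ≠ 0
    intro h3
    have h4 := congrFun (congrFun (congrFun (congrFun h3 a) b) a) b
    rw [weylVec, full_basis4_eq_zero_odd ha, smul_zero, sub_zero, swap_basis4, anti_apply] at h4
    simp [basis4_apply, ha, hb, hab, hab.symm] at h4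
  · change altVec _ ≠ 0
    intro h3
    have h4 := congrFun (congrFun (congrFun (congrFun h3 a) b) a) c
    rw [altVec, swap_basis4, anti_apply] at h4
    simp [basis4_apply, ha, hb, hab, hab.symm, hac, hac.symm, hbc, hbc.symm] at h4
  · refine hricci _ h.trace_symm fun h3 => ?_
    have h4 := congrFun (congrFun h3 a) a
    simp [flip2_basis2, basis2_apply, ha] at h4
  · change full m n _ ≠ 0
    intro h3
    have h4 := congrFun (congrFun (congrFun (congrFun h3 a) b) c) d
    rw [full_apply, swap_basis4] at h4
    simp only [Pi.sub_apply, Pi.add_apply, anti_apply, braid23_apply, map_smul, Pi.smul_apply] at h4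
    by_cases hcd' : c = d
    · subst hcd'
      simp [basis4_apply, ha, hb, hab, hab.symm, hac, hac.symm, hbc, hbc.symm, hcd rfl] at h4
    · simp [basis4_apply, ha, hb, hab, hab.symm, hac, hac.symm, hbc, hbc.symm, had, had.symm, hbd,
        hbd.symm, hcd', Ne.symm hcd'] at h4
  · refine hricci _ h.trace_anti fun h3 => ?_
    have h4 := congrFun (congrFun h3 a) b
    simp [flip2_basis2, basis2_apply, ha, hab, hab.symm] at h4
  · exact h6

end

/-- The third label for the non-standard root system. -/
def thirdIdx (hm : 4 < m) (hn : 1 < n) : OspIdx m n :=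
  if 6 ≤ m then evenIdx n 3 (by omega) else oddIdx m 1 (by omega)

/-- The fourth label for the non-standard root system. -/
def fourthIdx (hm : 4 < m) (hn : 1 < n) : OspIdx m n :=
  if 8 ≤ m then evenIdx n 4 (by omega) else oddIdx m 1 (by omega)

lemma thirdIdx_cases (hm : 4 < m) (hn : 1 < n) :
    (6 ≤ m ∧ thirdIdx hm hn = evenIdx n 3 (by omega)) ∨
      (m < 6 ∧ thirdIdx hm hn = oddIdx m 1 (by omega)) := by
  unfold thirdIdx
  split_ifs with h
  · exact Or.inl ⟨h, rfl⟩
  · exact Or.inr ⟨by omega, rfl⟩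

lemma fourthIdx_cases (hm : 4 < m) (hn : 1 < n) :
    (8 ≤ m ∧ fourthIdx hm hn = evenIdx n 4 (by omega)) ∨
      (m < 8 ∧ fourthIdx hm hn = oddIdx m 1 (by omega)) := by
  unfold fourthIdx
  split_ifs with h
  · exact Or.inl ⟨h, rfl⟩
  · exact Or.inr ⟨by omega, rfl⟩

lemma evenFrame_nonstd (hm : 4 < m) (hn : 1 < n) :
    EvenFrame (evenIdx n 1 (by omega)) (evenIdx n 2 (by omega)) (thirdIdx hm hn)
      (fourthIdx hm hn) := by
  rcases thirdIdx_cases hm hn with ⟨h1, e1⟩ | ⟨h1, e1⟩ <;>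
    rcases fourthIdx_cases hm hn with ⟨h2, e2⟩ | ⟨h2, e2⟩ <;> rw [e1, e2]
  · refine ⟨rfl, rfl, ?_, ?_, ?_, ?_, ?_, ?_, ?_⟩
    all_goals simp [evenIdx, idxRev, Fin.ext_iff]
    omega
  · refine ⟨rfl, rfl, ?_, ?_, ?_, ?_, ?_, ?_, ?_⟩
    all_goals simp [evenIdx, oddIdx, idxRev, Fin.ext_iff]
    omega
  · omega
  · refine ⟨rfl, rfl, ?_, ?_, ?_, ?_, ?_, ?_, ?_⟩
    all_goals simp [evenIdx, oddIdx, idxRev, Fin.ext_iff]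
    · rfl
    · omega

lemma wtEval_nonstandardWeights (hm : 4 < m) (hn : 1 < n) (H : osp m n) (i : Fin 6) :
    wtEval (nonstandardWeights m n i) H =
      let a := H.1 (evenIdx n 1 (by omega)) (evenIdx n 1 (by omega))
      let b := H.1 (evenIdx n 2 (by omega)) (evenIdx n 2 (by omega))
      let c := H.1 (thirdIdx hm hn) (thirdIdx hm hn)
      let d := H.1 (fourthIdx hm hn) (fourthIdx hm hn)
      ![a + b + a + b, a + b + a + c, a + a, a + b + c + d, a + b, 0] i := by
  have e1 := wtEval_wtEps (n := n) le_rfl (by omega : 1 ≤ m / 2) H (by omega)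
  have e2 := wtEval_wtEps (n := n) one_le_two (by omega : 2 ≤ m / 2) H (by omega)
  have f1 := wtEval_wtDelta (m := m) le_rfl hn.le H (by omega)
  let a := H.1 (evenIdx n 1 (by omega)) (evenIdx n 1 (by omega))
  let b := H.1 (evenIdx n 2 (by omega)) (evenIdx n 2 (by omega))
  let c := H.1 (thirdIdx hm hn) (thirdIdx hm hn)
  let d := H.1 (fourthIdx hm hn) (fourthIdx hm hn)
  have e3 : wtEval (if 6 ≤ m then 2 • wtEps m n 1 + wtEps m n 2 + wtEps m n 3
      else 2 • wtEps m n 1 + wtEps m n 2 + wtDelta m n 1) H = a + b + a + c := by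
    rcases thirdIdx_cases hm hn with ⟨h3, e⟩ | ⟨h3, e⟩
    · have e3 := wtEval_wtEps (n := n) (by omega : 1 ≤ 3) (by omega : 3 ≤ m / 2) H (by omega)
      rw [if_pos h3, wtEval_add, wtEval_add, wtEval_nsmul, e1, e2, e3]
      simp only [a, b, c, e]; push_cast; ring
    · rw [if_neg (by omega), wtEval_add, wtEval_add, wtEval_nsmul, e1, e2, f1]
      simp only [a, b, c, e]; push_cast; ring
  have e4 : wtEval (if 8 ≤ m then wtEps m n 1 + wtEps m n 2 + wtEps m n 3 + wtEps m n 4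
      else if 6 ≤ m then wtEps m n 1 + wtEps m n 2 + wtEps m n 3 + wtDelta m n 1
      else wtEps m n 1 + wtEps m n 2 + 2 • wtDelta m n 1) H = a + b + c + d := by
    rcases thirdIdx_cases hm hn with ⟨h3, e⟩ | ⟨h3, e⟩ <;>
      rcases fourthIdx_cases hm hn with ⟨h4, e'⟩ | ⟨h4, e'⟩
    · have e3 := wtEval_wtEps (n := n) (by omega : 1 ≤ 3) (by omega : 3 ≤ m / 2) H (by omega)
      have e4 := wtEval_wtEps (n := n) (by omega : 1 ≤ 4) (by omega : 4 ≤ m / 2) H (by omega)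
      rw [if_pos h4, wtEval_add, wtEval_add, wtEval_add, e1, e2, e3, e4]
      simp only [a, b, c, d, e, e']
    · have e3 := wtEval_wtEps (n := n) (by omega : 1 ≤ 3) (by omega : 3 ≤ m / 2) H (by omega)
      rw [if_neg (by omega), if_pos h3, wtEval_add, wtEval_add, wtEval_add, e1, e2, e3, f1]
      simp only [a, b, c, d, e, e']
    · omega
    · rw [if_neg (by omega), if_neg (by omega), wtEval_add, wtEval_add, wtEval_nsmul, e1, e2, f1]
      simp only [a, b, c, d, e, e']; push_cast; ring
  fin_cases i
  · refine ((wtEval_add _ _ _).trans (by rw [wtEval_nsmul, wtEval_nsmul, e1, e2])).trans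
      (?_ : _ = a + b + a + b)
    simp only [a, b]; push_cast; ring
  · exact e3
  · refine (wtEval_nsmul 2 _ H).trans (?_ : _ = a + a)
    rw [e1]; simp only [a]; push_cast; ring
  · exact e4
  · refine (wtEval_add _ _ _).trans (?_ : _ = a + b)
    rw [e1, e2]
  · exact wtEval_zero H

lemma isHighestWeightVector_nonstandard (hm : 4 < m) (hn : 1 < n)
    (h2 : (m : ℤ) - 2 * n ≠ 2) (h6 : ricciVec (metric2 m n) ≠ 0) (i : Fin 6) :
    IsHighestWeightVector (M := OspSq m n) (ospSqAct m n) (nonstandardSimpleRoots m n)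
      (nonstandardWeights m n i)
      (proj4 m n (nonstdVec (evenIdx n 1 (by omega)) (evenIdx n 2 (by omega)) (thirdIdx hm hn)
        (fourthIdx hm hn) i)) := by
  refine isHighestWeightVector_proj4 (sixVec_mem i)
    (nonstdVec_ne_zero (evenFrame_nonstd hm hn) h2 h6 i)
    (hasWeight_sixVec (fun H i => wtEval_nonstandardWeights hm hn H i) i) fun X hX => ?_
  have hz : ∀ a b, gradeFn (2 * n) 0 a ≤ gradeFn (2 * n) 0 b → X.1 a b = 0 := fun a b =>
    entry_eq_zero_of_isPositiveRootVector (fun α => nonstandardSimpleRoots_pos hm hn) hX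
  have hA : (0 : ℤ) ≤ 2 * n := by omega
  have heven : ∀ (k : ℕ) (hk : 2 * k + 1 < m) (x : OspIdx m n),
      (∀ i : Fin m, x = Sum.inl i → k ≤ i.val) → X.1 x (evenIdx n (k + 1) (by omega)) = 0 := by
    intro k hk x hx
    refine hz _ _ ?_
    rw [gradeFn_inl_of_lt _ _ (by simp; omega)]
    rcases x with i | j
    · have := hx i rfl
      exact (gradeFn_inl_le hA _ i).trans (by simp; omega)
    · exact (gradeFn_inr_le _ le_rfl j).trans (by simp; omega)
  -- δ₁ is dominated only by ε₁, …, ε_d. If m = 5 these are the labels a, b, and if m is 6 or 7 they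
  -- are a, b, c; removing them leaves even labels of degree at most zero.
  have hodd : ∀ x : OspIdx m n, (∀ i : Fin m, x = Sum.inl i → m ≤ 2 * i.val + 1) →
      X.1 x (oddIdx m 1 (by omega)) = 0 := by
    intro x hx
    refine hz _ _ ?_
    rw [gradeFn_inr_of_lt _ _ (by simp; omega)]
    rcases x with i | j
    · exact (gradeFn_inl_le_zero hA _ (hx i rfl)).trans (by simp; omega)
    · exact (gradeFn_inr_le _ le_rfl j).trans (by simp; omega)
  have hne : ∀ (k : ℕ) (hk : k < m) (i : Fin m), (Sum.inl i : OspIdx m n) ≠ Sum.inl ⟨k, hk⟩ →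
      i.val ≠ k := fun k hk i h e => h (congrArg Sum.inl (Fin.ext e))
  refine act4_nonstdVec_eq_zero rfl rfl (fun x => heven 0 (by omega) x (by simp)) (fun x hx => ?_)
    (fun x hx hx' => ?_) (fun x hx hx' hx'' => ?_) i
  · refine heven 1 (by omega) x ?_
    rintro i rfl
    have := hne _ _ _ hx
    omega
  · rcases thirdIdx_cases hm hn with ⟨h3, e⟩ | ⟨h3, e⟩ <;> rw [e]
    · refine heven 2 (by omega) x ?_
      rintro i rfl
      have := hne _ _ _ hx
      have := hne _ _ _ hx'
      omega
    · refine hodd x ?_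
      rintro i rfl
      have := hne _ _ _ hx
      have := hne _ _ _ hx'
      omega
  · rcases thirdIdx_cases hm hn with ⟨h3, e⟩ | ⟨h3, e⟩ <;>
      rcases fourthIdx_cases hm hn with ⟨h4, e'⟩ | ⟨h4, e'⟩ <;> rw [e] at hx'' <;> rw [e']
    · refine heven 3 (by omega) x ?_
      rintro i rfl
      have := hne _ _ _ hx
      have := hne _ _ _ hx'
      have := hne _ _ _ (fun h => zero_ne_one (hx'' h))
      omega
    · refine hodd x ?_
      rintro i rfl
      have := hne _ _ _ hx
      have := hne _ _ _ hx'
      have := hne _ _ _ (fun h => zero_ne_one (hx'' h))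
      omega
    · omega
    · refine hodd x ?_
      rintro i rfl
      have := hne _ _ _ hx
      have := hne _ _ _ hx'
      omega

end

theorem mainTheorem8 (m n : ℕ) (hm : 4 < m) (hn : 1 < n)
    (h0 : (m : ℤ) - 2 * n ≠ 0) (h1 : (m : ℤ) - 2 * n ≠ 1) (h2 : (m : ℤ) - 2 * n ≠ 2) :
    ∃ W : Fin 6 → Submodule ℂ (OspSq m n),
      DirectSum.IsInternal W ∧
      (∀ i, IsIrreducibleWithHighestWeight (M := OspSq m n) (ospSqAct m n) (ospSqPart m n)
        (nonstandardSimpleRoots m n) (nonstandardWeights m n i) (W i)) ∧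
      (∀ i, IsIrreducibleWithHighestWeight (M := OspSq m n) (ospSqAct m n) (ospSqPart m n)
        (standardSimpleRoots m n) (standardWeights m n i) (W i)) ∧
      ospSymSq m n = W 0 ⊔ W 2 ⊔ W 3 ⊔ W 5 := by
  have h := oddFrame_std (m := m) hn
  -- The invariant vector is common to both root systems, so its nonvanishing follows from its
  -- nonzero norm.
  have h6 : ricciVec (metric2 m n) ≠ 0 := fun e =>
    form4_stdVec_ne_zero h h0 h1 h2 5 (by
      change form4 m n (ricciVec (metric2 m n)) _ = 0
      rw [e, map_zero, LinearMap.zero_apply])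
  refine ⟨sqComponent m n, isInternal_sqComponent h h0 h1 h2,
    fun i => ⟨isIrreducibleSubrep_sqComponent h h0 h1 h2 i, _, ?_,
      isHighestWeightVector_nonstandard hm hn h2 h6 i⟩,
    fun i => ⟨isIrreducibleSubrep_sqComponent h h0 h1 h2 i, _, proj4_stdVec_mem h i,
      isHighestWeightVector_standard hm hn h0 h1 h2 i⟩,
    ospSymSq_eq h h0 h1 h2⟩
  -- Equality of `sep`-eigenvalues places the non-standard vector in the same summand as the
  -- standard one.
  exact proj4_mem_sqComponent (sixVec_mem i) (sep_nonstdVec (evenFrame_nonstd hm hn) i)
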